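/- **Conventions.** An *$\omega$-category* is a set $C$ with unary operators $d^-_n,d^+_n$ and partial binary operators $\#_n$ ($n\ge 0$) such that: $x\#_n y$ is defined iff $d^+_nx=d^-_ny$; every $x$ satisfies $d^-_nx=d^+_nx=x$ for some $n$; $d^\beta_md^\alpha_nx$ is $d^\beta_mx$ if $m<n$ and $d^\alpha_nx$ if $m\ge n$; $d^-_nx\#_nx=x=x\#_nd^+_nx$; if $x\#_ny$ is defined, then $d^\alpha_m(x\#_ny)=d^\alpha_mx=d^\alpha_my=d^\alpha_mx\#_nd^\alpha_my$ for $m<n$, $d^-_n(x\#_ny)=d^-_nx$, $d^+_n(x\#_ny)=d^+_ny$, and $d^\alpha_m(x\#_ny)=d^\alpha_mx\#_nd^\alpha_my$ for $m>n$; $(x\#_ny)\#_nz=x\#_n(y\#_nz)$ if either side is defined; and $(x\#_ny)\#_m(x'\#_ny')=(x\#_mx')\#_n(y\#_my')$ for $m<n$ when the left side is defined. Morphisms preserve all the operators. Put $C_n=\{x\in C: d^-_nx=x\}$. An *augmented directed complex* (ADC) is a nonnegatively graded chain complex of abelian groups $(K_n,\partial)$ with an augmentation $\varepsilon:K_0\to\mathbf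 Z$, $\varepsilon\partial=0$, and a submonoid $K_n^*\subset K_n$ for each $n$. Morphisms are augmentation-preserving chain maps that send $K_n^*$ into $L_n^*$. For an $\omega$-category $C$, the ADC $\lambda C$ has $(\lambda C)_n$ generated by the symbols $[x]_n$ ($x\in C_n$) subject to $[x\#_my]_n=[x]_n+[y]_n$ for $m<n$, with $\partial[x]_{n+1}=[d^+_nx]_n-[d^-_nx]_n$ and $\varepsilon[x]_0=1$, and $(\lambda C)_n^*$ is the submonoid generated by the $[x]_n$. For an ADC $K$, the $\omega$-category $\nu K$ consists of the double sequences $x=(x^-_0,x^+_0,x^-_1,x^+_1,\dots)$ with $x^\alpha_n\in K^*_n$, almost all $x^\alpha_n$ zero, $x^+_n-x^-_n=\partial x^-_{n+1}=\partial x^+_{n+1}$ and $\varepsilon x^\pm_0=1$; here $d^\alpha_nx=(x^-_0,x^+_0,\dots,x^-_{n-1},x^+_{n-1},x^\alpha_n,x^\alpha_n,0,0,\dots)$, and $x\#_ny=x-d^+_nx+y$. The functor $\lambda$ is left adjoint to $\nu$, with unit $\eta x=([d^-_0x]_0,[d^+_0x]_0,[d^-_1x]_1,[d^+_1x]_1,\dots)$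 and counit $\pi[x]_n=x^-_n=x^+_n$ ($x\in(\nu K)_n$). A *basis* of an ADC $K$ is a set $B\subset\bigsqcup_nK_n$ such that each $K_n$ is free abelian on $B\cap K_n$ and each $K^*_n$ is the submonoid generated by $B\cap K_n$; it is unique if it exists. Write $|b|=n$ for $b\in B\cap K_n$. For $x,y\in K_n$ write $x\le y$ if $y-x\in K_n^*$, and let $x\wedge y$ be the greatest lower bound. Let $\partial^+x$ and $\partial^-x$ be the positive and negative parts of $\partial x$ with respect to $B$. For $b\in B$ let $\langle b\rangle^\alpha_n$ be $0$ for $n>|b|$, $b$ for $n=|b|$, and $\partial^\alpha\langle b\rangle^\alpha_{n+1}$ for $n<|b|$. The basis $B$ is *unital* if $\varepsilon\langle b\rangle^-_0=\varepsilon\langle b\rangle^+_0=1$ for all $b\in B$; *loop-free* if there are partial orders $\le_0,\le_1,\dots$ on $B$ such that $a<_nb$ whenever $|a|,|b|>n$ and $\langle a\rangle^+_n\wedge\langle b\rangle^-_n>0$; *strongly loop-free* if there is a partial order $\le_{\mathbf N}$ on $B$ such that $a<_{\mathbf N}b$ whenever $a\le\partial^-b$ or $b\le\partial^+a$. A *basis*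 of an $\omega$-category $C$ is a subset $E$ with a dimension $|e|\in\mathbf N$ for each $e\in E$ such that, for each $n$, $C_n$ is the set of composites (under the operators $\#_m$) of elements of $E$ of dimension at most $n$, and such that $e\mapsto[e]_{|e|}$ is a bijection from $E$ onto a basis of $\lambda C$. It is *atomic* if $[d^-_ne]_n\wedge[d^+_ne]_n=0$ for $e\in E$ and $n<|e|$, and *(strongly) loop-free* if the corresponding basis of $\lambda C$ is. **Theorem 5.11.** The functors $\lambda$ and $\nu$, with the unit $\eta$ and counit $\pi$, restrict to an adjoint equivalence between the full subcategory of $\omega$-categories with loop-free atomic bases and the full subcategory of ADCs with loop-free unital bases. Under this equivalence, the $\omega$-categories with strongly loop-free atomic bases correspond to the ADCs with strongly loop-free unital bases. That is: these classes are contained in the two subcategories above; an $\omega$-category $C$ with a loop-free atomic basis has a strongly loop-free atomic basis if and only if $\lambda C$ has a strongly loop-free unital basis; an ADC $K$ with a loop-free unital basis has a strongly loop-free unital basis if and only if $\nu K$ has a strongly loop-free atomic basis; and $\lambda$, $\nu$, $\eta$, $\pi$ also restrict to an adjoint equivalence between the two full subcategories of the strongly loop-free objects. -/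

import Mathlib

open CategoryTheory

universe u

namespace Steiner

/-! ## Strict omega-categories (single-sorted) -/

/-- The signs `-` (source) and `+` (target). -/
inductive Sgn : Type
  | neg
  | pos

/-- A strict `ω`-category: a set with source operators `d .neg n`, target operators `d .pos n`,
and partial compositions `comp n x y` (written `x #ₙ y`), defined exactly when
`d .pos n x = d .neg n y`. In every axiom, the hypotheses of the form `d .pos _ _ = d .neg _ _`
beyond the ones that define the composites on one side follow from the other axioms. -/
structure OmegaCat where
  carrier : Type u
  d : Sgn → ℕ → carrier → carrier
  comp : ∀ (n : ℕ) (x y : carrier), d .pos n x = d .neg n y → carrier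
  exists_dim : ∀ x, ∃ n, d .neg n x = x ∧ d .pos n x = x
  d_d_of_lt : ∀ {m n : ℕ}, m < n → ∀ (β α : Sgn) (x : carrier), d β m (d α n x) = d β m x
  d_d_of_le : ∀ {m n : ℕ}, n ≤ m → ∀ (β α : Sgn) (x : carrier), d β m (d α n x) = d α n x
  id_comp : ∀ (n : ℕ) (x : carrier) (h : d .pos n (d .neg n x) = d .neg n x),
    comp n (d .neg n x) x h = x
  comp_id : ∀ (n : ℕ) (x : carrier) (h : d .pos n x = d .neg n (d .pos n x)),
    comp n x (d .pos n x) h = x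
  d_comp_of_lt : ∀ {m n : ℕ}, m < n → ∀ (α : Sgn) (x y : carrier)
    (h : d .pos n x = d .neg n y) (h' : d .pos n (d α m x) = d .neg n (d α m y)),
    d α m (comp n x y h) = d α m x ∧ d α m x = d α m y ∧
      d α m y = comp n (d α m x) (d α m y) h'
  d_neg_comp : ∀ (n : ℕ) (x y : carrier) (h : d .pos n x = d .neg n y),
    d .neg n (comp n x y h) = d .neg n x
  d_pos_comp : ∀ (n : ℕ) (x y : carrier) (h : d .pos n x = d .neg n y),
    d .pos n (comp n x y h) = d .pos n y
  d_comp_of_gt : ∀ {m n : ℕ}, n < m → ∀ (α : Sgn) (x y : carrier)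
    (h : d .pos n x = d .neg n y) (h' : d .pos n (d α m x) = d .neg n (d α m y)),
    d α m (comp n x y h) = comp n (d α m x) (d α m y) h'
  assoc : ∀ (n : ℕ) (x y z : carrier) (hxy : d .pos n x = d .neg n y)
    (hyz : d .pos n y = d .neg n z)
    (h : d .pos n (comp n x y hxy) = d .neg n z)
    (h' : d .pos n x = d .neg n (comp n y z hyz)),
    comp n (comp n x y hxy) z h = comp n x (comp n y z hyz) h'
  interchange : ∀ {m n : ℕ}, m < n → ∀ (x y x' y' : carrier)
    (hxy : d .pos n x = d .neg n y) (hxy' : d .pos n x' = d .neg n y')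
    (hm : d .pos m (comp n x y hxy) = d .neg m (comp n x' y' hxy'))
    (hx : d .pos m x = d .neg m x') (hy : d .pos m y = d .neg m y')
    (hn : d .pos n (comp m x x' hx) = d .neg n (comp m y y' hy)),
    comp m (comp n x y hxy) (comp n x' y' hxy') hm =
      comp n (comp m x x' hx) (comp m y y' hy) hn

namespace OmegaCat

/-- A morphism of `ω`-categories. -/
@[ext]
structure Hom (C D : OmegaCat.{u}) where
  toFun : C.carrier → D.carrier
  map_d : ∀ (α : Sgn) (n : ℕ) (x : C.carrier), toFun (C.d α n x) = D.d α n (toFun x)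
  map_comp : ∀ (n : ℕ) (x y : C.carrier) (h : C.d .pos n x = C.d .neg n y)
    (h' : D.d .pos n (toFun x) = D.d .neg n (toFun y)),
    toFun (C.comp n x y h) = D.comp n (toFun x) (toFun y) h'

theorem Hom.comp_cond {C D : OmegaCat.{u}} (f : Hom C D) {n : ℕ} {x y : C.carrier}
    (h : C.d .pos n x = C.d .neg n y) :
    D.d .pos n (f.toFun x) = D.d .neg n (f.toFun y) := by
  rw [← f.map_d, ← f.map_d, h]

instance : Category OmegaCat.{u} where
  Hom := Hom
  id C := ⟨id, fun _ _ _ => rfl, fun _ _ _ _ _ => rfl⟩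
  comp f g := ⟨g.toFun ∘ f.toFun, fun α n x => by simp [f.map_d, g.map_d],
    fun n x y h h' => by
      simp only [Function.comp]
      rw [f.map_comp n x y h (f.comp_cond h), g.map_comp]⟩

@[ext]
theorem hom_ext {C D : OmegaCat.{u}} {f g : C ⟶ D}
    (h : ∀ x, Hom.toFun f x = Hom.toFun g x) : f = g :=
  Hom.ext (funext h)

variable (C : OmegaCat.{u})

/-- The `n`-th stage `Cₙ = {x | dₙ⁻ x = x}` of the standard filtration. -/
def Level (n : ℕ) : Type u := {x : C.carrier // C.d .neg n x = x}

variable {C}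

theorem d_of_neg {n : ℕ} {x : C.carrier} (h : C.d .neg n x = x) (α : Sgn) : C.d α n x = x := by
  rw [← h, C.d_d_of_le le_rfl]

theorem d_of_level {n m : ℕ} (x : C.Level n) (h : n ≤ m) (α : Sgn) : C.d α m x.1 = x.1 := by
  rw [← x.2, C.d_d_of_le h]

variable (C) in
/-- The operator `d α n`, as a map to `Cₙ`. -/
def trunc (α : Sgn) (n : ℕ) (x : C.carrier) : C.Level n :=
  ⟨C.d α n x, C.d_d_of_le le_rfl _ _ _⟩

theorem trunc_level (α : Sgn) {n : ℕ} (x : C.Level n) : C.trunc α n x.1 = x :=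
  Subtype.ext (d_of_level x le_rfl α)

/-- The action of a morphism on `Cₙ`. -/
def Hom.level {D : OmegaCat.{u}} (f : Hom C D) (n : ℕ) (x : C.Level n) : D.Level n :=
  ⟨f.toFun x.1, by rw [← f.map_d, x.2]⟩

theorem cond_d_lt {m n : ℕ} (h : m < n) (α : Sgn) {x y : C.carrier}
    (hxy : C.d .pos m x = C.d .neg m y) :
    C.d .pos m (C.d α n x) = C.d .neg m (C.d α n y) := by
  rw [C.d_d_of_lt h, C.d_d_of_lt h, hxy]

theorem cond_d_gt {m n : ℕ} (h : m < n) (α : Sgn) {x y : C.carrier}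
    (hxy : C.d .pos n x = C.d .neg n y) : C.d α m x = C.d α m y := by
  rw [← C.d_d_of_lt h α .pos x, hxy, C.d_d_of_lt h]

/-! ### The chain groups of `λ C` -/

variable (C) in
/-- The relations `[x #ₘ y] = [x] + [y]` for `m < n` and `x, y, x #ₘ y ∈ Cₙ`. -/
def lamRel (n : ℕ) : Set (FreeAbelianGroup (C.Level n)) :=
  {r | ∃ (m : ℕ) (_ : m < n) (x y z : C.Level n) (h : C.d .pos m x.1 = C.d .neg m y.1),
    z.1 = C.comp m x.1 y.1 h ∧
    r = FreeAbelianGroup.of z - (FreeAbelianGroup.of x + FreeAbelianGroup.of y)}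

variable (C) in
/-- The chain group `(λ C)ₙ`. -/
abbrev LamGroup (n : ℕ) : Type u :=
  FreeAbelianGroup (C.Level n) ⧸ AddSubgroup.closure (C.lamRel n)

/-- The generator `[x]ₙ` of `(λ C)ₙ`, for `x ∈ Cₙ`. -/
def cls {n : ℕ} (x : C.Level n) : C.LamGroup n :=
  QuotientAddGroup.mk (FreeAbelianGroup.of x)

theorem cls_comp {n m : ℕ} (hm : m < n) (x y z : C.Level n)
    (h : C.d .pos m x.1 = C.d .neg m y.1) (hz : z.1 = C.comp m x.1 y.1 h) :
    cls z = cls x + cls y := by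
  have : cls x + cls y =
      ((FreeAbelianGroup.of x + FreeAbelianGroup.of y :) : C.LamGroup n) := rfl
  rw [this]
  refine (QuotientAddGroup.eq_iff_sub_mem).2 ?_
  exact AddSubgroup.subset_closure ⟨m, hm, x, y, z, h, hz, rfl⟩

theorem cls_eq_zero {n m : ℕ} (hm : m < n) (x : C.Level n) (h : C.d .neg m x.1 = x.1) :
    cls x = 0 := by
  have h1 : C.d .pos m x.1 = x.1 := d_of_neg h .pos
  have h2 : C.d .pos m x.1 = C.d .neg m (C.d .pos m x.1) := by rw [h1, h]
  have h3 := C.comp_id m x.1 h2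
  have h4 : x.1 = C.comp m x.1 x.1 (by rw [h1, h]) := by
    conv_lhs => rw [← h3]
    congr 1
  have := cls_comp hm x x x _ h4
  simpa using this

/-- The homomorphism from `(λ C)ₙ` given by a function on `Cₙ` compatible with the relations. -/
def lamLift {A : Type*} [AddCommGroup A] {n : ℕ} (f : C.Level n → A)
    (hf : ∀ (m : ℕ) (_ : m < n) (x y z : C.Level n) (h : C.d .pos m x.1 = C.d .neg m y.1),
      z.1 = C.comp m x.1 y.1 h → f z = f x + f y) : C.LamGroup n →+ A :=
  QuotientAddGroup.lift _ (FreeAbelianGroup.lift f) (by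
    rw [AddSubgroup.closure_le]
    rintro r ⟨m, hm, x, y, z, h, hz, rfl⟩
    simp [hf m hm x y z h hz])

@[simp]
theorem lamLift_cls {A : Type*} [AddCommGroup A] {n : ℕ} (f : C.Level n → A) (hf)
    (x : C.Level n) : lamLift f hf (cls x) = f x := by
  simp [lamLift, cls]

theorem lamGroup_hom_ext {A : Type*} [AddCommGroup A] {n : ℕ} {f g : C.LamGroup n →+ A}
    (h : ∀ x : C.Level n, f (cls x) = g (cls x)) : f = g := by
  apply QuotientAddGroup.addMonoidHom_ext
  apply FreeAbelianGroup.lift_ext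
  exact h

variable (C) in
/-- The boundary `∂ [x]ₙ₊₁ = [dₙ⁺ x]ₙ - [dₙ⁻ x]ₙ`. -/
def lamBd (n : ℕ) : C.LamGroup (n + 1) →+ C.LamGroup n :=
  lamLift (fun x => cls (C.trunc .pos n x.1) - cls (C.trunc .neg n x.1)) (by
    intro m hm x y z h hz
    rcases Nat.lt_succ_iff_lt_or_eq.1 hm with hmn | rfl
    · have key : ∀ α : Sgn, cls (C.trunc α n z.1) =
          cls (C.trunc α n x.1) + cls (C.trunc α n y.1) := by
        intro α
        refine cls_comp hmn _ _ _ (cond_d_lt hmn α h) ?_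
        change C.d α n z.1 = _
        rw [hz]
        exact C.d_comp_of_gt hmn α _ _ h _
      rw [key, key]
      abel
    · have h1 : C.trunc .pos m z.1 = C.trunc .pos m y.1 :=
        Subtype.ext (by simp only [trunc, hz]; exact C.d_pos_comp _ _ _ h)
      have h2 : C.trunc .neg m z.1 = C.trunc .neg m x.1 :=
        Subtype.ext (by simp only [trunc, hz]; exact C.d_neg_comp _ _ _ h)
      have h3 : C.trunc .pos m x.1 = C.trunc .neg m y.1 := Subtype.ext h
      rw [h1, h2, h3]
      abel)

@[simp]
theorem lamBd_cls {n : ℕ} (x : C.Level (n + 1)) :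
    C.lamBd n (cls x) = cls (C.trunc .pos n x.1) - cls (C.trunc .neg n x.1) :=
  lamLift_cls _ _ x

theorem lamBd_lamBd (n : ℕ) (x : C.LamGroup (n + 1 + 1)) : C.lamBd n (C.lamBd (n + 1) x) = 0 := by
  have : (C.lamBd n).comp (C.lamBd (n + 1)) = 0 := by
    apply lamGroup_hom_ext
    intro x
    have h : ∀ α β : Sgn, C.trunc α n (C.trunc β (n + 1) x.1).1 = C.trunc α n x.1 := fun α β =>
      Subtype.ext (C.d_d_of_lt (Nat.lt_succ_self n) α β x.1)
    simp [h]
  exact DFunLike.congr_fun this x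

variable (C) in
/-- The augmentation `ε [x]₀ = 1`. -/
def lamAug : C.LamGroup 0 →+ ℤ :=
  lamLift (fun _ => 1) (fun m hm => absurd hm (Nat.not_lt_zero m))

@[simp]
theorem lamAug_cls (x : C.Level 0) : C.lamAug (cls x) = 1 := lamLift_cls _ _ x

/-- The homomorphism `[x]ₙ ↦ [f x]ₙ` induced by a morphism `f`. -/
def lamMap {D : OmegaCat.{u}} (f : Hom C D) (n : ℕ) : C.LamGroup n →+ D.LamGroup n :=
  lamLift (fun x => cls (f.level n x)) (fun m hm x y z h hz =>
    cls_comp hm _ _ _ (f.comp_cond h) (by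
      change f.toFun z.1 = _
      rw [hz]
      exact f.map_comp m _ _ h _))

@[simp]
theorem lamMap_cls {D : OmegaCat.{u}} (f : Hom C D) {n : ℕ} (x : C.Level n) :
    lamMap f n (cls x) = cls (f.level n x) :=
  lamLift_cls _ _ x

end OmegaCat

/-! ## Augmented directed complexes -/

/-- An augmented directed complex: an augmented chain complex of abelian groups in nonnegative
degrees, with a distinguished submonoid of each chain group. -/
structure ADC where
  cx : ChainComplex AddCommGrpCat.{u} ℕ
  aug : cx.X 0 →+ ℤ
  aug_d : ∀ x : cx.X 1, aug ((cx.d 1 0).hom x) = 0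
  pos : ∀ n, AddSubmonoid (cx.X n)

namespace ADC

/-- The chain group `Kₙ`. -/
abbrev X (K : ADC.{u}) (n : ℕ) : Type u := K.cx.X n

/-- The boundary `∂ : Kₙ₊₁ → Kₙ`. -/
def bd (K : ADC.{u}) (n : ℕ) : K.X (n + 1) →+ K.X n := (K.cx.d (n + 1) n).hom

theorem aug_bd (K : ADC.{u}) (x : K.X 1) : K.aug (K.bd 0 x) = 0 := K.aug_d x

theorem bd_bd (K : ADC.{u}) (n : ℕ) (x : K.X (n + 1 + 1)) : K.bd n (K.bd (n + 1) x) = 0 := by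
  have := K.cx.d_comp_d (n + 1 + 1) (n + 1) n
  exact DFunLike.congr_fun (congrArg AddCommGrpCat.Hom.hom this) x

/-- A morphism of augmented directed complexes: an augmentation-preserving chain map that maps
distinguished submonoids into distinguished submonoids. -/
@[ext]
structure Hom (K L : ADC.{u}) where
  map : K.cx ⟶ L.cx
  aug_map : ∀ x : K.X 0, L.aug ((map.f 0).hom x) = K.aug x
  map_pos : ∀ (n : ℕ) (x : K.X n), x ∈ K.pos n → (map.f n).hom x ∈ L.pos n

instance : Category ADC.{u} where
  Hom := Hom
  id K := ⟨𝟙 _, fun _ => rfl, fun _ _ h => h⟩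
  comp f g := ⟨f.map ≫ g.map, fun x => (g.aug_map _).trans (f.aug_map x),
    fun n x h => g.map_pos n _ (f.map_pos n x h)⟩

/-- The `n`-th component of a morphism. -/
def Hom.app {K L : ADC.{u}} (f : Hom K L) (n : ℕ) : K.X n →+ L.X n := (f.map.f n).hom

theorem Hom.app_bd {K L : ADC.{u}} (f : Hom K L) (n : ℕ) (x : K.X (n + 1)) :
    f.app n (K.bd n x) = L.bd n (f.app (n + 1) x) :=
  (DFunLike.congr_fun (congrArg AddCommGrpCat.Hom.hom (f.map.comm (n + 1) n)) x).symm

@[ext]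
theorem hom_ext {K L : ADC.{u}} {f g : K ⟶ L}
    (h : ∀ n, Hom.app f n = Hom.app g n) : f = g := by
  apply Hom.ext
  apply HomologicalComplex.hom_ext
  intro n
  exact AddCommGrpCat.hom_ext (h n)

/-- Construct a morphism from its components. -/
def homMk {K L : ADC.{u}} (f : ∀ n, K.X n →+ L.X n)
    (hbd : ∀ n x, f n (K.bd n x) = L.bd n (f (n + 1) x))
    (haug : ∀ x, L.aug (f 0 x) = K.aug x)
    (hpos : ∀ n x, x ∈ K.pos n → f n x ∈ L.pos n) : Hom K L where
  map := ChainComplex.ofHom (fun n => AddCommGrpCat.ofHom (f n))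
    (fun n => AddCommGrpCat.hom_ext (AddMonoidHom.ext fun x => (hbd n x).symm))
  aug_map := haug
  map_pos := hpos

end ADC

/-! ## The functor `λ` -/

/-- The augmented directed complex `λ C`. -/
def lamObj (C : OmegaCat.{u}) : ADC.{u} where
  cx := ChainComplex.of (fun n => AddCommGrpCat.of (C.LamGroup n))
    (fun n => AddCommGrpCat.ofHom (C.lamBd n))
    (fun n => AddCommGrpCat.hom_ext (AddMonoidHom.ext fun x => OmegaCat.lamBd_lamBd n x))
  aug := C.lamAug
  aug_d x := by
    have : C.lamAug.comp (C.lamBd 0) = 0 := OmegaCat.lamGroup_hom_ext (fun x => by simp)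
    exact DFunLike.congr_fun this x
  pos n := AddSubmonoid.closure (Set.range (OmegaCat.cls (C := C) (n := n)))

theorem lamObj_bd (C : OmegaCat.{u}) (n : ℕ) : (lamObj C).bd n = C.lamBd n := by
  have := ChainComplex.of_d (fun n => AddCommGrpCat.of (C.LamGroup n))
    (fun n => AddCommGrpCat.ofHom (C.lamBd n)) n
  exact congrArg AddCommGrpCat.Hom.hom this

/-- The functor `λ` from `ω`-categories to augmented directed complexes. -/
def lam : OmegaCat.{u} ⥤ ADC.{u} where
  obj := lamObj
  map {C D} f := ADC.homMk (K := lamObj C) (L := lamObj D) (OmegaCat.lamMap f)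
    (fun n x => by
      rw [lamObj_bd, lamObj_bd]
      have : (OmegaCat.lamMap f n).comp (C.lamBd n) =
          (D.lamBd n).comp (OmegaCat.lamMap f (n + 1)) := by
        apply OmegaCat.lamGroup_hom_ext
        intro x
        have h : ∀ α, OmegaCat.Hom.level f n (C.trunc α n x.1) =
            D.trunc α n (OmegaCat.Hom.level f (n + 1) x).1 := fun α =>
          Subtype.ext (OmegaCat.Hom.map_d f α n x.1)
        simp [h]
      exact DFunLike.congr_fun this x)
    (fun x => by
      have : D.lamAug.comp (OmegaCat.lamMap f 0) = C.lamAug :=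
        OmegaCat.lamGroup_hom_ext (fun x => by simp)
      exact DFunLike.congr_fun this x)
    (fun n x hx => by
      have : AddSubmonoid.closure (Set.range (OmegaCat.cls (C := C) (n := n))) ≤
          (AddSubmonoid.closure (Set.range (OmegaCat.cls (C := D) (n := n)))).comap
            (OmegaCat.lamMap f n) := by
        rw [AddSubmonoid.closure_le]
        rintro _ ⟨x, rfl⟩
        exact AddSubmonoid.subset_closure ⟨_, (OmegaCat.lamMap_cls f x).symm⟩
      exact this hx)
  map_id C := by
    apply ADC.hom_ext
    intro n
    exact OmegaCat.lamGroup_hom_ext (C := C) fun x => OmegaCat.lamMap_cls (𝟙 C) x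
  map_comp {C D E} f g := by
    apply ADC.hom_ext
    intro n
    refine OmegaCat.lamGroup_hom_ext (C := C) fun x => ?_
    refine (OmegaCat.lamMap_cls (f ≫ g) x).trans ?_
    symm
    change OmegaCat.lamMap g n (OmegaCat.lamMap f n (OmegaCat.cls x)) = _
    rw [OmegaCat.lamMap_cls, OmegaCat.lamMap_cls]
    rfl

/-! ## The functor `ν` -/

namespace ADC

/-- Double sequences `(x₀⁻, x₀⁺, x₁⁻, x₁⁺, …)` with `xₙᵅ ∈ Kₙ`. -/
abbrev DSeq (K : ADC.{u}) : Type u := Sgn → ∀ n, K.X n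

/-- The operator `(x₀⁻, x₀⁺, …) ↦ (x₀⁻, x₀⁺, …, xₙ₋₁⁻, xₙ₋₁⁺, xₙᵅ, xₙᵅ, 0, 0, …)`. -/
def dseq (K : ADC.{u}) (α : Sgn) (n : ℕ) : K.DSeq →+ K.DSeq where
  toFun x := fun β m => if m < n then x β m else if m = n then x α m else 0
  map_zero' := by
    funext β m
    simp
  map_add' x y := by
    funext β m
    simp only [Pi.add_apply]
    split_ifs <;> simp

variable {K : ADC.{u}}

theorem dseq_of_lt {α β : Sgn} {n m : ℕ} (x : K.DSeq) (h : m < n) :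
    K.dseq α n x β m = x β m := if_pos h

theorem dseq_self (α β : Sgn) (n : ℕ) (x : K.DSeq) : K.dseq α n x β n = x α n := by
  simp [dseq]

theorem dseq_of_gt {α β : Sgn} {n m : ℕ} (x : K.DSeq) (h : n < m) :
    K.dseq α n x β m = 0 := by
  simp [dseq, h.not_gt, h.ne']

theorem dseq_dseq_of_lt {m n : ℕ} (h : m < n) (β α : Sgn) (x : K.DSeq) :
    K.dseq β m (K.dseq α n x) = K.dseq β m x := by
  funext γ k
  rcases lt_trichotomy k m with hk | rfl | hk
  · rw [dseq_of_lt _ hk, dseq_of_lt _ hk, dseq_of_lt _ (hk.trans h)]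
  · rw [dseq_self, dseq_self, dseq_of_lt _ h]
  · rw [dseq_of_gt _ hk, dseq_of_gt _ hk]

theorem dseq_dseq_of_le {m n : ℕ} (h : n ≤ m) (β α : Sgn) (x : K.DSeq) :
    K.dseq β m (K.dseq α n x) = K.dseq α n x := by
  funext γ k
  rcases lt_trichotomy k m with hk | rfl | hk
  · rw [dseq_of_lt _ hk]
  · rw [dseq_self]
    rcases h.lt_or_eq with h | rfl
    · rw [dseq_of_gt _ h, dseq_of_gt _ h]
    · rw [dseq_self, dseq_self]
  · rw [dseq_of_gt _ hk, dseq_of_gt _ (h.trans_lt hk)]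

/-- The double sequences that belong to `ν K`. -/
structure IsNu (x : K.DSeq) : Prop where
  finite : ∃ N, ∀ n, N ≤ n → ∀ α, x α n = 0
  bd : ∀ n α, K.bd n (x α (n + 1)) = x .pos n - x .neg n
  pos : ∀ n α, x α n ∈ K.pos n
  aug : ∀ α, K.aug (x α 0) = 1

theorem IsNu.dseq {x : K.DSeq} (hx : IsNu x) (α : Sgn) (n : ℕ) : IsNu (K.dseq α n x) where
  finite := ⟨n + 1, fun m hm _ => dseq_of_gt _ hm⟩
  bd m β := by
    rcases lt_trichotomy m n with h | rfl | h
    · rw [dseq_of_lt _ h, dseq_of_lt _ h]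
      rcases (Nat.succ_le_of_lt h).lt_or_eq with h' | rfl
      · rw [dseq_of_lt _ h', hx.bd]
      · rw [dseq_self, hx.bd]
    · rw [dseq_of_gt _ (Nat.lt_succ_self m), dseq_self, dseq_self, map_zero, sub_self]
    · rw [dseq_of_gt _ (h.trans (Nat.lt_succ_self m)), dseq_of_gt _ h, dseq_of_gt _ h, map_zero,
        sub_self]
  pos m β := by
    simp only [ADC.dseq, AddMonoidHom.coe_mk, ZeroHom.coe_mk]
    split_ifs
    exacts [hx.pos _ _, hx.pos _ _, zero_mem _]
  aug β := by
    rcases Nat.eq_zero_or_pos n with rfl | h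
    · rw [dseq_self, hx.aug]
    · rw [dseq_of_lt _ h, hx.aug]

/-- The composite `x #ₙ y = x - z + y`, where `z = dₙ⁺ x = dₙ⁻ y`. -/
def compSeq (n : ℕ) (x y : K.DSeq) : K.DSeq := x - K.dseq .pos n x + y

section compSeq

variable {n : ℕ} {x y : K.DSeq}

theorem compSeq_lt_aux (h : K.dseq .pos n x = K.dseq .neg n y) {m : ℕ} (hm : m < n) (α : Sgn) : x α m = y α m := by
  have := congrFun (congrFun h α) m
  rwa [dseq_of_lt _ hm, dseq_of_lt _ hm] at this

theorem compSeq_self_aux (h : K.dseq .pos n x = K.dseq .neg n y) : x .pos n = y .neg n := by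
  have := congrFun (congrFun h .pos) n
  rwa [dseq_self, dseq_self] at this

theorem compSeq_of_lt {m : ℕ} (hm : m < n) (α : Sgn) : compSeq n x y α m = y α m := by
  simp [compSeq, dseq_of_lt _ hm]

theorem compSeq_of_gt {m : ℕ} (hm : n < m) (α : Sgn) : compSeq n x y α m = x α m + y α m := by
  simp [compSeq, dseq_of_gt _ hm]

theorem compSeq_pos : compSeq n x y .pos n = y .pos n := by
  simp [compSeq, dseq_self]

theorem compSeq_neg (h : K.dseq .pos n x = K.dseq .neg n y) :
    compSeq n x y .neg n = x .neg n := by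
  simp [compSeq, dseq_self, compSeq_self_aux h]

end compSeq

theorem IsNu.comp {n : ℕ} {x y : K.DSeq} (hx : IsNu x) (hy : IsNu y)
    (h : K.dseq .pos n x = K.dseq .neg n y) : IsNu (compSeq n x y) where
  finite := by
    obtain ⟨N, hN⟩ := hx.finite
    obtain ⟨M, hM⟩ := hy.finite
    refine ⟨N + M + n + 1, fun m hm α => ?_⟩
    rw [compSeq_of_gt (by omega), hN _ (by omega), hM _ (by omega), add_zero]
  bd m α := by
    rcases lt_trichotomy m n with hm | rfl | hm
    · rw [compSeq_of_lt hm, compSeq_of_lt hm, ← hy.bd m α]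
      rcases (Nat.succ_le_of_lt hm).lt_or_eq with h' | h'
      · rw [compSeq_of_lt h']
      · subst h'
        cases α
        · rw [compSeq_neg h, hx.bd, hy.bd, compSeq_lt_aux h hm, compSeq_lt_aux h hm]
        · rw [compSeq_pos]
    · rw [compSeq_of_gt (Nat.lt_succ_self m), compSeq_pos, compSeq_neg h, map_add, hx.bd, hy.bd,
        compSeq_self_aux h]
      abel
    · rw [compSeq_of_gt hm, compSeq_of_gt hm, compSeq_of_gt (hm.trans (Nat.lt_succ_self m)),
        map_add, hx.bd, hy.bd]
      abel
  pos m α := by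
    rcases lt_trichotomy m n with hm | rfl | hm
    · rw [compSeq_of_lt hm]
      exact hy.pos _ _
    · cases α
      · rw [compSeq_neg h]
        exact hx.pos _ _
      · rw [compSeq_pos]
        exact hy.pos _ _
    · rw [compSeq_of_gt hm]
      exact add_mem (hx.pos _ _) (hy.pos _ _)
  aug α := by
    rcases Nat.eq_zero_or_pos n with rfl | hn
    · cases α
      · rw [compSeq_neg h, hx.aug]
      · rw [compSeq_pos, hy.aug]
    · rw [compSeq_of_lt hn, hy.aug]

end ADC

/-- The `ω`-category `ν K`. -/
def nuObj (K : ADC.{u}) : OmegaCat.{u} where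
  carrier := {x : K.DSeq // ADC.IsNu x}
  d α n x := ⟨K.dseq α n x.1, x.2.dseq α n⟩
  comp n x y h := ⟨ADC.compSeq n x.1 y.1, x.2.comp y.2 (congrArg Subtype.val h)⟩
  exists_dim x := by
    obtain ⟨N, hN⟩ := x.2.finite
    have : ∀ α, K.dseq α N x.1 = x.1 := by
      intro α
      funext β m
      rcases lt_trichotomy m N with h | rfl | h
      · rw [ADC.dseq_of_lt _ h]
      · rw [ADC.dseq_self, hN _ le_rfl, hN _ le_rfl]
      · rw [ADC.dseq_of_gt _ h, hN _ h.le]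
    exact ⟨N, Subtype.ext (this _), Subtype.ext (this _)⟩
  d_d_of_lt h β α x := Subtype.ext (ADC.dseq_dseq_of_lt h β α x.1)
  d_d_of_le h β α x := Subtype.ext (ADC.dseq_dseq_of_le h β α x.1)
  id_comp n x h := Subtype.ext (by
    simp only [ADC.compSeq]
    rw [ADC.dseq_dseq_of_le le_rfl]
    abel)
  comp_id n x h := Subtype.ext (by
    simp only [ADC.compSeq]
    abel)
  d_comp_of_lt {m n} hmn α x y h h' := by
    have h1 : K.dseq .pos n x.1 = K.dseq .neg n y.1 := congrArg Subtype.val h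
    have h2 : K.dseq α m x.1 = K.dseq α m y.1 := by
      rw [← ADC.dseq_dseq_of_lt hmn α .pos x.1, h1, ADC.dseq_dseq_of_lt hmn]
    refine ⟨Subtype.ext ?_, Subtype.ext h2, Subtype.ext ?_⟩
    · simp only [ADC.compSeq, map_add, map_sub, ADC.dseq_dseq_of_lt hmn, h2]
      abel
    · simp only [ADC.compSeq, ADC.dseq_dseq_of_le hmn.le]
      abel
  d_neg_comp n x y h := Subtype.ext (by
    have h1 : K.dseq .pos n x.1 = K.dseq .neg n y.1 := congrArg Subtype.val h
    simp only [ADC.compSeq, map_add, map_sub, ADC.dseq_dseq_of_le le_rfl, h1]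
    abel)
  d_pos_comp n x y h := Subtype.ext (by
    simp only [ADC.compSeq, map_add, map_sub, ADC.dseq_dseq_of_le le_rfl]
    abel)
  d_comp_of_gt {m n} hnm α x y h h' := Subtype.ext (by
    simp only [ADC.compSeq, map_add, map_sub, ADC.dseq_dseq_of_le hnm.le,
      ADC.dseq_dseq_of_lt hnm])
  assoc n x y z hxy hyz h h' := Subtype.ext (by
    simp only [ADC.compSeq, map_add, map_sub, ADC.dseq_dseq_of_le le_rfl]
    abel)
  interchange {m n} hmn x y x' y' hxy hxy' hm hx hy hn := Subtype.ext (by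
    simp only [ADC.compSeq, map_add, map_sub, ADC.dseq_dseq_of_le hmn.le,
      ADC.dseq_dseq_of_lt hmn]
    abel)

theorem nuObj_ext {K : ADC.{u}} {x y : (nuObj K).carrier}
    (h : ∀ α n, x.1 α n = y.1 α n) : x = y :=
  Subtype.ext (funext fun α => funext fun n => h α n)

/-- The map of double sequences induced by a morphism. -/
def ADC.Hom.seq {K L : ADC.{u}} (f : ADC.Hom K L) (x : K.DSeq) : L.DSeq :=
  fun α n => f.app n (x α n)

theorem ADC.Hom.seq_dseq {K L : ADC.{u}} (f : ADC.Hom K L) (α : Sgn) (n : ℕ) (x : K.DSeq) :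
    f.seq (K.dseq α n x) = L.dseq α n (f.seq x) := by
  funext β m
  simp only [ADC.Hom.seq, ADC.dseq, AddMonoidHom.coe_mk, ZeroHom.coe_mk]
  split_ifs <;> simp

/-- The functor `ν` from augmented directed complexes to `ω`-categories. -/
def nu : ADC.{u} ⥤ OmegaCat.{u} where
  obj := nuObj
  map {K L} f :=
    { toFun := fun x => ⟨ADC.Hom.seq f x.1,
        { finite := by
            obtain ⟨N, hN⟩ := x.2.finite
            exact ⟨N, fun n hn α => by rw [ADC.Hom.seq, hN n hn, map_zero]⟩
          bd := fun n α => by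
            simp only [ADC.Hom.seq]
            rw [← ADC.Hom.app_bd, x.2.bd, map_sub]
          pos := fun n α => ADC.Hom.map_pos f n _ (x.2.pos n α)
          aug := fun α => (ADC.Hom.aug_map f _).trans (x.2.aug α) }⟩
      map_d := fun α n x => Subtype.ext (ADC.Hom.seq_dseq f α n x.1)
      map_comp := fun n x y h h' => Subtype.ext (by
        change ADC.Hom.seq f (ADC.compSeq n x.1 y.1) =
          ADC.compSeq n (ADC.Hom.seq f x.1) (ADC.Hom.seq f y.1)
        simp only [ADC.compSeq, ← ADC.Hom.seq_dseq]
        funext α m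
        simp [ADC.Hom.seq]) }
  map_id K := OmegaCat.hom_ext fun x => rfl
  map_comp f g := OmegaCat.hom_ext fun x => rfl

/-! ## The adjunction -/

/-- The double sequence `([d₀⁻ x]₀, [d₀⁺ x]₀, [d₁⁻ x]₁, [d₁⁺ x]₁, …)`. -/
def etaSeq (C : OmegaCat.{u}) (x : C.carrier) : (lamObj C).DSeq :=
  fun α n => OmegaCat.cls (C.trunc α n x)

theorem etaSeq_congr {C : OmegaCat.{u}} {x y : C.carrier} {α β : Sgn} {n : ℕ}
    (h : C.d α n x = C.d β n y) : etaSeq C x α n = etaSeq C y β n :=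
  congrArg OmegaCat.cls (Subtype.ext h)

theorem etaSeq_isNu (C : OmegaCat.{u}) (x : C.carrier) : ADC.IsNu (etaSeq C x) where
  finite := by
    obtain ⟨N, hN, -⟩ := C.exists_dim x
    refine ⟨N + 1, fun n hn α => OmegaCat.cls_eq_zero (m := N) hn _ ?_⟩
    change C.d .neg N (C.d α n x) = C.d α n x
    rw [← hN, C.d_d_of_le (Nat.le_of_succ_le hn), C.d_d_of_le le_rfl]
  bd n α := by
    refine (DFunLike.congr_fun (lamObj_bd C n) _).trans ((OmegaCat.lamBd_cls _).trans ?_)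
    have h : ∀ β, C.trunc β n (C.trunc α (n + 1) x).1 = C.trunc β n x := fun β =>
      Subtype.ext (C.d_d_of_lt (Nat.lt_succ_self n) _ _ _)
    rw [h, h]
    rfl
  pos n α := AddSubmonoid.subset_closure ⟨_, rfl⟩
  aug α := OmegaCat.lamAug_cls _

theorem etaSeq_d (C : OmegaCat.{u}) (α : Sgn) (n : ℕ) (x : C.carrier) :
    etaSeq C (C.d α n x) = (lamObj C).dseq α n (etaSeq C x) := by
  funext β m
  rcases lt_trichotomy m n with h | rfl | h
  · rw [ADC.dseq_of_lt _ h]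
    exact etaSeq_congr (C.d_d_of_lt h _ _ _)
  · rw [ADC.dseq_self]
    exact etaSeq_congr (C.d_d_of_le le_rfl _ _ _)
  · rw [ADC.dseq_of_gt _ h]
    refine OmegaCat.cls_eq_zero h _ ?_
    change C.d .neg n (C.d β m (C.d α n x)) = C.d β m (C.d α n x)
    rw [C.d_d_of_le h.le, C.d_d_of_le le_rfl]

theorem etaSeq_comp (C : OmegaCat.{u}) (n : ℕ) (x y : C.carrier)
    (h : C.d .pos n x = C.d .neg n y) :
    etaSeq C (C.comp n x y h) = ADC.compSeq n (etaSeq C x) (etaSeq C y) := by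
  have h' : (lamObj C).dseq .pos n (etaSeq C x) = (lamObj C).dseq .neg n (etaSeq C y) := by
    rw [← etaSeq_d, ← etaSeq_d, h]
  funext β m
  rcases lt_trichotomy m n with hm | rfl | hm
  · rw [ADC.compSeq_of_lt hm]
    have := C.d_comp_of_lt hm β x y h
      (by rw [C.d_d_of_le hm.le, C.d_d_of_le hm.le, OmegaCat.cond_d_gt hm β h])
    exact etaSeq_congr (this.1.trans this.2.1)
  · cases β
    · rw [ADC.compSeq_neg h']
      exact etaSeq_congr (C.d_neg_comp _ _ _ h)
    · rw [ADC.compSeq_pos]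
      exact etaSeq_congr (C.d_pos_comp _ _ _ h)
  · rw [ADC.compSeq_of_gt hm]
    exact OmegaCat.cls_comp hm _ _ _ (OmegaCat.cond_d_lt hm β h)
      (C.d_comp_of_gt hm β x y h _)

/-- The unit `η x = ([d₀⁻ x]₀, [d₀⁺ x]₀, [d₁⁻ x]₁, [d₁⁺ x]₁, …)`. -/
def etaApp (C : OmegaCat.{u}) : C ⟶ nu.obj (lam.obj C) where
  toFun x := ⟨etaSeq C x, etaSeq_isNu C x⟩
  map_d α n x := Subtype.ext (etaSeq_d C α n x)
  map_comp n x y h _ := Subtype.ext (etaSeq_comp C n x y h)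

/-- For `x ∈ (ν K)ₙ`, the element `xₙ⁻ = xₙ⁺` of `Kₙ`. -/
def topComp (K : ADC.{u}) (n : ℕ) (x : (nuObj K).Level n) : K.X n := x.1.1 .neg n

theorem topComp_eq {K : ADC.{u}} {n : ℕ} (x : (nuObj K).Level n) (α : Sgn) :
    x.1.1 α n = topComp K n x := by
  have := congrFun (congrFun (congrArg Subtype.val x.2) α) n
  rw [← this]
  exact ADC.dseq_self _ _ _ _

/-- The homomorphism `π [x]ₙ = xₙ⁻ = xₙ⁺`. -/
def piMap (K : ADC.{u}) (n : ℕ) : (nuObj K).LamGroup n →+ K.X n :=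
  OmegaCat.lamLift (topComp K n) (fun m hm x y z h hz => by
    rw [topComp, hz]
    exact ADC.compSeq_of_gt hm _)

theorem piMap_cls {K : ADC.{u}} {n : ℕ} (x : (nuObj K).Level n) :
    piMap K n (OmegaCat.cls x) = topComp K n x :=
  OmegaCat.lamLift_cls _ _ x

/-- The counit `π : λ ν K ⟶ K`. -/
def piApp (K : ADC.{u}) : lam.obj (nu.obj K) ⟶ K :=
  ADC.homMk (K := lamObj (nuObj K)) (piMap K)
    (fun n x => by
      rw [lamObj_bd]
      have : (piMap K n).comp ((nuObj K).lamBd n) = (K.bd n).comp (piMap K (n + 1)) := by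
        apply OmegaCat.lamGroup_hom_ext
        intro x
        have h : ∀ α, topComp K n ((nuObj K).trunc α n x.1) = x.1.1 α n := fun α =>
          ADC.dseq_self _ _ _ _
        simp only [AddMonoidHom.comp_apply, OmegaCat.lamBd_cls, map_sub, piMap_cls, h]
        exact (x.1.2.bd n .neg).symm
      exact DFunLike.congr_fun this x)
    (fun x => by
      have : K.aug.comp (piMap K 0) = (nuObj K).lamAug :=
        OmegaCat.lamGroup_hom_ext (fun x => by
          rw [AddMonoidHom.comp_apply, piMap_cls, OmegaCat.lamAug_cls]
          exact x.1.2.aug _)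
      exact DFunLike.congr_fun this x)
    (fun n x hx => by
      have : AddSubmonoid.closure (Set.range (OmegaCat.cls (C := nuObj K) (n := n))) ≤
          (K.pos n).comap (piMap K n) := by
        rw [AddSubmonoid.closure_le]
        rintro _ ⟨x, rfl⟩
        change piMap K n (OmegaCat.cls x) ∈ K.pos n
        rw [piMap_cls]
        exact x.1.2.pos _ _
      exact this hx)

/-- The adjunction `λ ⊣ ν` with unit `η` and counit `π`. -/
def lamNuAdj : lam.{u} ⊣ nu.{u} where
  unit :=
    { app := etaApp
      naturality := fun C D f => by
        apply OmegaCat.hom_ext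
        intro x
        refine nuObj_ext fun α n => ?_
        change OmegaCat.cls (D.trunc α n (OmegaCat.Hom.toFun f x)) =
          OmegaCat.lamMap f n (OmegaCat.cls (C.trunc α n x))
        rw [OmegaCat.lamMap_cls]
        exact congrArg _ (Subtype.ext (OmegaCat.Hom.map_d f α n x).symm) }
  counit :=
    { app := piApp
      naturality := fun K L f => by
        apply ADC.hom_ext
        intro n
        refine OmegaCat.lamGroup_hom_ext (C := nuObj K) fun x => ?_
        change piMap L n (OmegaCat.lamMap (nu.map f) n (OmegaCat.cls x)) =
          ADC.Hom.app f n (piMap K n (OmegaCat.cls x))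
        refine (congrArg (piMap L n)
          (OmegaCat.lamMap_cls (C := nuObj K) (D := nuObj L) (nu.map f) x)).trans ?_
        rw [piMap_cls, piMap_cls]
        rfl }
  left_triangle_components C := by
    apply ADC.hom_ext
    intro n
    refine OmegaCat.lamGroup_hom_ext (C := C) fun x => ?_
    change piMap (lamObj C) n (OmegaCat.lamMap (etaApp C) n (OmegaCat.cls x)) = OmegaCat.cls x
    rw [OmegaCat.lamMap_cls]
    refine (piMap_cls (K := lamObj C) _).trans ?_
    exact congrArg OmegaCat.cls (OmegaCat.trunc_level .neg x)
  right_triangle_components K := by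
    apply OmegaCat.hom_ext
    intro x
    refine nuObj_ext fun α n => ?_
    change piMap K n (OmegaCat.cls ((nuObj K).trunc α n x)) = x.1 α n
    rw [piMap_cls]
    exact ADC.dseq_self _ _ _ _

/-! ## Bases for augmented directed complexes -/

/-- The signs as integers. -/
def Sgn.toInt : Sgn → ℤ
  | .neg => -1
  | .pos => 1

namespace ADC

/-- A basis for an augmented directed complex, given by its intersections with the `Kₙ`. -/
structure IsBasis (K : ADC.{u}) (B : ∀ n, Set (K.X n)) : Prop where
  linearIndependent : ∀ n, LinearIndependent ℤ (Subtype.val : B n → K.X n)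
  span_eq_top : ∀ n, Submodule.span ℤ (B n) = ⊤
  pos_eq : ∀ n, K.pos n = AddSubmonoid.closure (B n)

/-- The relation `x ≤ y` on `Kₙ`, meaning that `y - x ∈ Kₙ*`. -/
def Le (K : ADC.{u}) {n : ℕ} (x y : K.X n) : Prop := y - x ∈ K.pos n

/-- The relation `x ∧ y = z`: the element `z` is the greatest lower bound of `x` and `y`. -/
def IsMeet (K : ADC.{u}) {n : ℕ} (x y z : K.X n) : Prop :=
  K.Le z x ∧ K.Le z y ∧ ∀ w, K.Le w x → K.Le w y → K.Le w z

variable {K : ADC.{u}} {B : ∀ n, Set (K.X n)}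

/-- The `ℤ`-basis of `Kₙ` consisting of the `n`-dimensional basis elements. -/
noncomputable def IsBasis.basis (hB : K.IsBasis B) (n : ℕ) : Module.Basis (B n) ℤ (K.X n) :=
  Module.Basis.mk (hB.linearIndependent n) (by rw [Subtype.range_coe, hB.span_eq_top])

/-- The positive and negative parts of `x = ∑ cᵢ bᵢ`: the sum of the terms with positive
coefficients, and minus the sum of the terms with negative coefficients. -/
noncomputable def IsBasis.part (hB : K.IsBasis B) (α : Sgn) {n : ℕ} (x : K.X n) : K.X n :=
  ((hB.basis n).repr x).sum fun b c => max (α.toInt * c) 0 • (b : K.X n)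

/-- The elements `∂⁻ x` and `∂⁺ x`: the negative and positive parts of `∂ x`. -/
noncomputable def IsBasis.bdPart (hB : K.IsBasis B) (α : Sgn) {n : ℕ} (x : K.X (n + 1)) :
    K.X n :=
  hB.part α (K.bd n x)

/-- The element `⟨b⟩ᵅₘ` of `Kₘ` for `b ∈ Kₙ`, as a function of `m`: it is `0` for `m > n`, it is
`b` for `m = n`, and it is `∂ᵅ ⟨b⟩ᵅₘ₊₁` for `m < n`. -/
noncomputable def IsBasis.atom (hB : K.IsBasis B) (α : Sgn) : {n : ℕ} → K.X n → ∀ m, K.X m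
  | 0, b => Pi.single 0 b
  | n + 1, b => Function.update (hB.atom α (hB.bdPart α b)) (n + 1) b

theorem IsBasis.atom_of_gt (hB : K.IsBasis B) (α : Sgn) {n : ℕ} (b : K.X n) {m : ℕ}
    (h : n < m) : hB.atom α b m = 0 := by
  induction n with
  | zero => exact Pi.single_eq_of_ne h.ne' _
  | succ n ih =>
    rw [IsBasis.atom, Function.update_of_ne h.ne']
    exact ih _ (Nat.lt_of_succ_lt h)

theorem IsBasis.atom_self (hB : K.IsBasis B) (α : Sgn) {n : ℕ} (b : K.X n) :
    hB.atom α b n = b := by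
  cases n with
  | zero => exact Pi.single_eq_same _ _
  | succ n => exact Function.update_self _ _ _

theorem IsBasis.atom_of_lt (hB : K.IsBasis B) (α : Sgn) {n : ℕ} (b : K.X n) {m : ℕ}
    (h : m < n) : hB.atom α b m = hB.bdPart α (hB.atom α b (m + 1)) := by
  induction n with
  | zero => exact absurd h (Nat.not_lt_zero m)
  | succ n ih =>
    rw [IsBasis.atom, Function.update_of_ne h.ne]
    rcases Nat.lt_succ_iff_lt_or_eq.1 h with h' | rfl
    · rw [Function.update_of_ne (Nat.succ_lt_succ h').ne]
      exact ih _ h'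
    · rw [Function.update_self, hB.atom_self]

/-- A basis is unital if `ε ⟨b⟩₀⁻ = ε ⟨b⟩₀⁺ = 1` for every basis element `b`. -/
def IsBasis.IsUnital (hB : K.IsBasis B) : Prop :=
  ∀ (n : ℕ) (b : K.X n), b ∈ B n → ∀ α, K.aug (hB.atom α b 0) = 1

/-- A basis is loop-free if there are partial orderings `≤₀, ≤₁, …` on it such that `a <ₙ b`
whenever `⟨a⟩ₙ⁺ ∧ ⟨b⟩ₙ⁻ > 0` and `|a|, |b| > n`. -/
def IsBasis.IsLoopFree (hB : K.IsBasis B) : Prop :=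
  ∃ le : ℕ → PartialOrder (Σ m, B m), ∀ (n : ℕ) (a b : Σ m, B m), n < a.1 → n < b.1 →
    (∃ z, K.IsMeet (hB.atom .pos (a.2 : K.X a.1) n) (hB.atom .neg (b.2 : K.X b.1) n) z ∧
      K.Le 0 z ∧ z ≠ 0) →
    (le n).lt a b

/-- A basis is strongly loop-free if there is a partial ordering `≤` on it such that `a < b`
whenever `a ≤ ∂⁻ b` or `b ≤ ∂⁺ a`. -/
def IsBasis.IsStronglyLoopFree (hB : K.IsBasis B) : Prop :=
  ∃ le : PartialOrder (Σ m, B m),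
    (∀ (n : ℕ) (a : B n) (b : B (n + 1)), K.Le (a : K.X n) (hB.bdPart .neg (b : K.X (n + 1))) →
      le.lt ⟨n, a⟩ ⟨n + 1, b⟩) ∧
    (∀ (n : ℕ) (a : B (n + 1)) (b : B n), K.Le (b : K.X n) (hB.bdPart .pos (a : K.X (n + 1))) →
      le.lt ⟨n + 1, a⟩ ⟨n, b⟩)

end ADC

/-! ## Bases for `ω`-categories -/

namespace OmegaCat

/-- The set of composites of members of `S`: the closure of `S` under all the compositions. -/
inductive Composite (C : OmegaCat.{u}) (S : Set C.carrier) : C.carrier → Prop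
  | of (x : C.carrier) (hx : x ∈ S) : Composite C S x
  | comp (n : ℕ) (x y : C.carrier) (h : C.d .pos n x = C.d .neg n y)
      (hx : Composite C S x) (hy : Composite C S y) : Composite C S (C.comp n x y h)

variable (C : OmegaCat.{u}) (E : Set C.carrier) (dim : E → ℕ)

/-- The set `E`, whose members are assigned dimensions by `dim`, composition-generates `C`: for
each `n`, the elements of `Cₙ` are the composites of the members of `E` of dimension at most `n`. -/
def IsCompGen : Prop :=
  ∀ (n : ℕ) (x : C.carrier),
    C.d .neg n x = x ↔ C.Composite {y | ∃ e : E, e.1 = y ∧ dim e ≤ n} x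

variable {C E dim}

theorem IsCompGen.mem_level (h : C.IsCompGen E dim) (e : E) : C.d .neg (dim e) e.1 = e.1 :=
  (h _ _).2 (.of _ ⟨e, rfl, le_rfl⟩)

/-- The element `[e]_{|e|}` of `(λ C)_{|e|}`. -/
def IsCompGen.gen (h : C.IsCompGen E dim) (e : E) : Σ n, (lam.obj C).X n :=
  ⟨dim e, cls (C := C) ⟨e.1, h.mem_level e⟩⟩

/-- The image of `e ↦ [e]_{|e|}` in degree `n`. -/
def IsCompGen.genSet (h : C.IsCompGen E dim) (n : ℕ) : Set ((lam.obj C).X n) :=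
  {z | ∃ e : E, h.gen e = ⟨n, z⟩}

variable (C E dim) in
/-- A basis for an `ω`-category: a set of composition-generators such that `e ↦ [e]_{|e|}` is a
bijection onto a basis for `λ C`. -/
structure IsBasis : Prop where
  isCompGen : C.IsCompGen E dim
  gen_injective : Function.Injective isCompGen.gen
  isBasis : (lam.obj C).IsBasis isCompGen.genSet

/-- A basis is atomic if `[dₙ⁻ e]ₙ ∧ [dₙ⁺ e]ₙ = 0` for `e ∈ E` and `n < |e|`. -/
def IsBasis.IsAtomic (_ : C.IsBasis E dim) : Prop :=
  ∀ (e : E) (n : ℕ), n < dim e →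
    (lam.obj C).IsMeet (cls (C.trunc .neg n e.1)) (cls (C.trunc .pos n e.1)) 0

/-- A basis for `C` is loop-free if the corresponding basis for `λ C` is loop-free. -/
def IsBasis.IsLoopFree (h : C.IsBasis E dim) : Prop := h.isBasis.IsLoopFree

/-- A basis for `C` is strongly loop-free if the corresponding basis for `λ C` is. -/
def IsBasis.IsStronglyLoopFree (h : C.IsBasis E dim) : Prop := h.isBasis.IsStronglyLoopFree

end OmegaCat

/-! ## The subcategories -/

/-- The `ω`-categories with loop-free atomic bases. -/
def LoopFreeAtomic : ObjectProperty OmegaCat.{u} := fun C =>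
  ∃ (E : Set C.carrier) (dim : E → ℕ) (h : C.IsBasis E dim), h.IsLoopFree ∧ h.IsAtomic

/-- The `ω`-categories with strongly loop-free atomic bases. -/
def StronglyLoopFreeAtomic : ObjectProperty OmegaCat.{u} := fun C =>
  ∃ (E : Set C.carrier) (dim : E → ℕ) (h : C.IsBasis E dim), h.IsStronglyLoopFree ∧ h.IsAtomic

/-- The augmented directed complexes with loop-free unital bases. -/
def LoopFreeUnital : ObjectProperty ADC.{u} := fun K =>
  ∃ (B : ∀ n, Set (K.X n)) (hB : K.IsBasis B), hB.IsLoopFree ∧ hB.IsUnital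

/-- The augmented directed complexes with strongly loop-free unital bases. -/
def StronglyLoopFreeUnital : ObjectProperty ADC.{u} := fun K =>
  ∃ (B : ∀ n, Set (K.X n)) (hB : K.IsBasis B), hB.IsStronglyLoopFree ∧ hB.IsUnital

/-- The adjunction `adj : L ⊣ R` restricts to an adjoint equivalence between the full subcategories
given by `P` and `Q`: the functors `L` and `R` restrict to these subcategories, and the restricted
functors form an adjoint equivalence whose unit and counit are those of `adj`. -/
def RestrictsToAdjointEquivalence {𝒜 ℬ : Type*} [Category 𝒜] [Category ℬ] {L : 𝒜 ⥤ ℬ}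
    {R : ℬ ⥤ 𝒜} (adj : L ⊣ R) (P : ObjectProperty 𝒜) (Q : ObjectProperty ℬ) : Prop :=
  ∃ (hL : ∀ X : P.FullSubcategory, Q (L.obj X.obj))
    (hR : ∀ Y : Q.FullSubcategory, P (R.obj Y.obj))
    (unitIso : 𝟭 P.FullSubcategory ≅ Q.lift (P.ι ⋙ L) hL ⋙ P.lift (Q.ι ⋙ R) hR)
    (counitIso : P.lift (Q.ι ⋙ R) hR ⋙ Q.lift (P.ι ⋙ L) hL ≅ 𝟭 Q.FullSubcategory),
    (∀ X, (unitIso.hom.app X).hom = adj.unit.app X.obj) ∧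
    (∀ Y, (counitIso.hom.app Y).hom = adj.counit.app Y.obj) ∧
    ∀ X, (Q.lift (P.ι ⋙ L) hL).map (unitIso.hom.app X) ≫
      counitIso.hom.app ((Q.lift (P.ι ⋙ L) hL).obj X) = 𝟙 _

end Steiner

/-! # Augmented directed complexes and loop-free omega-categories -/

/-! It is enough that `λ` and `ν` preserve the two classes of objects and that the unit and counit
are invertible on them; the adjunction then restricts formally. Everything rests on factorizations
in `ν K` for `K` with a loop-free unital basis.

Call the atoms that make up an element `x` of `ν K` above dimension `k` its parts (`HasParts`). A
part `b` consumes `⟨b⟩⁻ₖ` and produces `⟨b⟩⁺ₖ`, and the boundary condition becomes a conservation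
law: `x⁺ₖ` is `x⁻ₖ` plus all that is produced minus all that is consumed. If no other part produces
a cell that `a` consumes, then positivity forces `⟨a⟩⁻ₖ ≤ x⁻ₖ`, and `a` splits off as a left factor
under `#ₖ` (`HasParts.front`). Loop-freeness provides such a minimal part, so an element with parts
is a composite of elements with single parts. Lowering `k` breaks these up further until `k = 0`,
where unitality leaves only atoms. Hence the atoms generate `ν K` (`composite_nuAtom`), and `b ↦
[⟨b⟩]` is inverse to the counit.

For the unit, atomicity says that `[dₙ⁺e]` and `[dₙ⁻e]` are the positive and negative parts of a
boundary, so `η e` is the atom on `[e]`. It remains to see that a morphism `f : C → ν K` is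
bijective whenever `C` is generated by lifts of the atoms (`LiftsAtoms`). Injectivity is the hard
point. By induction on `k` one proves two claims together: neighbouring `#ₖ`-factors in `C` commute,
up to whiskering, when the first does not feed the second (`CanSwap`), and `f` is injective on
elements with at most one part above `k` (`InjOnSimple`). Swapping lets factorizations in `ν K` be
lifted to `C`, because in a composite no later part feeds an earlier one (`HasParts.not_feeds`);
this depends on the fact that coefficients in `ν K` never exceed `1` (`coef_le_one`).

For the strong version, a single strong order serves as every `≤ₙ`. Moreover a basis consists of the
indecomposables of the positive cones, so it is unique, and strong loop-freeness can be moved along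
isomorphisms. -/

namespace Steiner

namespace ADC.IsBasis

variable {K : ADC.{u}} {B : ∀ n, Set (K.X n)} (hB : K.IsBasis B)

/-! ## Coefficients with respect to a basis -/

/-- The coefficient of a basis element. -/
noncomputable def coef {n : ℕ} (b : B n) : K.X n →+ ℤ := ((hB.basis n).coord b).toAddMonoidHom

theorem coef_eq {n : ℕ} (b : B n) (x : K.X n) : hB.coef b x = (hB.basis n).repr x b := rfl

theorem basis_apply {n : ℕ} (b : B n) : hB.basis n b = (b : K.X n) := by
  simp [ADC.IsBasis.basis]

theorem coef_ext {n : ℕ} {x y : K.X n} (h : ∀ b, hB.coef b x = hB.coef b y) : x = y :=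
  (hB.basis n).ext_elem h

theorem coef_self {n : ℕ} (b : B n) : hB.coef b (b : K.X n) = 1 := by
  rw [coef_eq, ← hB.basis_apply, Module.Basis.repr_self, Finsupp.single_eq_same]

theorem coef_ne {n : ℕ} {b c : B n} (h : b ≠ c) : hB.coef b (c : K.X n) = 0 := by
  rw [coef_eq, ← hB.basis_apply, Module.Basis.repr_self, Finsupp.single_eq_of_ne h]

theorem sum_repr {n : ℕ} (x : K.X n) :
    (((hB.basis n).repr x).sum fun b c => c • (b : K.X n)) = x := by
  conv_rhs => rw [← (hB.basis n).linearCombination_repr x]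
  simp [Finsupp.linearCombination_apply, hB.basis_apply]

theorem mem_pos (hB : K.IsBasis B) {n : ℕ} (b : B n) : (b : K.X n) ∈ K.pos n := by
  rw [hB.pos_eq]
  exact AddSubmonoid.subset_closure b.2

theorem mem_pos_iff {n : ℕ} {x : K.X n} : x ∈ K.pos n ↔ ∀ b, 0 ≤ hB.coef b x := by
  constructor
  · intro h b
    rw [hB.pos_eq] at h
    induction h using AddSubmonoid.closure_induction with
    | mem y hy =>
      by_cases hb : b = ⟨y, hy⟩
      · rw [hb, hB.coef_self ⟨y, hy⟩]
        exact zero_le_one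
      · rw [hB.coef_ne (c := ⟨y, hy⟩) hb]
    | zero => simp
    | add y z _ _ hy hz =>
      rw [map_add]
      exact add_nonneg hy hz
  · intro h
    rw [← hB.sum_repr x]
    refine sum_mem fun b _ => ?_
    have hb : 0 ≤ (hB.basis n).repr x b := h b
    obtain ⟨k, hk⟩ := Int.eq_ofNat_of_zero_le hb
    beta_reduce
    rw [hk, natCast_zsmul]
    exact nsmul_mem (hB.mem_pos b) k

theorem le_iff {n : ℕ} {x y : K.X n} : K.Le x y ↔ ∀ b, hB.coef b x ≤ hB.coef b y := by
  simp only [ADC.Le, hB.mem_pos_iff, map_sub, sub_nonneg]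

theorem coef_part {n : ℕ} (α : Sgn) (b : B n) (x : K.X n) :
    hB.coef b (hB.part α x) = max (α.toInt * hB.coef b x) 0 := by
  rw [part, Finsupp.sum, map_sum]
  simp only [map_zsmul]
  by_cases hb : b ∈ ((hB.basis n).repr x).support
  · rw [Finset.sum_eq_single_of_mem b hb]
    · rw [hB.coef_self, coef_eq]
      simp
    · intro c _ hc
      rw [hB.coef_ne hc.symm, smul_zero]
  · rw [Finset.sum_eq_zero]
    · rw [coef_eq, Finsupp.notMem_support_iff.1 hb]
      simp
    · intro c hc
      rw [hB.coef_ne, smul_zero]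
      rintro rfl
      exact hb hc

theorem part_mem_pos {n : ℕ} (α : Sgn) (x : K.X n) : hB.part α x ∈ K.pos n :=
  hB.mem_pos_iff.2 fun b => by rw [hB.coef_part]; exact le_max_right _ _

theorem coef_part_pos {n : ℕ} (b : B n) (x : K.X n) :
    hB.coef b (hB.part .pos x) = max (hB.coef b x) 0 := by
  rw [coef_part, Sgn.toInt, one_mul]

theorem coef_part_neg {n : ℕ} (b : B n) (x : K.X n) :
    hB.coef b (hB.part .neg x) = max (-hB.coef b x) 0 := by
  rw [coef_part, Sgn.toInt, neg_one_mul]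

theorem part_pos_sub_part_neg {n : ℕ} (x : K.X n) : hB.part .pos x - hB.part .neg x = x :=
  hB.coef_ext fun b => by
    rw [map_sub, coef_part_pos, coef_part_neg]
    omega

theorem isMeet_iff {n : ℕ} {x y z : K.X n} :
    K.IsMeet x y z ↔ ∀ b, hB.coef b z = min (hB.coef b x) (hB.coef b y) := by
  constructor
  · rintro ⟨h1, h2, h3⟩ b
    -- Coefficientwise, `s - max (s - t) 0 = min s t`, so this element realizes the minimum.
    have hc : ∀ b, hB.coef b (x - hB.part .pos (x - y)) = min (hB.coef b x) (hB.coef b y) := by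
      intro b
      rw [map_sub, coef_part_pos, map_sub]
      omega
    have h4 := hB.le_iff.1 (h3 _ (hB.le_iff.2 fun b => (hc b).le.trans (min_le_left _ _))
      (hB.le_iff.2 fun b => (hc b).le.trans (min_le_right _ _))) b
    rw [hc] at h4
    exact le_antisymm (le_min (hB.le_iff.1 h1 b) (hB.le_iff.1 h2 b)) h4
  · intro h
    refine ⟨hB.le_iff.2 fun b => ?_, hB.le_iff.2 fun b => ?_, fun w h1 h2 =>
      hB.le_iff.2 fun b => ?_⟩
    · rw [h]
      exact min_le_left _ _
    · rw [h]
      exact min_le_right _ _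
    · rw [h]
      exact le_min (hB.le_iff.1 h1 b) (hB.le_iff.1 h2 b)

theorem exists_meet_pos_iff {n : ℕ} {x y : K.X n} (hx : x ∈ K.pos n) (hy : y ∈ K.pos n) :
    (∃ z, K.IsMeet x y z ∧ K.Le 0 z ∧ z ≠ 0) ↔ ∃ b, 0 < hB.coef b x ∧ 0 < hB.coef b y := by
  rw [hB.mem_pos_iff] at hx hy
  constructor
  · rintro ⟨z, hz, -, hz0⟩
    rw [hB.isMeet_iff] at hz
    by_contra! hc
    refine hz0 (hB.coef_ext fun b => ?_)
    have h1 := hz b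
    have h2 := hc b
    have h3 := hx b
    have h4 := hy b
    rw [map_zero]
    omega
  · rintro ⟨b, h1, h2⟩
    have hc : ∀ b, hB.coef b (x - hB.part .pos (x - y)) = min (hB.coef b x) (hB.coef b y) := by
      intro b
      rw [map_sub, coef_part_pos, map_sub]
      omega
    refine ⟨x - hB.part .pos (x - y), hB.isMeet_iff.2 hc, hB.le_iff.2 fun b => ?_, fun h => ?_⟩
    · rw [hc, map_zero]
      exact le_min (hx b) (hy b)
    · have := hc b
      rw [h, map_zero] at this
      omega

/-- The right side is indecomposability in the positive cone and does not mention `B`; this is what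
makes a basis unique. -/
theorem mem_iff (hB : K.IsBasis B) {n : ℕ} {x : K.X n} : x ∈ B n ↔ x ∈ K.pos n ∧ x ≠ 0 ∧
    ∀ y z, y ∈ K.pos n → z ∈ K.pos n → y + z = x → y = 0 ∨ z = 0 := by
  constructor
  · intro hx
    refine ⟨hB.mem_pos ⟨x, hx⟩, fun h => ?_, fun y z hy hz hyz => ?_⟩
    · have := hB.coef_self ⟨x, hx⟩
      simp [h] at this
    · rw [hB.mem_pos_iff] at hy hz
      have h1 : ∀ b, hB.coef b y + hB.coef b z = hB.coef b x := fun b => by rw [← map_add, hyz]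
      have h2 : ∀ b, b ≠ ⟨x, hx⟩ → hB.coef b x = 0 := fun b hb => hB.coef_ne (c := ⟨x, hx⟩) hb
      have h3 := h1 ⟨x, hx⟩
      rw [hB.coef_self ⟨x, hx⟩] at h3
      have h4 := hy ⟨x, hx⟩
      have h5 := hz ⟨x, hx⟩
      rcases h4.eq_or_lt with h6 | h6
      · refine .inl (hB.coef_ext fun b => ?_)
        rw [map_zero]
        by_cases hb : b = ⟨x, hx⟩
        · rw [hb, ← h6]
        · have := h1 b
          have := h2 b hb
          have := hy b
          have := hz b
          omega
      · refine .inr (hB.coef_ext fun b => ?_)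
        rw [map_zero]
        by_cases hb : b = ⟨x, hx⟩
        · rw [hb]
          omega
        · have := h1 b
          have := h2 b hb
          have := hy b
          have := hz b
          omega
  · rintro ⟨hx, hx0, hx1⟩
    have hb : ∃ b, 0 < hB.coef b x := by
      by_contra! h
      exact hx0 (hB.coef_ext fun b => by
        rw [map_zero]
        exact le_antisymm (h b) (hB.mem_pos_iff.1 hx b))
    obtain ⟨b, hb⟩ := hb
    have h1 : x - b ∈ K.pos n := hB.mem_pos_iff.2 fun c => by
      rw [map_sub]
      by_cases hc : c = b
      · rw [hc, hB.coef_self]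
        omega
      · rw [hB.coef_ne hc, sub_zero]
        exact hB.mem_pos_iff.1 hx c
    rcases hx1 _ _ (hB.mem_pos b) h1 (add_sub_cancel _ _) with h | h
    · have := hB.coef_self b
      rw [h, map_zero] at this
      omega
    · rw [sub_eq_zero.1 h]
      exact b.2

theorem unique (hB : K.IsBasis B) {B' : ∀ n, Set (K.X n)} (hB' : K.IsBasis B') : B = B' := by
  funext n
  ext x
  rw [hB.mem_iff, hB'.mem_iff]

/-! ## Atoms -/

theorem atom_mem_pos {n : ℕ} {b : K.X n} (hb : b ∈ K.pos n) (α : Sgn) (m : ℕ) :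
    hB.atom α b m ∈ K.pos m := by
  rcases lt_trichotomy m n with h | rfl | h
  · rw [hB.atom_of_lt α b h]
    exact hB.part_mem_pos _ _
  · rwa [hB.atom_self]
  · rw [hB.atom_of_gt α b h]
    exact zero_mem _

/-- The basis elements, with their dimensions. -/
abbrev Elt (_ : K.IsBasis B) : Type u := Σ n, B n

/-- The element `⟨b⟩ᵅₙ`. -/
noncomputable def at' (α : Sgn) (b : hB.Elt) (n : ℕ) : K.X n := hB.atom α (b.2 : K.X b.1) n

/-- The relation `⟨a⟩⁺ₙ ∧ ⟨b⟩⁻ₙ > 0`. -/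
def Feeds (n : ℕ) (a b : hB.Elt) : Prop :=
  ∃ c : B n, 0 < hB.coef c (hB.at' .pos a n) ∧ 0 < hB.coef c (hB.at' .neg b n)

theorem at'_mem_pos (α : Sgn) (b : hB.Elt) (n : ℕ) : hB.at' α b n ∈ K.pos n :=
  hB.atom_mem_pos (hB.mem_pos b.2) α n

theorem coef_at'_nonneg (α : Sgn) (b : hB.Elt) {n : ℕ} (c : B n) :
    0 ≤ hB.coef c (hB.at' α b n) :=
  hB.mem_pos_iff.1 (hB.at'_mem_pos α b n) c

theorem at'_self (α : Sgn) (b : hB.Elt) : hB.at' α b b.1 = b.2 := hB.atom_self α _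

theorem at'_of_gt (α : Sgn) (b : hB.Elt) {n : ℕ} (h : b.1 < n) : hB.at' α b n = 0 :=
  hB.atom_of_gt α _ h

theorem at'_of_lt (α : Sgn) (b : hB.Elt) {n : ℕ} (h : n < b.1) :
    hB.at' α b n = hB.bdPart α (hB.at' α b (n + 1)) :=
  hB.atom_of_lt α _ h

/-! ### Loop-freeness in terms of supports, and its strong form -/

theorem isLoopFree_iff : hB.IsLoopFree ↔ ∃ le : ℕ → PartialOrder hB.Elt,
    ∀ (n : ℕ) (a b : hB.Elt), n < a.1 → n < b.1 → hB.Feeds n a b → (le n).lt a b := by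
  refine exists_congr fun le => forall_congr' fun n => forall_congr' fun a =>
    forall_congr' fun b => forall_congr' fun _ => forall_congr' fun _ => ?_
  exact imp_congr_left (hB.exists_meet_pos_iff (hB.at'_mem_pos _ _ _) (hB.at'_mem_pos _ _ _))

/-- Cancellation between the terms of a positive `x` can only remove cells from `∂ᵅ`; a cell that
survives comes from one of the terms. -/
theorem coef_bdPart_le {n : ℕ} (α : Sgn) (x : K.X (n + 1)) (hx : x ∈ K.pos (n + 1)) (c : B n)
    (hc : 0 < hB.coef c (hB.bdPart α x)) :
    ∃ b : B (n + 1), 0 < hB.coef b x ∧ 0 < hB.coef c (hB.bdPart α (b : K.X (n + 1))) := by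
  by_contra! h
  have h1 : α.toInt * hB.coef c (K.bd n x) ≤ 0 := by
    rw [← hB.sum_repr x, Finsupp.sum, map_sum, map_sum, Finset.mul_sum]
    refine Finset.sum_nonpos fun b hb => ?_
    have h2 : 0 < hB.coef b x := lt_of_le_of_ne (hB.mem_pos_iff.1 hx b)
      (Finsupp.mem_support_iff.1 hb).symm
    have h3 := h b h2
    rw [bdPart, coef_part] at h3
    rw [map_zsmul, map_zsmul, smul_eq_mul, mul_left_comm]
    exact mul_nonpos_of_nonneg_of_nonpos h2.le ((le_max_left _ _).trans h3)
  rw [bdPart, coef_part] at hc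
  omega

theorem le_of_coef_pos {n : ℕ} {x : K.X n} (hx : x ∈ K.pos n) {b : B n} (h : 0 < hB.coef b x) :
    K.Le (b : K.X n) x :=
  hB.le_iff.2 fun c => by
    by_cases hc : c = b
    · rw [hc, hB.coef_self]
      omega
    · rw [hB.coef_ne hc]
      exact hB.mem_pos_iff.1 hx c

/-- The one order serves for every `n`. A cell of `⟨a⟩⁺ₙ` is reached from `a` by successive targets,
which increase in the order, and a cell of `⟨b⟩⁻ₙ` leads up to `b` through successive sources; a
common cell joins the two chains. -/
theorem IsStronglyLoopFree.isLoopFree (h : hB.IsStronglyLoopFree) : hB.IsLoopFree := by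
  obtain ⟨le, h1, h2⟩ := h
  rw [isLoopFree_iff]
  refine ⟨fun _ => le, ?_⟩
  have hpos : ∀ (a : hB.Elt) (k n : ℕ) (c : B n), n + k = a.1 →
      0 < hB.coef c (hB.at' .pos a n) → le.le a ⟨n, c⟩ := by
    intro a k
    induction k with
    | zero =>
      rintro n c rfl hc
      rw [at'_self] at hc
      by_cases hca : c = a.2
      · rw [hca]
      · rw [hB.coef_ne hca] at hc
        omega
    | succ k ih =>
      intro n c hn hc
      rw [hB.at'_of_lt .pos a (by omega)] at hc
      obtain ⟨b, hb1, hb2⟩ := hB.coef_bdPart_le .pos _ (hB.at'_mem_pos _ _ _) c hc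
      exact (ih (n + 1) b (by omega) hb1).trans
        (h2 n b c (hB.le_of_coef_pos (hB.part_mem_pos _ _) hb2)).le
  have hneg : ∀ (a : hB.Elt) (k n : ℕ) (c : B n), n + k = a.1 →
      0 < hB.coef c (hB.at' .neg a n) → le.le ⟨n, c⟩ a := by
    intro a k
    induction k with
    | zero =>
      rintro n c rfl hc
      rw [at'_self] at hc
      by_cases hca : c = a.2
      · rw [hca]
      · rw [hB.coef_ne hca] at hc
        omega
    | succ k ih =>
      intro n c hn hc
      rw [hB.at'_of_lt .neg a (by omega)] at hc
      obtain ⟨b, hb1, hb2⟩ := hB.coef_bdPart_le .neg _ (hB.at'_mem_pos _ _ _) c hc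
      exact (h1 n c b (hB.le_of_coef_pos (hB.part_mem_pos _ _) hb2)).le.trans
        (ih (n + 1) b (by omega) hb1)
  rintro n a b ha hb ⟨c, hc1, hc2⟩
  -- Since `n < |a|`, the chain from `a` has at least one genuine step, from `d` down to `c`; this
  -- makes the conclusion strict.
  rw [hB.at'_of_lt .pos a ha] at hc1
  obtain ⟨d, hd1, hd2⟩ := hB.coef_bdPart_le .pos _ (hB.at'_mem_pos _ _ _) c hc1
  have h3 := hpos a (a.1 - (n + 1)) (n + 1) d (by omega) hd1
  have h4 := h2 n d c (hB.le_of_coef_pos (hB.part_mem_pos _ _) hd2)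
  exact lt_of_le_of_lt h3 (lt_of_lt_of_le h4 (hneg b (b.1 - n) n c (by omega) hc2))

/-- One multiset serves both signs because `⟨b⟩⁻ₙ = ⟨b⟩⁺ₙ = b` when `|b| = n`. -/
theorem exists_terms {n : ℕ} {x : K.X n} (hx : x ∈ K.pos n) :
    ∃ L : Multiset hB.Elt, (∀ b ∈ L, b.1 = n) ∧ ∀ α, (L.map fun b => hB.at' α b n).sum = x := by
  rw [hB.pos_eq] at hx
  induction hx using AddSubmonoid.closure_induction with
  | mem y hy => exact ⟨{⟨n, ⟨y, hy⟩⟩}, by simp, fun α => by simp [hB.at'_self α ⟨n, ⟨y, hy⟩⟩]⟩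
  | zero => exact ⟨0, by simp, by simp⟩
  | add y z _ _ hy hz =>
    obtain ⟨L, hL, hL'⟩ := hy
    obtain ⟨M, hM, hM'⟩ := hz
    refine ⟨L + M, fun b hb => ?_, fun α => by simp [hL', hM']⟩
    rcases Multiset.mem_add.1 hb with h | h
    exacts [hL b h, hM b h]

end ADC.IsBasis

/-! ## Composition as a relation -/

namespace OmegaCat

variable (C : OmegaCat.{u})

/-- The relation `x #ₙ y = z`. -/
def IsComp (n : ℕ) (x y z : C.carrier) : Prop := ∃ h, C.comp n x y h = z

variable {C} {m n : ℕ} {x y z x' y' z' w : C.carrier}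

theorem IsComp.cond (h : C.IsComp n x y z) : C.d .pos n x = C.d .neg n y := h.1

theorem exists_isComp (h : C.d .pos n x = C.d .neg n y) : ∃ z, C.IsComp n x y z := ⟨_, h, rfl⟩

theorem IsComp.eq (h : C.IsComp n x y z) (h' : C.IsComp n x y z') : z = z' := by
  obtain ⟨_, rfl⟩ := h
  exact h'.2

theorem IsComp.d_neg (h : C.IsComp n x y z) : C.d .neg n z = C.d .neg n x := by
  obtain ⟨h, rfl⟩ := h
  exact C.d_neg_comp _ _ _ _

theorem IsComp.d_pos (h : C.IsComp n x y z) : C.d .pos n z = C.d .pos n y := by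
  obtain ⟨h, rfl⟩ := h
  exact C.d_pos_comp _ _ _ _

theorem IsComp.d_lt (h : C.IsComp n x y z) (hm : m < n) (α : Sgn) :
    C.d α m z = C.d α m x ∧ C.d α m z = C.d α m y := by
  obtain ⟨h, rfl⟩ := h
  have := C.d_comp_of_lt hm α x y h
    (by rw [C.d_d_of_le hm.le, C.d_d_of_le hm.le, cond_d_gt hm α h])
  exact ⟨this.1, this.1.trans this.2.1⟩

theorem IsComp.d_gt (h : C.IsComp n x y z) (hm : n < m) (α : Sgn) :
    C.IsComp n (C.d α m x) (C.d α m y) (C.d α m z) := by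
  obtain ⟨h, rfl⟩ := h
  exact ⟨cond_d_lt hm α h, (C.d_comp_of_gt hm α x y h _).symm⟩

theorem isComp_d_neg (n : ℕ) (x : C.carrier) : C.IsComp n (C.d .neg n x) x x :=
  ⟨C.d_d_of_le le_rfl _ _ _, C.id_comp n x _⟩

theorem isComp_d_pos (n : ℕ) (x : C.carrier) : C.IsComp n x (C.d .pos n x) x :=
  ⟨(C.d_d_of_le le_rfl _ _ _).symm, C.comp_id n x _⟩

theorem isComp_self (h : C.d .neg n x = x) : C.IsComp n x x x := by
  have := isComp_d_neg n x
  rwa [h] at this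

theorem IsComp.eq_right (h : C.IsComp n x y z) (hx : C.d .neg n x = x) : z = y := by
  have h1 : x = C.d .neg n y := by rw [← h.cond, d_of_neg hx]
  exact h.eq (h1 ▸ isComp_d_neg n y)

theorem IsComp.eq_left (h : C.IsComp n x y z) (hy : C.d .neg n y = y) : z = x := by
  have h1 : y = C.d .pos n x := by rw [h.cond, hy]
  exact h.eq (h1 ▸ isComp_d_pos n x)

theorem IsComp.assoc (h : C.IsComp n x y z) (h' : C.IsComp n z x' w) :
    ∃ v, C.IsComp n y x' v ∧ C.IsComp n x v w := by
  obtain ⟨v, hv⟩ := exists_isComp (h.d_pos.symm.trans h'.cond)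
  refine ⟨v, hv, ?_⟩
  have h1 : C.d .pos n x = C.d .neg n v := by rw [hv.d_neg, h.cond]
  obtain ⟨h, rfl⟩ := h
  obtain ⟨hv, rfl⟩ := hv
  obtain ⟨h', rfl⟩ := h'
  exact ⟨h1, (C.assoc n x y x' h hv h' h1).symm⟩

theorem IsComp.assoc' (h : C.IsComp n y x' z) (h' : C.IsComp n x z w) :
    ∃ v, C.IsComp n x y v ∧ C.IsComp n v x' w := by
  obtain ⟨v, hv⟩ := exists_isComp (h'.cond.trans h.d_neg)
  refine ⟨v, hv, ?_⟩
  have h1 : C.d .pos n v = C.d .neg n x' := by rw [hv.d_pos, h.cond]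
  obtain ⟨h, rfl⟩ := h
  obtain ⟨hv, rfl⟩ := hv
  obtain ⟨h', rfl⟩ := h'
  exact ⟨h1, C.assoc n x y x' hv h h1 h'⟩

theorem IsComp.interchange (hmn : m < n) (h : C.IsComp n x y z) (h' : C.IsComp n x' y' z')
    (hw : C.IsComp m z z' w) :
    ∃ u v, C.IsComp m x x' u ∧ C.IsComp m y y' v ∧ C.IsComp n u v w := by
  obtain ⟨u, hu⟩ : ∃ u, C.IsComp m x x' u := exists_isComp (by
    rw [← (h.d_lt hmn _).1, ← (h'.d_lt hmn _).1, hw.cond])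
  obtain ⟨v, hv⟩ : ∃ u, C.IsComp m y y' u := exists_isComp (by
    rw [← (h.d_lt hmn _).2, ← (h'.d_lt hmn _).2, hw.cond])
  refine ⟨u, v, hu, hv, ?_⟩
  have h1 : C.d .pos n u = C.d .neg n v := by
    have h2 := hu.d_gt hmn .pos
    rw [h.cond, h'.cond] at h2
    exact h2.eq (hv.d_gt hmn .neg)
  obtain ⟨h, rfl⟩ := h
  obtain ⟨hv, rfl⟩ := hv
  obtain ⟨h', rfl⟩ := h'
  obtain ⟨hu, rfl⟩ := hu
  obtain ⟨hw, rfl⟩ := hw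
  exact ⟨h1, (C.interchange hmn x y x' y' h h' hw hu hv h1).symm⟩

/-- Interchange applied to `x = x #ₙ dₙ⁺x` and `y = dₙ⁻y #ₙ y`: a lower composite performs `x` first
and `y` second. The companion lemma performs `y` first, and passing between the two is what permits
swapping. -/
theorem IsComp.exchange_pos_neg (hmn : m < n) (h : C.IsComp m x y z) :
    ∃ u v, C.IsComp m x (C.d .neg n y) u ∧ C.IsComp m (C.d .pos n x) y v ∧ C.IsComp n u v z :=
  (isComp_d_pos n x).interchange hmn (isComp_d_neg n y) h

theorem IsComp.exchange_neg_pos (hmn : m < n) (h : C.IsComp m x y z) :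
    ∃ u v, C.IsComp m (C.d .neg n x) y u ∧ C.IsComp m x (C.d .pos n y) v ∧ C.IsComp n u v z :=
  (isComp_d_neg n x).interchange hmn (isComp_d_pos n y) h

theorem level_mono (h : C.d .neg m x = x) (hmn : m ≤ n) : C.d .neg n x = x :=
  d_of_level ⟨x, h⟩ hmn .neg

theorem IsComp.level (h : C.IsComp m x y z) (hx : C.d .neg n x = x) (hy : C.d .neg n y = y) :
    C.d .neg n z = z := by
  rcases le_or_gt n m with hnm | hmn
  · rw [h.eq_right (level_mono hx hnm), hy]
  · have := h.d_gt hmn .neg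
    rw [hx, hy] at this
    exact this.eq h

theorem Hom.isComp {D : OmegaCat.{u}} (f : Hom C D) (h : C.IsComp n x y z) :
    D.IsComp n (f.toFun x) (f.toFun y) (f.toFun z) := by
  obtain ⟨h, rfl⟩ := h
  exact ⟨f.comp_cond h, (f.map_comp n x y h _).symm⟩

theorem Composite.isComp {S : Set C.carrier} (h : C.IsComp n x y z) (hx : C.Composite S x)
    (hy : C.Composite S y) : C.Composite S z := by
  obtain ⟨h, rfl⟩ := h
  exact .comp n x y h hx hy

theorem Composite.mono {S T : Set C.carrier} (hST : S ⊆ T) (hx : C.Composite S x) :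
    C.Composite T x := by
  induction hx with
  | of x hx => exact .of x (hST hx)
  | comp n x y h _ _ ihx ihy => exact .comp n x y h ihx ihy

end OmegaCat

/-! ## Composition in `ν K` by coordinates -/

section Nu

variable {K : ADC.{u}} {m n : ℕ} {x y z x' y' : (nuObj K).carrier}

theorem nu_d_val (α : Sgn) (n : ℕ) (x : (nuObj K).carrier) :
    ((nuObj K).d α n x).1 = K.dseq α n x.1 := rfl

theorem nu_level_iff : (nuObj K).d .neg n x = x ↔ ∀ m, n < m → ∀ α, x.1 α m = 0 := by
  constructor
  · intro h m hm α
    rw [← h, nu_d_val, ADC.dseq_of_gt _ hm]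
  · intro h
    -- The two `n`-components differ by the boundary of an `(n + 1)`-component, which is zero here.
    have key : x.1 .neg n = x.1 .pos n := by
      have := x.2.bd n .neg
      rw [h _ (Nat.lt_succ_self n), map_zero] at this
      exact (sub_eq_zero.1 this.symm).symm
    refine nuObj_ext fun α m => ?_
    rw [nu_d_val]
    rcases lt_trichotomy m n with hm | rfl | hm
    · rw [ADC.dseq_of_lt _ hm]
    · rw [ADC.dseq_self]
      cases α
      exacts [rfl, key]
    · rw [ADC.dseq_of_gt _ hm, h _ hm]

theorem nu_isComp_val (h : (nuObj K).IsComp n x y z) : z.1 = ADC.compSeq n x.1 y.1 := by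
  obtain ⟨h, rfl⟩ := h
  rfl

theorem nu_isComp_gt (h : (nuObj K).IsComp n x y z) (hm : n < m) (α : Sgn) :
    z.1 α m = x.1 α m + y.1 α m := by
  rw [nu_isComp_val h, ADC.compSeq_of_gt hm]

theorem nu_isComp_right (h : (nuObj K).IsComp n x y z) (hm : m < n) (α : Sgn) :
    z.1 α m = y.1 α m := by
  rw [nu_isComp_val h, ADC.compSeq_of_lt hm]

theorem nu_isComp_left (h : (nuObj K).IsComp n x y z) (hm : m < n) (α : Sgn) :
    z.1 α m = x.1 α m := by
  rw [nu_isComp_right h hm, ADC.compSeq_lt_aux (congrArg Subtype.val h.cond) hm]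

theorem nu_isComp_pos (h : (nuObj K).IsComp n x y z) : z.1 .pos n = y.1 .pos n := by
  rw [nu_isComp_val h, ADC.compSeq_pos]

theorem nu_isComp_neg (h : (nuObj K).IsComp n x y z) : z.1 .neg n = x.1 .neg n := by
  rw [nu_isComp_val h, ADC.compSeq_neg (congrArg Subtype.val h.cond)]

theorem nu_isComp_mid (h : (nuObj K).IsComp n x y z) : x.1 .pos n = y.1 .neg n :=
  ADC.compSeq_self_aux (congrArg Subtype.val h.cond)

theorem nu_isComp_iff : (nuObj K).IsComp n x y z ↔
    (∀ m < n, ∀ α, x.1 α m = z.1 α m ∧ y.1 α m = z.1 α m) ∧ x.1 .neg n = z.1 .neg n ∧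
      x.1 .pos n = y.1 .neg n ∧ y.1 .pos n = z.1 .pos n ∧
      ∀ m, n < m → ∀ α, z.1 α m = x.1 α m + y.1 α m := by
  constructor
  · exact fun h => ⟨fun m hm α => ⟨(nu_isComp_left h hm α).symm, (nu_isComp_right h hm α).symm⟩,
      (nu_isComp_neg h).symm, nu_isComp_mid h, (nu_isComp_pos h).symm,
      fun m hm α => nu_isComp_gt h hm α⟩
  · rintro ⟨h1, h2, h3, h4, h5⟩
    have hc : (nuObj K).d .pos n x = (nuObj K).d .neg n y := nuObj_ext fun α m => by
      rw [nu_d_val, nu_d_val]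
      rcases lt_trichotomy m n with hm | rfl | hm
      · rw [ADC.dseq_of_lt _ hm, ADC.dseq_of_lt _ hm, (h1 m hm α).1, (h1 m hm α).2]
      · rw [ADC.dseq_self, ADC.dseq_self, h3]
      · rw [ADC.dseq_of_gt _ hm, ADC.dseq_of_gt _ hm]
    obtain ⟨z', hz'⟩ := OmegaCat.exists_isComp hc
    have : z' = z := nuObj_ext fun α m => by
      rcases lt_trichotomy m n with hm | rfl | hm
      · rw [nu_isComp_left hz' hm, (h1 m hm α).1]
      · cases α
        · rw [nu_isComp_neg hz', h2]
        · rw [nu_isComp_pos hz', h4]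
      · rw [nu_isComp_gt hz' hm, h5 m hm]
    exact this ▸ hz'

theorem nu_pos_eq (x : (nuObj K).carrier) (n : ℕ) (α : Sgn) :
    x.1 .pos n = x.1 .neg n + K.bd n (x.1 α (n + 1)) := by
  rw [x.2.bd]
  abel

/-- The factors of a composite `x #ₙ y` are determined by the composite and by their components
of dimension greater than `n`. -/
theorem nu_isComp_unique (h : (nuObj K).IsComp n x y z) (h' : (nuObj K).IsComp n x' y' z)
    (hx : ∀ m, n < m → ∀ α, x.1 α m = x'.1 α m) (hy : ∀ m, n < m → ∀ α, y.1 α m = y'.1 α m) :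
    x = x' ∧ y = y' := by
  have h0 : x.1 .neg n = x'.1 .neg n := by rw [← nu_isComp_neg h, ← nu_isComp_neg h']
  -- The middle component is not visible in `z`; it is recovered from the source `x⁻ₙ` and the
  -- boundary of the prescribed `(n + 1)`-component.
  have h1 : x.1 .pos n = x'.1 .pos n := by
    rw [nu_pos_eq x n .neg, nu_pos_eq x' n .neg, h0, hx _ (Nat.lt_succ_self n)]
  constructor
  · refine nuObj_ext fun α m => ?_
    rcases lt_trichotomy m n with hm | rfl | hm
    · rw [← nu_isComp_left h hm, ← nu_isComp_left h' hm]
    · cases α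
      exacts [h0, h1]
    · exact hx m hm α
  · refine nuObj_ext fun α m => ?_
    rcases lt_trichotomy m n with hm | rfl | hm
    · rw [← nu_isComp_right h hm, ← nu_isComp_right h' hm]
    · cases α
      · rw [← nu_isComp_mid h, ← nu_isComp_mid h', h1]
      · rw [← nu_isComp_pos h, ← nu_isComp_pos h']
    · exact hy m hm α

end Nu

namespace ADC.IsBasis

variable {K : ADC.{u}} {B : ∀ n, Set (K.X n)} {hB : K.IsBasis B}

/-! ## Orderings on a loop-free basis -/

/-- The strict ordering `<ₙ` on a loop-free basis. -/
def IsLoopFree.lt (hL : hB.IsLoopFree) (n : ℕ) (a b : hB.Elt) : Prop :=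
  ((hB.isLoopFree_iff.1 hL).choose n).lt a b

variable (hL : hB.IsLoopFree)

theorem IsLoopFree.lt_of_feeds {n : ℕ} {a b : hB.Elt} (ha : n < a.1) (hb : n < b.1)
    (h : hB.Feeds n a b) : hL.lt n a b :=
  (hB.isLoopFree_iff.1 hL).choose_spec n a b ha hb h

theorem IsLoopFree.lt_irrefl (n : ℕ) (a : hB.Elt) : ¬hL.lt n a a :=
  @_root_.lt_irrefl _ ((hB.isLoopFree_iff.1 hL).choose n).toPreorder a

theorem IsLoopFree.lt_trans {n : ℕ} {a b c : hB.Elt} (h : hL.lt n a b) (h' : hL.lt n b c) :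
    hL.lt n a c :=
  @_root_.lt_trans _ ((hB.isLoopFree_iff.1 hL).choose n).toPreorder a b c h h'

theorem IsLoopFree.exists_minimal (n : ℕ) {L : Multiset hB.Elt} (h : L ≠ 0) :
    ∃ a ∈ L, ∀ c ∈ L, ¬hL.lt n c a := by
  induction L using Multiset.induction with
  | empty => exact absurd rfl h
  | cons a L ih =>
    by_cases h0 : L = 0
    · subst h0
      exact ⟨a, by simp, by simpa using hL.lt_irrefl n a⟩
    · obtain ⟨m, hm, hm'⟩ := ih h0
      by_cases ham : hL.lt n a m
      · refine ⟨a, by simp, fun c hc hca => ?_⟩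
        rcases Multiset.mem_cons.1 hc with rfl | hc
        · exact hL.lt_irrefl n _ hca
        · exact hm' c hc (hL.lt_trans hca ham)
      · refine ⟨m, by simp [hm], fun c hc hcm => ?_⟩
        rcases Multiset.mem_cons.1 hc with rfl | hc
        · exact ham hcm
        · exact hm' c hc hcm

include hL in
-- A common cell would make `a` strictly precede itself.
theorem IsLoopFree.coef_disjoint {n : ℕ} {a : hB.Elt} (ha : n < a.1) (c : B n) :
    hB.coef c (hB.at' .pos a n) = 0 ∨ hB.coef c (hB.at' .neg a n) = 0 := by
  by_contra! h
  exact hL.lt_irrefl n a (hL.lt_of_feeds ha ha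
    ⟨c, lt_of_le_of_ne (hB.coef_at'_nonneg _ _ _) h.1.symm,
      lt_of_le_of_ne (hB.coef_at'_nonneg _ _ _) h.2.symm⟩)

/-! ## Atoms as elements of `ν K` -/

/-- Downward induction on `n`. By `∂∂ = 0`, the elements `⟨b⟩⁺ₙ₊₁` and `⟨b⟩⁻ₙ₊₁` have the same
boundary, so `⟨b⟩⁺ₙ` and `⟨b⟩⁻ₙ` are the positive and negative parts of one element. -/
theorem bd_at' (b : hB.Elt) (n : ℕ) (α : Sgn) :
    K.bd n (hB.at' α b (n + 1)) = hB.at' .pos b n - hB.at' .neg b n := by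
  obtain ⟨k, hk⟩ : ∃ k, b.1 ≤ n + k := ⟨b.1, by omega⟩
  induction k generalizing n α with
  | zero =>
    rw [hB.at'_of_gt α b (by omega), map_zero]
    rcases (show b.1 ≤ n from hk).eq_or_lt with rfl | h
    · rw [hB.at'_self, hB.at'_self, sub_self]
    · rw [hB.at'_of_gt _ b h, hB.at'_of_gt _ b h, sub_self]
  | succ k ih =>
    rcases lt_or_ge n b.1 with h | h
    · have key : K.bd n (hB.at' .pos b (n + 1)) = K.bd n (hB.at' .neg b (n + 1)) := by
        have h1 := ih (n + 1) .neg (by omega)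
        have h2 := K.bd_bd n (hB.at' .neg b (n + 1 + 1))
        rw [h1, map_sub, sub_eq_zero] at h2
        exact h2
      have key' : K.bd n (hB.at' α b (n + 1)) = K.bd n (hB.at' .pos b (n + 1)) := by
        cases α
        exacts [key.symm, rfl]
      rw [key', hB.at'_of_lt .pos b h, hB.at'_of_lt .neg b h, bdPart, bdPart, ← key,
        hB.part_pos_sub_part_neg]
    · exact ih n α (by omega)

theorem IsUnital.aug_at' (hU : hB.IsUnital) (b : hB.Elt) (α : Sgn) :
    K.aug (hB.at' α b 0) = 1 := hU b.1 b.2 b.2.2 α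

theorem isNu_at' (hU : hB.IsUnital) (b : hB.Elt) : ADC.IsNu fun α n => hB.at' α b n where
  finite := ⟨b.1 + 1, fun _ hn α => hB.at'_of_gt α b hn⟩
  bd n α := bd_at' b n α
  pos n α := hB.at'_mem_pos α b n
  aug α := hU.aug_at' b α

/-- The atom `⟨b⟩` as an element of `ν K`. -/
noncomputable def nuAtom (hU : hB.IsUnital) (b : hB.Elt) : (nuObj K).carrier :=
  ⟨fun α n => hB.at' α b n, isNu_at' hU b⟩

theorem nuAtom_val (hU : hB.IsUnital) (b : hB.Elt) (α : Sgn) (n : ℕ) :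
    (nuAtom hU b).1 α n = hB.at' α b n := rfl

/-- A zero component would propagate down to dimension `0`, where the augmentation is `1`. -/
theorem at'_ne_zero (hU : hB.IsUnital) (b : hB.Elt) {n : ℕ} (h : n ≤ b.1) (α : Sgn) :
    hB.at' α b n ≠ 0 := by
  induction n with
  | zero =>
    intro h0
    have := hU.aug_at' b α
    rw [h0, map_zero] at this
    omega
  | succ n ih =>
    intro h0
    refine ih (by omega) ?_
    rw [hB.at'_of_lt α b h, bdPart, h0, map_zero]
    exact hB.coef_ext fun c => by rw [hB.coef_part]; simp

theorem exists_coef_at'_pos (hU : hB.IsUnital) (b : hB.Elt) {n : ℕ} (h : n ≤ b.1) (α : Sgn) :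
    ∃ c : B n, 0 < hB.coef c (hB.at' α b n) := by
  by_contra! hc
  refine at'_ne_zero hU b h α (hB.coef_ext fun c => ?_)
  rw [map_zero]
  exact le_antisymm (hc c) (hB.coef_at'_nonneg α b c)

theorem nuAtom_injective (hU : hB.IsUnital) : Function.Injective (nuAtom hU) := by
  intro a b hab
  have key : ∀ n, hB.at' .neg a n = hB.at' .neg b n := fun n => by
    rw [← nuAtom_val hU, ← nuAtom_val hU, hab]
  have h1 : a.1 = b.1 := by
    rcases lt_trichotomy a.1 b.1 with h | h | h
    · exact absurd ((key _).symm.trans (hB.at'_of_gt _ a h)) (at'_ne_zero hU b le_rfl _)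
    · exact h
    · exact absurd ((key _).trans (hB.at'_of_gt _ b h)) (at'_ne_zero hU a le_rfl _)
  obtain ⟨n, a⟩ := a
  obtain ⟨m, b⟩ := b
  obtain rfl : n = m := h1
  have h2 := key n
  rw [hB.at'_self .neg ⟨n, a⟩, hB.at'_self .neg ⟨n, b⟩] at h2
  exact congrArg (Sigma.mk n) (Subtype.ext h2)

/-! ## Parts -/

variable (hB) in
/-- The sum of the elements `⟨b⟩ᵅₙ` for `b` in a multiset. -/
noncomputable def atSum (α : Sgn) (L : Multiset hB.Elt) (n : ℕ) : K.X n :=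
  (L.map fun b => hB.at' α b n).sum

@[simp]
theorem atSum_zero (α : Sgn) (n : ℕ) : hB.atSum α 0 n = 0 := by simp [atSum]

@[simp]
theorem atSum_cons (α : Sgn) (b : hB.Elt) (L : Multiset hB.Elt) (n : ℕ) :
    hB.atSum α (b ::ₘ L) n = hB.at' α b n + hB.atSum α L n := by simp [atSum]

@[simp]
theorem atSum_singleton (α : Sgn) (b : hB.Elt) (n : ℕ) :
    hB.atSum α {b} n = hB.at' α b n := by simp [atSum]

@[simp]
theorem atSum_add (α : Sgn) (L M : Multiset hB.Elt) (n : ℕ) :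
    hB.atSum α (L + M) n = hB.atSum α L n + hB.atSum α M n := by simp [atSum]

theorem atSum_of_gt (α : Sgn) {L : Multiset hB.Elt} {n : ℕ} (h : ∀ b ∈ L, b.1 < n) :
    hB.atSum α L n = 0 := by
  refine Multiset.sum_eq_zero fun x hx => ?_
  obtain ⟨b, hb, rfl⟩ := Multiset.mem_map.1 hx
  exact hB.at'_of_gt α b (h b hb)

theorem coef_atSum_nonneg (α : Sgn) (L : Multiset hB.Elt) {n : ℕ} (c : B n) :
    0 ≤ hB.coef c (hB.atSum α L n) := by
  induction L using Multiset.induction with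
  | empty => simp
  | cons b L ih =>
    rw [atSum_cons, map_add]
    exact add_nonneg (hB.coef_at'_nonneg _ _ _) ih

theorem coef_atSum_eq_zero (α : Sgn) {L : Multiset hB.Elt} {n : ℕ} {c : B n}
    (h : ∀ b ∈ L, hB.coef c (hB.at' α b n) = 0) : hB.coef c (hB.atSum α L n) = 0 := by
  induction L using Multiset.induction with
  | empty => simp
  | cons b L ih =>
    rw [atSum_cons, map_add, h b (by simp), ih fun b hb => h b (by simp [hb]), add_zero]

theorem bd_atSum (L : Multiset hB.Elt) (n : ℕ) (α : Sgn) :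
    K.bd n (hB.atSum α L (n + 1)) = hB.atSum .pos L n - hB.atSum .neg L n := by
  induction L using Multiset.induction with
  | empty => simp
  | cons b L ih =>
    rw [atSum_cons, map_add, ih, bd_at', atSum_cons, atSum_cons]
    abel

variable (hB) in
/-- The components of `x` in dimensions greater than `k` are those of the sum of the atoms in a
multiset of basis elements of dimensions greater than `k`. -/
def HasParts (k : ℕ) (L : Multiset hB.Elt) (x : (nuObj K).carrier) : Prop :=
  (∀ b ∈ L, k < b.1) ∧ ∀ n, k < n → ∀ α, x.1 α n = hB.atSum α L n

variable {k : ℕ} {L M : Multiset hB.Elt} {x y z : (nuObj K).carrier} {a b : hB.Elt}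

theorem HasParts.pos_eq (h : hB.HasParts k L x) :
    x.1 .pos k = x.1 .neg k + (hB.atSum .pos L k - hB.atSum .neg L k) := by
  rw [nu_pos_eq x k .neg, h.2 _ (Nat.lt_succ_self k), bd_atSum]

theorem HasParts.isComp (h : hB.HasParts k L x) (h' : hB.HasParts k M y)
    (hz : (nuObj K).IsComp k x y z) : hB.HasParts k (L + M) z :=
  ⟨fun b hb => (Multiset.mem_add.1 hb).elim (h.1 b) (h'.1 b), fun n hn α => by
    rw [nu_isComp_gt hz hn, h.2 n hn, h'.2 n hn, atSum_add]⟩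

theorem hasParts_zero_iff : hB.HasParts k 0 x ↔ (nuObj K).d .neg k x = x := by
  simp [HasParts, nu_level_iff]

theorem coef_nonneg (x : (nuObj K).carrier) (α : Sgn) {n : ℕ} (c : B n) :
    0 ≤ hB.coef c (x.1 α n) := hB.mem_pos_iff.1 (x.2.pos n α) c

include hL in
-- No cell is both consumed and produced by `a`. Thus `x⁺ₖ ≥ 0` forces `x⁻ₖ` to contain what `a`
-- consumes, and `x⁻ₖ ≥ 0` forces `x⁺ₖ` to contain what `a` produces.
theorem HasParts.coef_le (h : hB.HasParts k {a} x) (c : B k) (α : Sgn) :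
    hB.coef c (hB.at' α a k) ≤ hB.coef c (x.1 α k) := by
  have h1 := congrArg (hB.coef c) h.pos_eq
  simp only [atSum_singleton, map_add, map_sub] at h1
  have h2 := coef_nonneg (hB := hB) x .pos c
  have h3 := coef_nonneg (hB := hB) x .neg c
  have h4 := hB.coef_at'_nonneg .pos a c
  have h5 := hB.coef_at'_nonneg .neg a c
  rcases hL.coef_disjoint (h.1 a (by simp)) c with h6 | h6 <;> cases α <;> omega

include hL in
/-- A part that is not preceded by any other part can be split off at the left. -/
theorem HasParts.front (h : hB.HasParts k (a ::ₘ L) x) (ha : ∀ c ∈ L, ¬hB.Feeds k c a) :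
    ∃ y z, (nuObj K).IsComp k y z x ∧ hB.HasParts k {a} y ∧ hB.HasParts k L z := by
  have hak : k < a.1 := h.1 a (by simp)
  -- A cell consumed by `a` is produced neither by `a` itself nor by a part in `L`, so by
  -- conservation and `x⁺ₖ ≥ 0` it must be supplied by `x⁻ₖ`.
  have hle : ∀ c : B k, hB.coef c (hB.at' .neg a k) ≤ hB.coef c (x.1 .neg k) := by
    intro c
    have h1 := congrArg (hB.coef c) h.pos_eq
    simp only [atSum_cons, map_add, map_sub] at h1
    have h2 := coef_nonneg (hB := hB) x .pos c
    have h3 := coef_nonneg (hB := hB) x .neg c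
    have h4 := hB.coef_at'_nonneg .pos a c
    have h5 := hB.coef_at'_nonneg .neg a c
    have h6 := coef_atSum_nonneg (hB := hB) .neg L c
    rcases h5.eq_or_lt with h7 | h7
    · omega
    · have h8 : hB.coef c (hB.at' .pos a k) = 0 :=
        (hL.coef_disjoint hak c).resolve_right h7.ne'
      have h9 : hB.coef c (hB.atSum .pos L k) = 0 := coef_atSum_eq_zero _ fun b hb => by
        by_contra h10
        exact ha b hb ⟨c, lt_of_le_of_ne (hB.coef_at'_nonneg _ _ _) (Ne.symm h10), h7⟩
      omega
  have hle' : x.1 .neg k - hB.at' .neg a k ∈ K.pos k := hB.le_iff.2 hle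
  have hmid : x.1 .neg k - hB.at' .neg a k + hB.at' .pos a k ∈ K.pos k :=
    add_mem hle' (hB.at'_mem_pos _ _ _)
  -- The augmentation is unaffected because `⟨a⟩⁺₀ - ⟨a⟩⁻₀` is a boundary. The transport along `h0`
  -- only makes the augmentation typecheck for general `k`.
  have haug : ∀ h0 : k = 0,
      K.aug (h0 ▸ (x.1 .neg k - hB.at' .neg a k + hB.at' .pos a k)) = 1 := by
    rintro rfl
    have h1 := K.aug_bd (hB.at' .neg a 1)
    rw [bd_at', map_sub] at h1
    change K.aug (x.1 .neg 0 - hB.at' .neg a 0 + hB.at' .pos a 0) = 1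
    rw [map_add, map_sub, x.2.aug]
    omega
  -- The state between the two factors, after `a` alone has acted on `x⁻ₖ`.
  let mid : K.X k := x.1 .neg k - hB.at' .neg a k + hB.at' .pos a k
  let ys : K.DSeq := fun α n => if n < k then x.1 α n else if e : n = k then
    (match α with
      | .neg => x.1 .neg n
      | .pos => e ▸ mid) else hB.at' α a n
  let zs : K.DSeq := fun α n => if n < k then x.1 α n else if e : n = k then
    (match α with
      | .neg => e ▸ mid
      | .pos => x.1 .pos n) else hB.atSum α L n
  have y1 : ∀ n < k, ∀ α, ys α n = x.1 α n := fun n hn α => by simp [ys, hn]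
  have y2 : ys .neg k = x.1 .neg k := by simp [ys]
  have y3 : ys .pos k = mid := by simp [ys]
  have y4 : ∀ n, k < n → ∀ α, ys α n = hB.at' α a n := fun n hn α => by
    simp [ys, hn.not_gt, hn.ne']
  have z1 : ∀ n < k, ∀ α, zs α n = x.1 α n := fun n hn α => by simp [zs, hn]
  have z2 : zs .neg k = mid := by simp [zs]
  have z3 : zs .pos k = x.1 .pos k := by simp [zs]
  have z4 : ∀ n, k < n → ∀ α, zs α n = hB.atSum α L n := fun n hn α => by
    simp [zs, hn.not_gt, hn.ne']
  -- In dimension `k = n + 1`, the intermediate element has the boundary of `x⁻ₖ`, since `⟨a⟩⁺ₖ` and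
  -- `⟨a⟩⁻ₖ` have equal boundaries.
  have hbd : ∀ n, n + 1 = k → ∀ e : K.X (n + 1), (∀ h0 : n + 1 = k, e = h0 ▸ mid) →
      K.bd n e = x.1 .pos n - x.1 .neg n := by
    rintro n rfl e he
    rw [he rfl]
    change K.bd n (x.1 .neg (n + 1) - hB.at' .neg a (n + 1) + hB.at' .pos a (n + 1)) = _
    rw [map_add, map_sub, x.2.bd, bd_at', bd_at']
    abel
  have ynu : ADC.IsNu ys :=
    { finite := ⟨a.1 + 1, fun n hn α => by rw [y4 n (by omega), hB.at'_of_gt α a hn]⟩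
      bd := fun n α => by
        rcases lt_trichotomy n k with hn | rfl | hn
        · rw [y1 n hn, y1 n hn]
          rcases (Nat.succ_le_of_lt hn).lt_or_eq with h' | h'
          · rw [y1 _ h', x.2.bd]
          · subst h'
            cases α
            · rw [y2, x.2.bd]
            · rw [y3]
              exact hbd n rfl _ fun _ => rfl
        · rw [y4 _ (Nat.lt_succ_self n), y2, y3, bd_at']
          simp only [mid]
          abel
        · rw [y4 _ hn, y4 _ hn, y4 _ (by omega), bd_at']
      pos := fun n α => by
        rcases lt_trichotomy n k with hn | rfl | hn
        · rw [y1 n hn]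
          exact x.2.pos _ _
        · cases α
          · rw [y2]
            exact x.2.pos _ _
          · rw [y3]
            exact hmid
        · rw [y4 n hn]
          exact hB.at'_mem_pos _ _ _
      aug := fun α => by
        rcases Nat.eq_zero_or_pos k with rfl | hk
        · cases α
          · rw [y2, x.2.aug]
          · rw [y3]
            exact haug rfl
        · rw [y1 0 hk, x.2.aug] }
  have hLx : ∀ n, k < n → ∀ α, hB.atSum α L n = x.1 α n - hB.at' α a n := fun n hn α => by
    rw [h.2 n hn, atSum_cons, add_sub_cancel_left]
  have znu : ADC.IsNu zs :=
    { finite := by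
        obtain ⟨N, hN⟩ := x.2.finite
        exact ⟨N + a.1 + 1, fun n hn α => by
          rw [z4 n (by omega), hLx n (by omega), hB.at'_of_gt α a (by omega), hN n (by omega),
            sub_zero]⟩
      bd := fun n α => by
        rcases lt_trichotomy n k with hn | rfl | hn
        · rw [z1 n hn, z1 n hn]
          rcases (Nat.succ_le_of_lt hn).lt_or_eq with h' | h'
          · rw [z1 _ h', x.2.bd]
          · subst h'
            cases α
            · rw [z2]
              exact hbd n rfl _ fun _ => rfl
            · rw [z3, x.2.bd]
        · rw [z4 _ (Nat.lt_succ_self n), z2, z3, hLx _ (Nat.lt_succ_self n), map_sub, bd_at',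
            x.2.bd]
          simp only [mid]
          abel
        · rw [z4 _ hn, z4 _ hn, z4 _ (by omega), bd_atSum]
      pos := fun n α => by
        rcases lt_trichotomy n k with hn | rfl | hn
        · rw [z1 n hn]
          exact x.2.pos _ _
        · cases α
          · rw [z2]
            exact hmid
          · rw [z3]
            exact x.2.pos _ _
        · rw [z4 n hn]
          exact hB.mem_pos_iff.2 fun c => coef_atSum_nonneg _ _ _
      aug := fun α => by
        rcases Nat.eq_zero_or_pos k with rfl | hk
        · cases α
          · rw [z2]
            exact haug rfl
          · rw [z3, x.2.aug]
        · rw [z1 0 hk, x.2.aug] }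
  refine ⟨⟨ys, ynu⟩, ⟨zs, znu⟩, nu_isComp_iff.2 ⟨fun n hn α => ⟨y1 n hn α, z1 n hn α⟩, y2,
    y3.trans z2.symm, z3, fun n hn α => ?_⟩, ⟨by simpa using hak, fun n hn α => ?_⟩,
    ⟨fun b hb => h.1 b (by simp [hb]), z4⟩⟩
  · change x.1 α n = ys α n + zs α n
    rw [y4 n hn, z4 n hn, h.2 n hn, atSum_cons]
  · rw [atSum_singleton]
    exact y4 n hn α

include hL in
/-- Splitting a composite into two factors, given that minimal parts can be split off. -/
theorem split_of_front {C : OmegaCat.{u}} {k : ℕ} (H : Multiset hB.Elt → C.carrier → Prop)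
    (hdim : ∀ L x, H L x → ∀ b ∈ L, k < b.1)
    (hnil : ∀ L x, H L x → H 0 (C.d .neg k x))
    (hcomp : ∀ L M x y z, C.IsComp k x y z → H L x → H M y → H (L + M) z)
    (hfront : ∀ a L x, H (a ::ₘ L) x → (∀ c ∈ L, ¬hB.Feeds k c a) →
      ∃ y z, C.IsComp k y z x ∧ H {a} y ∧ H L z)
    (L M : Multiset hB.Elt) (x : C.carrier) (hx : H (L + M) x)
    (hLM : ∀ c ∈ M, ∀ d ∈ L, ¬hB.Feeds k c d) :
    ∃ y z, C.IsComp k y z x ∧ H L y ∧ H M z := by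
  induction hn : L.card generalizing L x with
  | zero =>
    rw [Multiset.card_eq_zero] at hn
    subst hn
    rw [zero_add] at hx
    exact ⟨_, _, OmegaCat.isComp_d_neg k x, hnil _ _ hx, hx⟩
  | succ n ih =>
    obtain ⟨a, ha, ha'⟩ := hL.exists_minimal k (L := L) (by rintro rfl; simp at hn)
    obtain ⟨L, rfl⟩ := Multiset.exists_cons_of_mem ha
    rw [Multiset.card_cons, Nat.add_right_cancel_iff] at hn
    rw [Multiset.cons_add] at hx
    have hd := hdim _ _ hx
    -- Nothing in `L` feeds `a` because `a` is minimal there, and nothing in `M` feeds it by `hLM`.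
    obtain ⟨y, z, hyz, hy, hz⟩ := hfront a (L + M) x hx (fun c hc hca => by
      rcases Multiset.mem_add.1 hc with hc | hc
      · exact ha' c (by simp [hc]) (hL.lt_of_feeds (hd c (by simp [hc])) (hd a (by simp)) hca)
      · exact hLM c hc a (by simp) hca)
    obtain ⟨z1, z2, hz12, hz1, hz2⟩ := ih L z hz
      (fun c hc d hd => hLM c hc d (by simp [hd])) hn
    obtain ⟨v, hv, hv'⟩ := hz12.assoc' hyz
    exact ⟨v, z2, hv', by simpa using hcomp _ _ _ _ _ hv hy hz1, hz2⟩

include hL in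
theorem HasParts.split (h : hB.HasParts k (L + M) x)
    (hLM : ∀ c ∈ M, ∀ d ∈ L, ¬hB.Feeds k c d) :
    ∃ y z, (nuObj K).IsComp k y z x ∧ hB.HasParts k L y ∧ hB.HasParts k M z :=
  split_of_front hL (hB.HasParts k) (fun _ _ h => h.1)
    (fun _ x _ => hasParts_zero_iff.2 ((nuObj K).d_d_of_le le_rfl _ _ x))
    (fun _ _ _ _ _ h hx hy => hx.isComp hy h) (fun _ _ _ h ha => h.front hL ha) L M x h hLM

open Classical in
include hL in
/-- Splitting along the down-set `{c | c <ₖ a}`. -/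
theorem HasParts.split_lt (h : hB.HasParts k L x) (a : hB.Elt) :
    ∃ y z, (nuObj K).IsComp k y z x ∧ hB.HasParts k (L.filter fun c => hL.lt k c a) y ∧
      hB.HasParts k (L.filter fun c => ¬hL.lt k c a) z := by
  refine HasParts.split hL (by rwa [Multiset.filter_add_not]) fun c hc d hd hcd => ?_
  rw [Multiset.mem_filter] at hc hd
  exact hc.2 (hL.lt_trans (hL.lt_of_feeds (h.1 c hc.1) (h.1 d hd.1) hcd) hd.2)

/-! ## Multiplicities -/

theorem coef_atSum_of_dim [DecidableEq hB.Elt] {n : ℕ} {L : Multiset hB.Elt}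
    (h : ∀ b ∈ L, b.1 = n) (c : B n) (α : Sgn) :
    hB.coef c (hB.atSum α L n) = L.count (⟨n, c⟩ : hB.Elt) := by
  induction L using Multiset.induction with
  | empty => simp
  | cons b L ih =>
    rw [atSum_cons, map_add, ih fun b hb => h b (by simp [hb]), Multiset.count_cons]
    obtain ⟨m, b⟩ := b
    obtain rfl : m = n := h ⟨m, b⟩ (by simp)
    rw [hB.at'_self α ⟨m, b⟩]
    by_cases hcb : c = b
    · subst hcb
      rw [hB.coef_self, if_pos rfl]
      push_cast
      ring
    · rw [hB.coef_ne hcb, if_neg (fun h => hcb (by simpa using h))]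
      push_cast
      ring

theorem aug_basis (hU : hB.IsUnital) (b : B 0) : K.aug (b : K.X 0) = 1 := by
  have := hU.aug_at' (hB := hB) ⟨0, b⟩ .pos
  rwa [hB.at'_self .pos ⟨0, b⟩] at this

theorem aug_eq_sum (hU : hB.IsUnital) (x : K.X 0) :
    K.aug x = ((hB.basis 0).repr x).sum fun _ c => c := by
  conv_lhs => rw [← hB.sum_repr x]
  rw [Finsupp.sum, map_sum, Finsupp.sum]
  refine Finset.sum_congr rfl fun b _ => ?_
  rw [map_zsmul, aug_basis hU, smul_eq_mul, mul_one]

/-- For a unital basis, `ε` is the sum of the coefficients. -/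
theorem coef_le_aug (hU : hB.IsUnital) {x : K.X 0} (hx : x ∈ K.pos 0) (c : B 0) :
    hB.coef c x ≤ K.aug x := by
  rw [hB.mem_pos_iff] at hx
  by_cases hc : c ∈ ((hB.basis 0).repr x).support
  · rw [aug_eq_sum hU, Finsupp.sum]
    exact Finset.single_le_sum (f := fun b => (hB.basis 0).repr x b) (fun b _ => hx b) hc
  · rw [coef_eq, Finsupp.notMem_support_iff.1 hc, aug_eq_sum hU]
    exact Finset.sum_nonneg fun b _ => hx b

/-- Truncation at `k + 1` leaves only top-dimensional parts, which can be read off from `xᵅₖ₊₁`. -/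
theorem exists_hasParts_d (x : (nuObj K).carrier) (α : Sgn) (k : ℕ) :
    ∃ L, (∀ b ∈ L, b.1 = k + 1) ∧ hB.HasParts k L ((nuObj K).d α (k + 1) x) ∧
      ∀ β, hB.atSum β L (k + 1) = x.1 α (k + 1) := by
  obtain ⟨L, hL1, hL2⟩ := hB.exists_terms (x.2.pos (k + 1) α)
  refine ⟨L, hL1, ⟨fun b hb => by rw [hL1 b hb]; omega, fun n hn β => ?_⟩, hL2⟩
  rw [nu_d_val]
  rcases (Nat.succ_le_of_lt hn).eq_or_lt with rfl | h
  · rw [ADC.dseq_self]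
    exact (hL2 β).symm
  · rw [ADC.dseq_of_gt _ h, atSum_of_gt β fun b hb => by rw [hL1 b hb]; exact h]

include hL in
-- Induction on dimension. If `b` occurs twice among the `(n + 1)`-dimensional parts, first remove
-- the parts below `b`; then two copies of `b` split off in succession. A cell `d` consumed by `b`
-- must still be available to the second copy although the first has consumed it and does not
-- produce it, so some source has coefficient at least `2` at `d`, one dimension lower.
theorem coef_le_one (hU : hB.IsUnital) {n : ℕ} (x : (nuObj K).carrier) (α : Sgn) (c : B n) :
    hB.coef c (x.1 α n) ≤ 1 := by
  classical
  induction n generalizing x α with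
  | zero =>
    refine (coef_le_aug hU (x.2.pos 0 α) c).trans ?_
    rw [x.2.aug]
  | succ n ih =>
    by_contra! hc
    obtain ⟨L, hL1, hL2, hL3⟩ := exists_hasParts_d (hB := hB) x α n
    let b : hB.Elt := ⟨n + 1, c⟩
    have hbn : n < b.1 := Nat.lt_succ_self n
    rw [← hL3 .neg, coef_atSum_of_dim hL1] at hc
    obtain ⟨y, z, -, -, hz⟩ := hL2.split_lt hL b
    have hcount : 2 ≤ (L.filter fun c => ¬hL.lt n c b).count b := by
      rw [Multiset.count_filter_of_pos (p := fun c => ¬hL.lt n c b) (hL.lt_irrefl n b)]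
      exact_mod_cast hc
    obtain ⟨L', hL'⟩ := Multiset.exists_cons_of_mem
      (Multiset.count_pos.1 (lt_of_lt_of_le two_pos hcount))
    rw [hL', Multiset.count_cons_self] at hcount
    obtain ⟨L'', rfl⟩ := Multiset.exists_cons_of_mem
      (Multiset.count_pos.1 (show 0 < L'.count b by omega))
    have hmin : ∀ c ∈ b ::ₘ b ::ₘ L'', ¬hB.Feeds n c b := fun c hc hcb => by
      have h1 : n < c.1 := hz.1 c (by rwa [hL'])
      rw [← hL', Multiset.mem_filter] at hc
      exact hc.2 (hL.lt_of_feeds h1 hbn hcb)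
    rw [hL'] at hz
    obtain ⟨u, v, huv, hu, hv⟩ := hz.front hL fun c hc => hmin c (by simp [hc])
    obtain ⟨s, t, hst, hs, -⟩ := hv.front hL fun c hc => hmin c (by simp [hc])
    obtain ⟨d, hd⟩ := exists_coef_at'_pos hU b hbn.le .neg
    have h1 := hs.coef_le hL d .neg
    rw [← nu_isComp_neg hst, ← nu_isComp_mid huv] at h1
    have h2 := (hL.coef_disjoint hbn d).resolve_right hd.ne'
    have h3 := congrArg (hB.coef d) hu.pos_eq
    simp only [atSum_singleton, map_add, map_sub] at h3
    have h4 := ih u .neg d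
    omega

include hL in
-- Suppose a cell `c` of the source of `x` is also produced by the part `a`. The parts that precede
-- `a` cannot consume `c`, since `a` would feed them; so `c` is still present when `a` acts and then
-- has coefficient at least `2`.
theorem HasParts.coef_disjoint (hU : hB.IsUnital) (h : hB.HasParts k L x) (ha : a ∈ L)
    (c : B k) (hx : 0 < hB.coef c (x.1 .neg k)) : hB.coef c (hB.at' .pos a k) = 0 := by
  classical
  by_contra hc
  have hc' : 0 < hB.coef c (hB.at' .pos a k) :=
    lt_of_le_of_ne (hB.coef_at'_nonneg _ _ _) (Ne.symm hc)
  have hak := h.1 a ha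
  obtain ⟨y, z, hyz, hy, hz⟩ := h.split_lt hL a
  have ha' : a ∈ L.filter fun c => ¬hL.lt k c a :=
    Multiset.mem_filter.2 ⟨ha, hL.lt_irrefl k a⟩
  obtain ⟨L', hL'⟩ := Multiset.exists_cons_of_mem ha'
  have hmin : ∀ c ∈ L', ¬hB.Feeds k c a := fun c hc hca => by
    have hc2 : c ∈ L.filter fun c => ¬hL.lt k c a := by simp [hL', hc]
    rw [Multiset.mem_filter] at hc2
    exact hc2.2 (hL.lt_of_feeds (h.1 c hc2.1) hak hca)
  rw [hL'] at hz
  obtain ⟨u, v, huv, hu, -⟩ := hz.front hL hmin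
  have h1 := congrArg (hB.coef c) hy.pos_eq
  have h2 : hB.coef c (hB.atSum .neg (L.filter fun c => hL.lt k c a) k) = 0 :=
    coef_atSum_eq_zero _ fun b hb => by
      rw [Multiset.mem_filter] at hb
      by_contra h3
      exact hL.lt_irrefl k a (hL.lt_trans (hL.lt_of_feeds hak (h.1 b hb.1)
        ⟨c, hc', lt_of_le_of_ne (hB.coef_at'_nonneg _ _ _) (Ne.symm h3)⟩) hb.2)
  have h3 := coef_atSum_nonneg (hB := hB) .pos (L.filter fun c => hL.lt k c a) c
  simp only [map_add, map_sub] at h1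
  rw [nu_isComp_mid hyz, ← nu_isComp_neg hyz, nu_isComp_neg huv] at h1
  have h4 := congrArg (hB.coef c) hu.pos_eq
  simp only [atSum_singleton, map_add, map_sub] at h4
  have h5 := (hL.coef_disjoint hak c).resolve_left hc
  have h6 := coef_le_one hL hU u .pos c
  omega

include hL in
/-- In a composite `x #ₖ y`, no part of `y` precedes a part of `x`. -/
theorem HasParts.not_feeds (hU : hB.IsUnital) (hx : hB.HasParts k L x) (hy : hB.HasParts k M y)
    (h : (nuObj K).IsComp k x y z) : ∀ c ∈ M, ∀ d ∈ L, ¬hB.Feeds k c d := by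
  rintro c hc d hd ⟨f, hf1, hf2⟩
  classical
  have hdk := hx.1 d hd
  obtain ⟨p, q, hpq, -, hq⟩ := hx.split_lt hL d
  have hd' : d ∈ L.filter fun c => ¬hL.lt k c d :=
    Multiset.mem_filter.2 ⟨hd, hL.lt_irrefl k d⟩
  obtain ⟨L', hL'⟩ := Multiset.exists_cons_of_mem hd'
  have hmin : ∀ c ∈ L', ¬hB.Feeds k c d := fun c hc hca => by
    have hc2 : c ∈ L.filter fun c => ¬hL.lt k c d := by simp [hL', hc]
    rw [Multiset.mem_filter] at hc2
    exact hc2.2 (hL.lt_of_feeds (hx.1 c hc2.1) hdk hca)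
  -- Regroup so that `w = q #ₖ y` begins with `d`. Its source contains the cell `f` that `d`
  -- consumes, yet its part `c` produces `f`.
  obtain ⟨w, hw, -⟩ := hpq.assoc h
  have hwp := hq.isComp hy hw
  rw [hL'] at hq
  obtain ⟨u, v, huv, hu, -⟩ := hq.front hL hmin
  have h1 := hu.coef_le hL f .neg
  rw [← nu_isComp_neg huv, ← nu_isComp_neg hw] at h1
  have := hwp.coef_disjoint hL hU (Multiset.mem_add.2 (.inr hc)) f (by omega)
  omega

/-! ## Uniqueness of parts -/

/-- In dimension `|b|` the coefficient of `b` is at least `1` for `P`. For `Q` it is `0`, because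
members of lower dimension vanish there and those of equal dimension are basis elements other than
`b`. -/
theorem not_mem_of_atSum_eq {P Q : Multiset hB.Elt} (hPQ : ∀ b ∈ P, b ∉ Q) {b : hB.Elt}
    (hb : b ∈ P) (hmax : ∀ c ∈ Q, c.1 ≤ b.1) (h : hB.atSum .neg P b.1 = hB.atSum .neg Q b.1) :
    False := by
  have h1 : hB.coef b.2 (hB.atSum .neg Q b.1) = 0 := coef_atSum_eq_zero _ fun c hc => by
    rcases (hmax c hc).lt_or_eq with h1 | h1
    · rw [hB.at'_of_gt _ c h1, map_zero]
    · have hcb : c ≠ b := by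
        rintro rfl
        exact hPQ _ hb hc
      obtain ⟨n, b⟩ := b
      obtain ⟨m, c⟩ := c
      obtain rfl : m = n := h1
      rw [hB.at'_self .neg ⟨m, c⟩]
      refine hB.coef_ne ?_
      rintro rfl
      exact hcb rfl
  obtain ⟨P, rfl⟩ := Multiset.exists_cons_of_mem hb
  rw [← h, atSum_cons, map_add, hB.at'_self, hB.coef_self] at h1
  have := coef_atSum_nonneg (hB := hB) .neg P b.2
  omega

/-- Atoms are triangular with respect to dimension: cancel the common members, then compare
coefficients at a remaining member of greatest dimension. -/
theorem HasParts.unique (h : hB.HasParts k L x) (h' : hB.HasParts k M x) : L = M := by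
  classical
  have hLM : L - M + L ∩ M = L := Multiset.sub_add_inter L M
  have hML : M - L + L ∩ M = M := by
    rw [Multiset.inter_comm]
    exact Multiset.sub_add_inter M L
  have hsum : ∀ n, k < n → hB.atSum .neg (L - M) n = hB.atSum .neg (M - L) n := by
    intro n hn
    have h1 := (h.2 n hn .neg).symm.trans (h'.2 n hn .neg)
    rw [← hLM] at h1
    conv_rhs at h1 => rw [← hML]
    rw [atSum_add, atSum_add] at h1
    exact add_right_cancel h1
  have hdisj : ∀ b ∈ L - M, b ∉ M - L := fun b hb hb' => by
    rw [Multiset.mem_sub] at hb hb'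
    omega
  by_cases h0 : (L - M + (M - L)).toFinset.Nonempty
  · obtain ⟨b, hb, hmax⟩ := Finset.exists_max_image _ (fun b : hB.Elt => b.1) h0
    simp only [Multiset.mem_toFinset] at hb hmax
    rcases Multiset.mem_add.1 hb with hb | hb
    · exact (not_mem_of_atSum_eq hdisj hb (fun c hc => hmax c (Multiset.mem_add.2 (.inr hc)))
        (hsum _ (h.1 b (Multiset.mem_of_le (Multiset.sub_le_self _ _) hb)))).elim
    · exact (not_mem_of_atSum_eq (fun b hb hb' => hdisj b hb' hb) hb
        (fun c hc => hmax c (Multiset.mem_add.2 (.inl hc)))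
        (hsum _ (h'.1 b (Multiset.mem_of_le (Multiset.sub_le_self _ _) hb))).symm).elim
  · rw [Finset.not_nonempty_iff_eq_empty, Multiset.toFinset_eq_empty] at h0
    have h1 : L - M = 0 := (add_eq_zero.1 h0).1
    have h2 : M - L = 0 := (add_eq_zero.1 h0).2
    rw [← hLM, h1]
    conv_rhs => rw [← hML, h2]

/-! ## Decompositions of atoms -/

theorem eq_zero_of_add_eq_zero (hB : K.IsBasis B) {n : ℕ} {x y : K.X n} (hx : x ∈ K.pos n)
    (hy : y ∈ K.pos n) (h : x + y = 0) : x = 0 := by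
  rw [hB.mem_pos_iff] at hx hy
  refine hB.coef_ext fun b => ?_
  have h1 := congrArg (hB.coef b) h
  have h2 := hx b
  have h3 := hy b
  rw [map_add, map_zero] at h1
  rw [map_zero]
  omega

include hL in
-- Downward induction from `|b|`. If `y` vanishes in dimension `n + 1`, then `y⁻ₙ = y⁺ₙ`, and this
-- is bounded by both `⟨b⟩⁻ₙ` and `⟨b⟩⁺ₙ`, which have no common cell.
theorem right_eq_zero_of_add_eq_at' (hk : k < b.1)
    (h : ∀ n, k < n → ∀ α, x.1 α n + y.1 α n = hB.at' α b n) (hy : y.1 .neg b.1 = 0)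
    {n : ℕ} (hn : k < n) (α : Sgn) : y.1 α n = 0 := by
  have hgt : ∀ n, b.1 < n → ∀ α, y.1 α n = 0 := fun n hn α =>
    eq_zero_of_add_eq_zero hB (y.2.pos n α) (x.2.pos n α)
      (by rw [add_comm, h n (by omega), hB.at'_of_gt α b hn])
  rcases lt_or_ge b.1 n with hbn | hbn
  · exact hgt n hbn α
  · obtain ⟨j, hj⟩ := Nat.exists_eq_add_of_le hbn
    induction j generalizing n α with
    | zero =>
      obtain rfl : b.1 = n := hj
      cases α
      · exact hy
      · rw [nu_pos_eq y b.1 .neg, hy, hgt _ (Nat.lt_succ_self _), map_zero, add_zero]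
    | succ j ih =>
      have h1 : ∀ α, y.1 α (n + 1) = 0 := fun α => ih (by omega) α (by omega) (by omega)
      have h2 := nu_pos_eq y n .neg
      rw [h1, map_zero, add_zero] at h2
      refine hB.coef_ext fun c => ?_
      have h3 := congrArg (hB.coef c) (h n hn .neg)
      have h4 := congrArg (hB.coef c) (h n hn .pos)
      have h5 := congrArg (hB.coef c) h2
      rw [map_add] at h3 h4
      have h6 := coef_nonneg (hB := hB) x .neg c
      have h7 := coef_nonneg (hB := hB) x .pos c
      have h8 := coef_nonneg (hB := hB) y .neg c
      rw [map_zero]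
      rcases hL.coef_disjoint (show n < b.1 by omega) c with h9 | h9 <;> cases α <;> omega

include hL in
-- In dimension `|b|` the element `b` is indecomposable, so one summand vanishes there, and then in
-- every dimension above `k`. This is why factorizations of an atom are trivial.
theorem eq_zero_or_eq_zero_of_add_eq_at'
    (h : ∀ n, k < n → ∀ α, x.1 α n + y.1 α n = hB.at' α b n) :
    (∀ n, k < n → ∀ α, x.1 α n = 0) ∨ (∀ n, k < n → ∀ α, y.1 α n = 0) := by
  rcases le_or_gt b.1 k with hk | hk
  · exact .inl fun n hn α => eq_zero_of_add_eq_zero hB (x.2.pos n α) (y.2.pos n α)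
      (by rw [h n hn, hB.at'_of_gt α b (by omega)])
  · have h1 := h b.1 hk .neg
    rw [hB.at'_self] at h1
    rcases (hB.mem_iff.1 b.2.2).2.2 _ _ (x.2.pos _ _) (y.2.pos _ _) h1 with h2 | h2
    · exact .inl fun n hn α => right_eq_zero_of_add_eq_at' hL (x := y) hk
        (fun n hn α => by rw [add_comm, h n hn]) h2 hn α
    · exact .inr fun n hn α => right_eq_zero_of_add_eq_at' hL hk h h2 hn α

/-! ## Generation by atoms -/

include hL in
theorem HasParts.composite {S : Set (nuObj K).carrier} (h : hB.HasParts k L x) (h0 : L ≠ 0)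
    (hS : ∀ c ∈ L, ∀ y, hB.HasParts k {c} y → (nuObj K).Composite S y) :
    (nuObj K).Composite S x := by
  induction hn : L.card generalizing L x with
  | zero => exact absurd (Multiset.card_eq_zero.1 hn) h0
  | succ n ih =>
    obtain ⟨a, ha, ha'⟩ := hL.exists_minimal k h0
    obtain ⟨L, rfl⟩ := Multiset.exists_cons_of_mem ha
    rw [Multiset.card_cons, Nat.add_right_cancel_iff] at hn
    obtain ⟨y, z, hyz, hy, hz⟩ := h.front hL fun c hc hca =>
      ha' c (by simp [hc]) (hL.lt_of_feeds (h.1 c (by simp [hc])) (h.1 a (by simp)) hca)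
    have hyS := hS a (by simp) y hy
    -- When `a` is the only part, the right factor is an identity for `#ₖ` and need not itself be a
    -- composite from `S`.
    by_cases hL0 : L = 0
    · rw [hL0, hasParts_zero_iff] at hz
      rwa [hyz.eq_left hz]
    · exact OmegaCat.Composite.isComp hyz hyS
        (ih hz hL0 (fun c hc => hS c (by simp [hc])) hn)

theorem eq_zero_of_aug_eq_zero (hU : hB.IsUnital) {x : K.X 0} (hx : x ∈ K.pos 0)
    (h : K.aug x = 0) : x = 0 :=
  hB.coef_ext fun c => by
    rw [map_zero]
    exact le_antisymm (h ▸ coef_le_aug hU hx c) (hB.mem_pos_iff.1 hx c)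

include hL in
-- In dimension `0` the difference `x - ⟨b⟩` is positive with augmentation `1 - 1 = 0`, so it
-- vanishes.
theorem eq_nuAtom_of_hasParts_zero (hU : hB.IsUnital) (h : hB.HasParts 0 {b} x) :
    x = nuAtom hU b := by
  refine nuObj_ext fun α n => ?_
  rcases Nat.eq_zero_or_pos n with rfl | hn
  · refine sub_eq_zero.1 (eq_zero_of_aug_eq_zero hU (hB.le_iff.2 fun c => h.coef_le hL c α) ?_)
    rw [map_sub, x.2.aug, nuAtom_val, hU.aug_at', sub_self]
  · rw [h.2 n hn, atSum_singleton, nuAtom_val]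

theorem exists_eq_nuAtom_of_level_zero (hU : hB.IsUnital) (h : (nuObj K).d .neg 0 x = x) :
    ∃ b : hB.Elt, b.1 = 0 ∧ x = nuAtom hU b := by
  obtain ⟨c, hc⟩ : ∃ c : B 0, 0 < hB.coef c (x.1 .neg 0) := by
    by_contra! hc
    have : x.1 .neg 0 = 0 := hB.coef_ext fun c => by
      rw [map_zero]
      exact le_antisymm (hc c) (coef_nonneg _ _ _)
    have h1 := x.2.aug .neg
    rw [this, map_zero] at h1
    omega
  have h1 : x.1 .neg 0 = c := sub_eq_zero.1 (eq_zero_of_aug_eq_zero hU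
    (hB.le_of_coef_pos (x.2.pos _ _) hc) (by rw [map_sub, x.2.aug, aug_basis hU, sub_self]))
  have h0 := nu_level_iff.1 h
  refine ⟨⟨0, c⟩, rfl, nuObj_ext fun α n => ?_⟩
  rw [nuAtom_val]
  rcases Nat.eq_zero_or_pos n with rfl | hn
  · rw [hB.at'_self α ⟨0, c⟩]
    cases α
    · exact h1
    · rw [nu_pos_eq x 0 .neg, h0 _ (Nat.lt_succ_self 0), map_zero, add_zero, h1]
  · rw [h0 n hn, hB.at'_of_gt α ⟨0, c⟩ hn]

include hL in
/-- An element with a single part `b` in dimensions greater than `k + 1` has the part `b` and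
`(k + 1)`-dimensional parts in dimensions greater than `k`. -/
theorem HasParts.descend (h : hB.HasParts (k + 1) {b} x) :
    ∃ L, (∀ c ∈ L, c.1 = k + 1) ∧ hB.HasParts k (b ::ₘ L) x := by
  -- The extra parts are the terms of `x⁻ₖ₊₁ - ⟨b⟩⁻ₖ₊₁`. By conservation this equals `x⁺ₖ₊₁ -
  -- ⟨b⟩⁺ₖ₊₁`, so they serve both signs.
  obtain ⟨L, hL1, hL2⟩ := hB.exists_terms (hB.le_iff.2 fun c => h.coef_le hL c .neg)
  have hb : k + 1 < b.1 := h.1 b (by simp)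
  refine ⟨L, hL1, fun c hc => ?_, fun n hn α => ?_⟩
  · rcases Multiset.mem_cons.1 hc with rfl | hc
    · omega
    · rw [hL1 c hc]
      omega
  · rw [atSum_cons]
    rcases (Nat.succ_le_of_lt hn).eq_or_lt with rfl | h'
    · have h1 : hB.atSum α L (k + 1) = _ := hL2 α
      rw [h1]
      cases α
      · abel
      · have h2 := h.pos_eq
        rw [atSum_singleton, atSum_singleton] at h2
        rw [h2]
        abel
    · rw [h.2 n h', atSum_singleton, atSum_of_gt α fun b hb => by rw [hL1 b hb]; exact h',
        add_zero]

include hL in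
-- Each descent from `k + 1` to `k` adds only parts of dimension `k + 1 < |b|`, so the bound `N`
-- persists down to `k = 0`, where single-part elements are atoms.
theorem HasParts.composite_nuAtom (hU : hB.IsUnital) {N : ℕ} (hb : b.1 ≤ N)
    (h : hB.HasParts k {b} x) :
    (nuObj K).Composite {y | ∃ c, nuAtom hU c = y ∧ c.1 ≤ N} x := by
  induction k generalizing b x with
  | zero =>
    rw [eq_nuAtom_of_hasParts_zero hL hU h]
    exact .of _ ⟨b, rfl, hb⟩
  | succ k ih =>
    obtain ⟨L, hL1, hL2⟩ := h.descend hL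
    have hbk := h.1 b (by simp)
    refine hL2.composite hL (Multiset.cons_ne_zero) fun c hc y hy => ih (b := c) ?_ hy
    rcases Multiset.mem_cons.1 hc with rfl | hc
    · exact hb
    · rw [hL1 c hc]
      omega

include hL in
theorem composite_nuAtom (hU : hB.IsUnital) {n : ℕ} (h : (nuObj K).d .neg n x = x) :
    (nuObj K).Composite {y | ∃ c : hB.Elt, nuAtom hU c = y ∧ c.1 ≤ n} x := by
  induction n generalizing x with
  | zero =>
    obtain ⟨b, hb, rfl⟩ := exists_eq_nuAtom_of_level_zero hU h
    exact .of _ ⟨b, rfl, hb.le⟩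
  | succ n ih =>
    obtain ⟨L, hL1, hL2, -⟩ := exists_hasParts_d (hB := hB) x .neg n
    rw [h] at hL2
    by_cases h0 : L = 0
    · rw [h0, hasParts_zero_iff] at hL2
      exact (ih hL2).mono (by
        rintro y ⟨c, hc, hcn⟩
        exact ⟨c, hc, by omega⟩)
    · exact hL2.composite hL h0 fun c hc y hy => hy.composite_nuAtom hL hU (hL1 c hc).le

theorem nuAtom_level (hU : hB.IsUnital) (b : hB.Elt) :
    (nuObj K).d .neg b.1 (nuAtom hU b) = nuAtom hU b :=
  nu_level_iff.2 fun _ hm α => hB.at'_of_gt α b hm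

end ADC.IsBasis

namespace ADC.IsBasis

variable {K : ADC.{u}} {B : ∀ n, Set (K.X n)} {hB : K.IsBasis B}

/-! ## Morphisms to `ν K` that lift the atoms -/

variable {C : OmegaCat.{u}}

/-- The elements `g b` generate `C`, and they are sent to the atoms `⟨b⟩` by the morphism `f`. -/
structure LiftsAtoms (hU : hB.IsUnital) (f : OmegaCat.Hom C (nuObj K)) (g : hB.Elt → C.carrier) :
    Prop where
  map : ∀ b, f.toFun (g b) = nuAtom hU b
  level : ∀ b, C.d .neg b.1 (g b) = g b
  gen : ∀ n x, C.d .neg n x = x → C.Composite {y | ∃ b, g b = y ∧ b.1 ≤ n} x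

variable (hL : hB.IsLoopFree) {hU : hB.IsUnital} {f : OmegaCat.Hom C (nuObj K)}
  {g : hB.Elt → C.carrier} (hg : LiftsAtoms hU f g)
  {k m n : ℕ} {a b : hB.Elt} {L M : Multiset hB.Elt} {x y z w : C.carrier}

theorem map_level (f : OmegaCat.Hom C (nuObj K)) (h : C.d .neg n x = x) :
    (nuObj K).d .neg n (f.toFun x) = f.toFun x := by
  rw [← f.map_d, h]

include hg

theorem LiftsAtoms.level_of_composite (h : C.Composite {y | ∃ b, g b = y ∧ b.1 ≤ n} x) :
    C.d .neg n x = x := by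
  induction h with
  | of x hx =>
    obtain ⟨b, rfl, hb⟩ := hx
    exact OmegaCat.level_mono (hg.level b) hb
  | comp m x y h _ _ ihx ihy => exact OmegaCat.IsComp.level ⟨h, rfl⟩ ihx ihy

/-- For `m ≤ n`, the operation `#ₘ` adds `(n + 1)`-components, so by positivity both factors inherit
the vanishing; a generator of dimension `n + 1` has nonzero image there. -/
theorem LiftsAtoms.level_pred (h : C.d .neg (n + 1) x = x)
    (hx : (f.toFun x).1 .neg (n + 1) = 0) : C.d .neg n x = x := by
  have hc := hg.gen _ _ h
  clear h
  induction hc with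
  | of x h =>
    obtain ⟨b, rfl, hb⟩ := h
    rcases hb.eq_or_lt with hb | hb
    · rw [hg.map, nuAtom_val] at hx
      exact absurd hx (at'_ne_zero hU b hb.ge _)
    · exact OmegaCat.level_mono (hg.level b) (Nat.le_of_lt_succ hb)
  | comp m x y h hcx hcy ihx ihy =>
    have hz : C.IsComp m x y (C.comp m x y h) := ⟨h, rfl⟩
    rcases lt_or_ge m (n + 1) with hm | hm
    · rw [nu_isComp_gt (f.isComp hz) hm] at hx
      have h1 := eq_zero_of_add_eq_zero hB ((f.toFun x).2.pos _ _) ((f.toFun y).2.pos _ _) hx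
      rw [h1, zero_add] at hx
      exact hz.level (ihx h1) (ihy hx)
    · have := hz.eq_right (OmegaCat.level_mono (hg.level_of_composite hcx) hm)
      rw [this] at hx ⊢
      exact ihy hx

theorem LiftsAtoms.level_of_map (h : (nuObj K).d .neg n (f.toFun x) = f.toFun x) :
    C.d .neg n x = x := by
  obtain ⟨N, hN, -⟩ := C.exists_dim x
  rw [nu_level_iff] at h
  obtain hn | hn := le_total N n
  · exact OmegaCat.level_mono hN hn
  · obtain ⟨j, rfl⟩ := Nat.exists_eq_add_of_le hn
    clear hn
    induction j with
    | zero => exact hN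
    | succ j ih => exact ih (hg.level_pred hN (h _ (by omega) _))

theorem LiftsAtoms.composite_range (x : C.carrier) : C.Composite (Set.range g) x := by
  obtain ⟨N, hN, -⟩ := C.exists_dim x
  refine (hg.gen N x hN).mono ?_
  rintro y ⟨b, rfl, -⟩
  exact ⟨b, rfl⟩

omit hg

/-- The element `x` is a composite under `#ₖ` of elements with single parts in dimensions
greater than `k`; these parts form the multiset `L`. -/
inductive IsSeq (hB : K.IsBasis B) (f : OmegaCat.Hom C (nuObj K)) (k : ℕ) :
    Multiset hB.Elt → C.carrier → Prop
  | nil (x : C.carrier) : C.d .neg k x = x → IsSeq hB f k 0 x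
  | cons (a : hB.Elt) (L : Multiset hB.Elt) (x y z : C.carrier) :
      hB.HasParts k {a} (f.toFun x) → IsSeq hB f k L y → C.IsComp k x y z →
      IsSeq hB f k (a ::ₘ L) z

theorem IsSeq.hasParts (h : IsSeq hB f k L x) : hB.HasParts k L (f.toFun x) := by
  induction h with
  | nil x hx => exact hasParts_zero_iff.2 (map_level f hx)
  | cons a L x y z hx _ hz ih => exact hx.isComp ih (f.isComp hz)

theorem isSeq_singleton (h : hB.HasParts k {a} (f.toFun x)) : IsSeq hB f k {a} x :=
  .cons a 0 x _ x h (.nil _ (C.d_d_of_le le_rfl _ _ _)) (OmegaCat.isComp_d_pos k x)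

theorem IsSeq.isComp (h : IsSeq hB f k L x) (h' : IsSeq hB f k M y) (hz : C.IsComp k x y z) :
    IsSeq hB f k (L + M) z := by
  induction h generalizing z with
  | nil x hx =>
    rw [hz.eq_right hx, zero_add]
    exact h'
  | cons a L u v x hu _ hx ih =>
    obtain ⟨w, hw, hw'⟩ := hx.assoc hz
    rw [Multiset.cons_add]
    exact .cons a _ u w z hu (ih hw) hw'

/-- Interchange with `w = w #ₖ w` whiskers each factor separately, and `w` contributes nothing above
dimension `k`. -/
theorem IsSeq.whisker_right (h : IsSeq hB f k L x) (hw : C.d .neg k w = w) (hm : m < k)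
    (hz : C.IsComp m x w z) : IsSeq hB f k L z := by
  induction h generalizing z with
  | nil x hx => exact .nil _ (hz.level hx hw)
  | cons a L u v x hu _ hx ih =>
    obtain ⟨u', v', hu', hv', h⟩ := hx.interchange hm (OmegaCat.isComp_self hw) hz
    refine .cons a _ u' v' z ⟨hu.1, fun n hn α => ?_⟩ (ih hv') h
    rw [nu_isComp_gt (f.isComp hu') (hm.trans hn), nu_level_iff.1 (map_level f hw) n hn, add_zero,
      hu.2 n hn]

theorem IsSeq.whisker_left (h : IsSeq hB f k L x) (hw : C.d .neg k w = w) (hm : m < k)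
    (hz : C.IsComp m w x z) : IsSeq hB f k L z := by
  induction h generalizing z with
  | nil x hx => exact .nil _ (hz.level hw hx)
  | cons a L u v x hu _ hx ih =>
    obtain ⟨u', v', hu', hv', h⟩ := (OmegaCat.isComp_self hw).interchange hm hx hz
    refine .cons a _ u' v' z ⟨hu.1, fun n hn α => ?_⟩ (ih hv') h
    rw [nu_isComp_gt (f.isComp hu') (hm.trans hn), nu_level_iff.1 (map_level f hw) n hn, zero_add,
      hu.2 n hn]

/-- For `m < k`, exchange turns `x #ₘ y` into `x` whiskered, followed under `#ₖ` by `y` whiskered.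
-/
theorem IsSeq.isComp_of_le (h : IsSeq hB f k L x) (h' : IsSeq hB f k M y) (hm : m ≤ k)
    (hz : C.IsComp m x y z) : IsSeq hB f k (L + M) z := by
  rcases hm.eq_or_lt with rfl | hm
  · exact h.isComp h' hz
  · obtain ⟨u, v, hu, hv, h1⟩ := hz.exchange_pos_neg hm
    exact (h.whisker_right (C.d_d_of_le le_rfl _ _ _) hm hu).isComp
      (h'.whisker_left (C.d_d_of_le le_rfl _ _ _) hm hv) h1

/-- Either `x` is in `Cₖ`, or `x` has a single part in dimensions greater than `k`. -/
def IsSimple (hB : K.IsBasis B) (f : OmegaCat.Hom C (nuObj K)) (k : ℕ) (x : C.carrier) : Prop :=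
  C.d .neg k x = x ∨ ∃ b, hB.HasParts k {b} (f.toFun x)

include hg

theorem LiftsAtoms.exists_isSeq_atom (b : hB.Elt) : ∃ L, IsSeq hB f k L (g b) := by
  rcases lt_or_ge k b.1 with hb | hb
  · refine ⟨{b}, isSeq_singleton ⟨by simpa using hb, fun n _ α => ?_⟩⟩
    rw [hg.map, nuAtom_val, atSum_singleton]
  · exact ⟨0, .nil _ (OmegaCat.level_mono (hg.level b) hb)⟩

theorem LiftsAtoms.exists_isSeq_of_level (h : C.d .neg (k + 1) x = x) :
    ∃ L, IsSeq hB f k L x := by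
  have hc := hg.gen _ _ h
  clear h
  induction hc with
  | of x h =>
    obtain ⟨b, rfl, -⟩ := h
    exact hg.exists_isSeq_atom b
  | comp m x y h hcx hcy ihx ihy =>
    have hz : C.IsComp m x y (C.comp m x y h) := ⟨h, rfl⟩
    rcases lt_or_ge m (k + 1) with hm | hm
    · obtain ⟨L, hL⟩ := ihx
      obtain ⟨M, hM⟩ := ihy
      exact ⟨_, hL.isComp_of_le hM (Nat.le_of_lt_succ hm) hz⟩
    · rw [hz.eq_right (OmegaCat.level_mono (hg.level_of_composite hcx) hm)]
      exact ihy

include hL in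
-- Induction on an expression of `x` by generators. Since atoms do not decompose, one factor of `#ₘ`
-- is trivial above `max m (k + 1)`. If `m ≥ k + 1`, it is an identity and can be dropped; otherwise
-- it lies in `Cₖ₊₁`, the other factor carries the part `b`, and the sequences for the two are
-- combined.
theorem LiftsAtoms.exists_isSeq_of_hasParts (h : hB.HasParts (k + 1) {b} (f.toFun x)) :
    ∃ L, IsSeq hB f k L x := by
  have hc := hg.composite_range x
  induction hc with
  | of x hx =>
    obtain ⟨b, rfl⟩ := hx
    exact hg.exists_isSeq_atom b
  | comp m x y h' hcx hcy ihx ihy =>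
    have hz : C.IsComp m x y (C.comp m x y h') := ⟨h', rfl⟩
    have hadd : ∀ n, max m (k + 1) < n → ∀ α,
        (f.toFun x).1 α n + (f.toFun y).1 α n = hB.at' α b n := fun n hn α => by
      rw [← nu_isComp_gt (f.isComp hz) ((le_max_left _ _).trans_lt hn),
        h.2 n ((le_max_right _ _).trans_lt hn), atSum_singleton]
    rcases eq_zero_or_eq_zero_of_add_eq_at' hL hadd with h0 | h0
    · have hlev := hg.level_of_map (nu_level_iff.2 h0)
      rcases le_or_gt (k + 1) m with hm | hm
      · rw [max_eq_left hm] at hlev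
        have heq := hz.eq_right hlev
        rw [heq] at h ⊢
        exact ihy h
      · rw [max_eq_right hm.le] at hlev h0 hadd
        obtain ⟨L, hL⟩ := hg.exists_isSeq_of_level hlev
        obtain ⟨M, hM⟩ := ihy ⟨h.1, fun n hn α => by
          rw [atSum_singleton, ← hadd n hn, h0 n hn, zero_add]⟩
        exact ⟨_, hL.isComp_of_le hM (Nat.le_of_lt_succ hm) hz⟩
    · have hlev := hg.level_of_map (nu_level_iff.2 h0)
      rcases le_or_gt (k + 1) m with hm | hm
      · rw [max_eq_left hm] at hlev
        have heq := hz.eq_left hlev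
        rw [heq] at h ⊢
        exact ihx h
      · rw [max_eq_right hm.le] at hlev h0 hadd
        obtain ⟨M, hM⟩ := hg.exists_isSeq_of_level hlev
        obtain ⟨L, hL⟩ := ihx ⟨h.1, fun n hn α => by
          rw [atSum_singleton, ← hadd n hn, h0 n hn, add_zero]⟩
        exact ⟨_, hL.isComp_of_le hM (Nat.le_of_lt_succ hm) hz⟩

include hL in
theorem LiftsAtoms.exists_isSeq (h : IsSimple hB f (k + 1) x) : ∃ L, IsSeq hB f k L x := by
  rcases h with h | ⟨b, h⟩
  · exact hg.exists_isSeq_of_level h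
  · exact hg.exists_isSeq_of_hasParts hL h

omit hg

/-! ## Exchange of factors -/

/-- Factors with single parts can be exchanged if the first part does not precede the second. -/
def CanSwap (hB : K.IsBasis B) (f : OmegaCat.Hom C (nuObj K)) (k : ℕ) : Prop :=
  ∀ (a b : hB.Elt) (x y z : C.carrier), hB.HasParts k {a} (f.toFun x) →
    hB.HasParts k {b} (f.toFun y) → C.IsComp k x y z → ¬hB.Feeds k a b →
    ∃ y' x', C.IsComp k y' x' z ∧ hB.HasParts k {b} (f.toFun y') ∧ hB.HasParts k {a} (f.toFun x')

/-- The factor with part `a` is moved to the left past one neighbour at a time; each swap is allowed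
because that neighbour does not feed `a`. -/
theorem IsSeq.front (hs : CanSwap hB f k) (h : IsSeq hB f k M x) (hM : M = a ::ₘ L)
    (ha : ∀ c ∈ L, ¬hB.Feeds k c a) :
    ∃ y z, C.IsComp k y z x ∧ IsSeq hB f k {a} y ∧ IsSeq hB f k L z := by
  induction h generalizing L with
  | nil x hx => exact absurd hM.symm (Multiset.cons_ne_zero)
  | cons a' L' u v x hu hv hx ih =>
    rcases Multiset.cons_eq_cons.1 hM with ⟨rfl, rfl⟩ | ⟨-, N, rfl, rfl⟩
    · exact ⟨u, v, hx, isSeq_singleton hu, hv⟩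
    · obtain ⟨y, z, hyz, hy, hz⟩ := ih rfl fun c hc => ha c (by simp [hc])
      obtain ⟨w, hw, hw'⟩ := hyz.assoc' hx
      obtain ⟨y', u', hyu, hy', hu'⟩ := hs a' a u y w hu hy.hasParts hw (ha a' (by simp))
      obtain ⟨t, ht, ht'⟩ := hyu.assoc hw'
      exact ⟨y', t, ht', isSeq_singleton hy', .cons a' N u' z t hu' hz ht⟩

include hL in
theorem IsSeq.split (hs : CanSwap hB f k) (h : IsSeq hB f k (L + M) x)
    (hLM : ∀ c ∈ M, ∀ d ∈ L, ¬hB.Feeds k c d) :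
    ∃ y z, C.IsComp k y z x ∧ IsSeq hB f k L y ∧ IsSeq hB f k M z :=
  split_of_front hL (IsSeq hB f k) (fun _ _ h => h.hasParts.1)
    (fun _ _ _ => .nil _ (C.d_d_of_le le_rfl _ _ _))
    (fun _ _ _ _ _ h hx hy => hx.isComp hy h) (fun _ _ _ h ha => h.front hs rfl ha) L M x h hLM

include hL in
/-- A factorization of the image of `x` in `ν K` lifts to a factorization of `x`. -/
theorem IsSeq.lift (hU : hB.IsUnital) (hs : CanSwap hB f k) {N : Multiset hB.Elt}
    (h : IsSeq hB f k N x) {v w : (nuObj K).carrier} (hv : hB.HasParts k L v)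
    (hw : hB.HasParts k M w) (hvw : (nuObj K).IsComp k v w (f.toFun x)) :
    ∃ y z, C.IsComp k y z x ∧ f.toFun y = v ∧ f.toFun z = w := by
  -- Parts are unique, so the sequence for `x` uses exactly those of `v` and `w`; `not_feeds` in `ν
  -- K` then allows it to be sorted accordingly.
  obtain rfl : N = L + M := h.hasParts.unique (hv.isComp hw hvw)
  obtain ⟨y, z, hyz, hy, hz⟩ := h.split hL hs (hv.not_feeds hL hU hw hvw)
  obtain ⟨h1, h2⟩ := nu_isComp_unique (f.isComp hyz) hvw
    (fun n hn α => by rw [hy.hasParts.2 n hn, hv.2 n hn])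
    (fun n hn α => by rw [hz.hasParts.2 n hn, hw.2 n hn])
  exact ⟨y, z, hyz, h1, h2⟩

/-- The morphism `f` is injective on simple elements. -/
def InjOnSimple (hB : K.IsBasis B) (f : OmegaCat.Hom C (nuObj K)) (k : ℕ) : Prop :=
  ∀ x y : C.carrier, IsSimple hB f k x → IsSimple hB f k y → f.toFun x = f.toFun y → x = y

include hL in
-- Move the same minimal part to the front of both sequences. The images of the factors are
-- determined by their parts, so the first factors agree by `hi` and the rest by induction.
theorem IsSeq.eq (hs : CanSwap hB f k) (hi : InjOnSimple hB f k) (hx : IsSeq hB f k L x)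
    (hy : IsSeq hB f k L y) (h : f.toFun x = f.toFun y) (hg : LiftsAtoms hU f g) : x = y := by
  induction hn : L.card generalizing L x y with
  | zero =>
    rw [Multiset.card_eq_zero] at hn
    subst hn
    exact hi x y (.inl (hg.level_of_map (hasParts_zero_iff.1 hx.hasParts)))
      (.inl (hg.level_of_map (hasParts_zero_iff.1 hy.hasParts))) h
  | succ n ih =>
    obtain ⟨a, ha, ha'⟩ := hL.exists_minimal k (L := L) (by rintro rfl; simp at hn)
    obtain ⟨L, rfl⟩ := Multiset.exists_cons_of_mem ha
    rw [Multiset.card_cons, Nat.add_right_cancel_iff] at hn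
    have hd := hx.hasParts.1
    have hmin : ∀ c ∈ L, ¬hB.Feeds k c a := fun c hc hca =>
      ha' c (by simp [hc]) (hL.lt_of_feeds (hd c (by simp [hc])) (hd a (by simp)) hca)
    obtain ⟨u, v, huv, hu, hv⟩ := hx.front hs rfl hmin
    obtain ⟨u', v', huv', hu', hv'⟩ := hy.front hs rfl hmin
    have h1 := f.isComp huv'
    rw [← h] at h1
    obtain ⟨h2, h3⟩ := nu_isComp_unique (f.isComp huv) h1
      (fun n hn α => by rw [hu.hasParts.2 n hn, hu'.hasParts.2 n hn])
      (fun n hn α => by rw [hv.hasParts.2 n hn, hv'.hasParts.2 n hn])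
    have h4 := hi u u' (.inr ⟨a, hu.hasParts⟩) (.inr ⟨a, hu'.hasParts⟩) h2
    have h5 := ih hv hv' h3 hn
    rw [h4, h5] at huv
    exact huv.eq huv'

/-! ### The induction for exchange and injectivity -/

include hg hL in
theorem LiftsAtoms.injOnSimple_succ (hs : CanSwap hB f k) (hi : InjOnSimple hB f k) :
    InjOnSimple hB f (k + 1) := by
  intro x y hx hy h
  obtain ⟨L, hLx⟩ := hg.exists_isSeq hL hx
  obtain ⟨M, hMy⟩ := hg.exists_isSeq hL hy
  have hM := hMy.hasParts
  rw [← h] at hM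
  rw [hM.unique hLx.hasParts] at hMy
  exact hLx.eq hL hs hi hMy h hg

include hg hL in
-- Any composite over an atom has an identity as one factor, so it collapses to a generator.
theorem LiftsAtoms.eq_atom (h : f.toFun x = nuAtom hU b) : x = g b := by
  have hc := hg.composite_range x
  induction hc with
  | of x hx =>
    obtain ⟨c, rfl⟩ := hx
    rw [hg.map] at h
    rw [nuAtom_injective hU h]
  | comp m x y h' hcx hcy ihx ihy =>
    have hz : C.IsComp m x y (C.comp m x y h') := ⟨h', rfl⟩
    have hadd : ∀ n, m < n → ∀ α,
        (f.toFun x).1 α n + (f.toFun y).1 α n = hB.at' α b n := fun n hn α => by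
      rw [← nu_isComp_gt (f.isComp hz) hn, h, nuAtom_val]
    rcases eq_zero_or_eq_zero_of_add_eq_at' hL hadd with h0 | h0
    · have heq := hz.eq_right (hg.level_of_map (nu_level_iff.2 h0))
      rw [heq] at h ⊢
      exact ihy h
    · have heq := hz.eq_left (hg.level_of_map (nu_level_iff.2 h0))
      rw [heq] at h ⊢
      exact ihx h

include hg hL in
theorem LiftsAtoms.injOnSimple_zero : InjOnSimple hB f 0 := by
  have key : ∀ x, IsSimple hB f 0 x → ∃ b, f.toFun x = nuAtom hU b := by
    rintro x (h | ⟨b, h⟩)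
    · obtain ⟨b, -, hb⟩ := exists_eq_nuAtom_of_level_zero hU (map_level f h)
      exact ⟨b, hb⟩
    · exact ⟨b, eq_nuAtom_of_hasParts_zero hL hU h⟩
  intro x y hx _ h
  obtain ⟨b, hb⟩ := key x hx
  rw [hg.eq_atom hL hb, hg.eq_atom hL (h.symm.trans hb)]

include hU hL in
-- Vacuous: single-part elements are atoms here, and the nonzero common component `x⁺₀ = y⁻₀` shows
-- that `a` feeds `b`.
theorem canSwap_zero : CanSwap hB f 0 := by
  intro a b x y z hx hy hz hab
  refine absurd ?_ hab
  have h1 := nu_isComp_mid (f.isComp hz)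
  rw [eq_nuAtom_of_hasParts_zero hL hU hx, eq_nuAtom_of_hasParts_zero hL hU hy, nuAtom_val,
    nuAtom_val] at h1
  obtain ⟨c, hc⟩ := exists_coef_at'_pos hU a (Nat.zero_le _) .pos
  exact ⟨c, hc, h1 ▸ hc⟩

include hL in
/-- The parts of a composite `x #ₖ₊₁ y` in dimensions greater than `k`. -/
theorem HasParts.descend_isComp {x y z : (nuObj K).carrier} (hx : hB.HasParts (k + 1) {a} x)
    (hy : hB.HasParts (k + 1) {b} y) (hz : (nuObj K).IsComp (k + 1) x y z)
    (hab : ¬hB.Feeds (k + 1) a b) :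
    ∃ W, (∀ c ∈ W, c.1 = k + 1) ∧ hB.HasParts k (a ::ₘ b ::ₘ W) z := by
  have ha : k + 1 < a.1 := hx.1 a (by simp)
  have hb : k + 1 < b.1 := hy.1 b (by simp)
  -- The middle component contains `⟨a⟩⁺ₖ₊₁` and `⟨b⟩⁻ₖ₊₁`; these have disjoint supports because `a`
  -- does not feed `b`, so it contains their sum.
  have hpos : x.1 .pos (k + 1) - hB.at' .pos a (k + 1) - hB.at' .neg b (k + 1) ∈ K.pos (k + 1) := by
    refine hB.mem_pos_iff.2 fun c => ?_
    have h1 := hx.coef_le hL c .pos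
    have h2 := hy.coef_le hL c .neg
    rw [← nu_isComp_mid hz] at h2
    have h3 := hB.coef_at'_nonneg .pos a c
    have h4 := hB.coef_at'_nonneg .neg b c
    rw [map_sub, map_sub]
    by_contra h5
    exact hab ⟨c, by omega, by omega⟩
  obtain ⟨W, hW1, hW2⟩ := hB.exists_terms hpos
  refine ⟨W, hW1, fun c hc => ?_, fun n hn α => ?_⟩
  · rcases Multiset.mem_cons.1 hc with rfl | hc
    · omega
    rcases Multiset.mem_cons.1 hc with rfl | hc
    · omega
    · rw [hW1 c hc]
      omega
  · rw [atSum_cons, atSum_cons]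
    rcases (Nat.succ_le_of_lt hn).eq_or_lt with rfl | h'
    · have h1 : hB.atSum α W (k + 1) = _ := hW2 α
      have h2 := hx.pos_eq
      have h3 := hy.pos_eq
      rw [atSum_singleton, atSum_singleton] at h2 h3
      rw [← nu_isComp_mid hz] at h3
      change z.1 α (k + 1) = _
      cases α
      · rw [h1, nu_isComp_neg hz, h2]
        abel
      · rw [h1, nu_isComp_pos hz, h3]
        abel
    · rw [nu_isComp_gt hz h', hx.2 n h', hy.2 n h', atSum_singleton, atSum_singleton,
        atSum_of_gt α (L := W) fun b hb => by rw [hW1 b hb]; exact h', add_zero]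

include hL in
theorem HasParts.separate {x : (nuObj K).carrier} {W : Multiset hB.Elt}
    (hx : hB.HasParts k (a ::ₘ b ::ₘ W) x) (hab : a ≠ b) (hba : ¬hL.lt k b a) :
    ∃ U V v w, (∀ c ∈ U, c ∈ W) ∧ (∀ c ∈ V, c ∈ W) ∧ hB.HasParts k (a ::ₘ U) v ∧
      hB.HasParts k (b ::ₘ V) w ∧ (nuObj K).IsComp k v w x := by
  classical
  -- Cut along the up-set generated by `b` for `<ₖ`; by hypothesis `a` is outside it.
  let P : hB.Elt → Prop := fun c => ¬(c = b ∨ hL.lt k b c)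
  have hPa : P a := by simp [P, hab, hba]
  have hPb : ¬P b := by simp [P]
  have h1 : (a ::ₘ b ::ₘ W).filter P = a ::ₘ W.filter P := by
    rw [Multiset.filter_cons_of_pos _ hPa, Multiset.filter_cons_of_neg _ hPb]
  have h2 : (a ::ₘ b ::ₘ W).filter (fun c => ¬P c) = b ::ₘ W.filter (fun c => ¬P c) := by
    rw [Multiset.filter_cons_of_neg (p := fun c => ¬P c) _ (not_not.2 hPa),
      Multiset.filter_cons_of_pos (p := fun c => ¬P c) _ hPb]
  have h3 := Multiset.filter_add_not P (a ::ₘ b ::ₘ W)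
  obtain ⟨v, w, hvw, hv, hw⟩ := HasParts.split hL (h3.symm ▸ hx) fun c hc d hd hcd => by
    rw [Multiset.mem_filter] at hc hd
    have hlt := hL.lt_of_feeds (hx.1 c hc.1) (hx.1 d hd.1) hcd
    rcases not_not.1 hc.2 with rfl | hbc
    · exact hd.2 (.inr hlt)
    · exact hd.2 (.inr (hL.lt_trans hbc hlt))
  rw [h1] at hv
  rw [h2] at hw
  exact ⟨_, _, v, w, fun c hc => (Multiset.mem_filter.1 hc).1,
    fun c hc => (Multiset.mem_filter.1 hc).1, hv, hw, hvw⟩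

theorem HasParts.eq_at' {v : (nuObj K).carrier} {W : Multiset hB.Elt}
    (h : hB.HasParts k (a ::ₘ W) v) (hW : ∀ c ∈ W, c.1 = k + 1) (hn : k + 1 < n) (α : Sgn) :
    v.1 α n = hB.at' α a n := by
  rw [h.2 n (by omega), atSum_cons, atSum_of_gt α fun c hc => by rw [hW c hc]; exact hn, add_zero]

theorem HasParts.isComp_d_right {v w z : (nuObj K).carrier} {W : Multiset hB.Elt}
    (h : hB.HasParts k (a ::ₘ W) v) (hW : ∀ c ∈ W, c.1 = k + 1) (ha : k + 1 < a.1) {α : Sgn}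
    (hz : (nuObj K).IsComp k v ((nuObj K).d α (k + 1) w) z) : hB.HasParts (k + 1) {a} z :=
  ⟨by simpa using ha, fun n hn β => by
    rw [nu_isComp_gt hz (by omega), h.eq_at' hW hn, nu_d_val, ADC.dseq_of_gt _ hn, add_zero,
      atSum_singleton]⟩

theorem HasParts.isComp_d_left {v w z : (nuObj K).carrier} {W : Multiset hB.Elt}
    (h : hB.HasParts k (a ::ₘ W) v) (hW : ∀ c ∈ W, c.1 = k + 1) (ha : k + 1 < a.1) {α : Sgn}
    (hz : (nuObj K).IsComp k ((nuObj K).d α (k + 1) w) v z) : hB.HasParts (k + 1) {a} z :=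
  ⟨by simpa using ha, fun n hn β => by
    rw [nu_isComp_gt hz (by omega), h.eq_at' hW hn, nu_d_val, ADC.dseq_of_gt _ hn, zero_add,
      atSum_singleton]⟩

theorem HasParts.isComp_unique {x y x' y' z : (nuObj K).carrier} (hx : hB.HasParts k L x)
    (hy : hB.HasParts k M y) (hx' : hB.HasParts k L x') (hy' : hB.HasParts k M y')
    (h : (nuObj K).IsComp k x y z) (h' : (nuObj K).IsComp k x' y' z) : x = x' ∧ y = y' :=
  nu_isComp_unique h h' (fun n hn α => by rw [hx.2 n hn, hx'.2 n hn])
    (fun n hn α => by rw [hy.2 n hn, hy'.2 n hn])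

include hg in
theorem LiftsAtoms.eq_d (hi : InjOnSimple hB f k) {α : Sgn}
    (h : f.toFun x = (nuObj K).d α k (f.toFun y)) : x = C.d α k y := by
  refine hi _ _ (.inl (hg.level_of_map ?_)) (.inl (C.d_d_of_le le_rfl _ _ _))
    (by rw [h, f.map_d])
  rw [h, (nuObj K).d_d_of_le le_rfl]

include hg hL in
-- The swap is an Eckmann–Hilton argument one dimension down. As `a` does not feed `b`, the image of
-- `z` has both among its parts above `k`, and it factors under `#ₖ` with `a` and `b` on different
-- sides. Lifting this factorization to `C` exhibits `z` as a `#ₖ`-composite, which the two exchange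
-- laws expand under `#ₖ₊₁` in either order.
theorem LiftsAtoms.canSwap_succ (hs : CanSwap hB f k) (hi : InjOnSimple hB f (k + 1)) :
    CanSwap hB f (k + 1) := by
  intro a b x y z hx hy hz hab
  by_cases hne : a = b
  · subst hne
    exact ⟨x, y, hz, hx, hy⟩
  have ha : k + 1 < a.1 := hx.1 a (by simp)
  have hb : k + 1 < b.1 := hy.1 b (by simp)
  have hlt := Nat.lt_succ_self k
  have hfz := f.isComp hz
  obtain ⟨W, hW1, hW⟩ := hx.descend_isComp hL hy hfz hab
  obtain ⟨L, hLx⟩ := hg.exists_isSeq_of_hasParts hL hx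
  obtain ⟨M, hMy⟩ := hg.exists_isSeq_of_hasParts hL hy
  by_cases hba : hL.lt k b a
  · rw [Multiset.cons_swap] at hW
    obtain ⟨U, V, v, w, hU', hV', hv, hw, hvw⟩ := hW.separate hL (Ne.symm hne)
      fun h => hL.lt_irrefl k a (hL.lt_trans h hba)
    obtain ⟨s, t, hs', ht, hst⟩ := hvw.exchange_neg_pos hlt
    obtain ⟨rfl, rfl⟩ := HasParts.isComp_unique
      (hw.isComp_d_left (fun c hc => hW1 c (hV' c hc)) ha hs')
      (hv.isComp_d_right (fun c hc => hW1 c (hU' c hc)) hb ht) hx hy hst hfz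
    obtain ⟨R, -, hR, -⟩ := exists_hasParts_d (hB := hB) v .neg k
    obtain ⟨R', -, hR', -⟩ := exists_hasParts_d (hB := hB) w .pos k
    -- In `ν K`, `x` and `y` are whiskerings of the `#ₖ`-factors `w` and `v`. Lift each separately;
    -- injectivity then identifies the whiskering cells as `p = d⁻p'` and `q' = d⁺q`, so that `p' #ₖ
    -- q` is `z`.
    obtain ⟨p, q, hpq, hp, rfl⟩ := hLx.lift hL hU hs hR hw hs'
    obtain ⟨p', q', hpq', rfl, hq'⟩ := hMy.lift hL hU hs hv hR' ht
    rw [hg.eq_d hi hp] at hpq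
    rw [hg.eq_d hi hq'] at hpq'
    obtain ⟨z', hz'⟩ : ∃ z', C.IsComp k p' q z' := OmegaCat.exists_isComp (by
      rw [hpq'.cond, C.d_d_of_lt hlt])
    obtain ⟨i, j, hi', hj, hij⟩ := hz'.exchange_neg_pos hlt
    rw [hi'.eq hpq, hj.eq hpq'] at hij
    rw [hij.eq hz] at hz'
    obtain ⟨y', x', hy', hx', hyx⟩ := hz'.exchange_pos_neg hlt
    have h1 := f.isComp hy'
    have h2 := f.isComp hx'
    rw [f.map_d] at h1 h2
    exact ⟨y', x', hyx, hv.isComp_d_right (fun c hc => hW1 c (hU' c hc)) hb h1,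
      hw.isComp_d_left (fun c hc => hW1 c (hV' c hc)) ha h2⟩
  · obtain ⟨U, V, v, w, hU', hV', hv, hw, hvw⟩ := hW.separate hL hne hba
    obtain ⟨s, t, hs', ht, hst⟩ := hvw.exchange_pos_neg hlt
    obtain ⟨rfl, rfl⟩ := HasParts.isComp_unique
      (hv.isComp_d_right (fun c hc => hW1 c (hU' c hc)) ha hs')
      (hw.isComp_d_left (fun c hc => hW1 c (hV' c hc)) hb ht) hx hy hst hfz
    obtain ⟨R, -, hR, -⟩ := exists_hasParts_d (hB := hB) w .neg k
    obtain ⟨R', -, hR', -⟩ := exists_hasParts_d (hB := hB) v .pos k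
    -- The mirror image, with `a` in the left `#ₖ`-factor: here `q = d⁻q'`, `p' = d⁺p`, and `z = p
    -- #ₖ q'`.
    obtain ⟨p, q, hpq, rfl, hq⟩ := hLx.lift hL hU hs hv hR hs'
    obtain ⟨p', q', hpq', hp', rfl⟩ := hMy.lift hL hU hs hR' hw ht
    rw [hg.eq_d hi hq] at hpq
    rw [hg.eq_d hi hp'] at hpq'
    obtain ⟨z', hz'⟩ : ∃ z', C.IsComp k p q' z' := OmegaCat.exists_isComp (by
      rw [hpq.cond, C.d_d_of_lt hlt])
    obtain ⟨i, j, hi', hj, hij⟩ := hz'.exchange_pos_neg hlt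
    rw [hi'.eq hpq, hj.eq hpq'] at hij
    rw [hij.eq hz] at hz'
    obtain ⟨y', x', hy', hx', hyx⟩ := hz'.exchange_neg_pos hlt
    have h1 := f.isComp hy'
    have h2 := f.isComp hx'
    rw [f.map_d] at h1 h2
    exact ⟨y', x', hyx, hw.isComp_d_left (fun c hc => hW1 c (hV' c hc)) hb h1,
      hv.isComp_d_right (fun c hc => hW1 c (hU' c hc)) ha h2⟩

include hg hL in
theorem LiftsAtoms.canSwap_and_injOnSimple (k : ℕ) : CanSwap hB f k ∧ InjOnSimple hB f k := by
  induction k with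
  | zero => exact ⟨canSwap_zero hL (hU := hU), hg.injOnSimple_zero hL⟩
  | succ k ih =>
    have h := hg.injOnSimple_succ hL ih.1 ih.2
    exact ⟨hg.canSwap_succ hL ih.1 h, h⟩

include hg hL in
-- Any two elements lie in a common `C_N`, where both are simple.
theorem LiftsAtoms.injective : Function.Injective f.toFun := by
  intro x y h
  obtain ⟨N, hN, -⟩ := C.exists_dim x
  obtain ⟨M, hM, -⟩ := C.exists_dim y
  exact (hg.canSwap_and_injOnSimple hL (max N M)).2 x y
    (.inl (OmegaCat.level_mono hN (le_max_left _ _)))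
    (.inl (OmegaCat.level_mono hM (le_max_right _ _))) h

include hg hL in
-- Atoms have lifts and generate; injectivity ensures that composable images have composable
-- preimages.
theorem LiftsAtoms.surjective : Function.Surjective f.toFun := by
  intro x
  obtain ⟨N, hN, -⟩ := (nuObj K).exists_dim x
  have hx := composite_nuAtom hL hU hN
  clear hN
  induction hx with
  | of x hx =>
    obtain ⟨b, rfl, -⟩ := hx
    exact ⟨g b, hg.map b⟩
  | comp m x y h _ _ ihx ihy =>
    obtain ⟨u, rfl⟩ := ihx
    obtain ⟨v, rfl⟩ := ihy
    have h' : C.d .pos m u = C.d .neg m v := hg.injective hL (by rw [f.map_d, f.map_d, h])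
    exact ⟨C.comp m u v h', f.map_comp m u v h' h⟩

end ADC.IsBasis

/-! ## Isomorphisms -/

theorem OmegaCat.isIso_of_bijective {C D : OmegaCat.{u}} (f : C ⟶ D)
    (hf : Function.Bijective (OmegaCat.Hom.toFun f)) : IsIso f := by
  let e := Equiv.ofBijective _ hf
  have he : ∀ x, OmegaCat.Hom.toFun f (e.symm x) = x := e.apply_symm_apply
  have hd : ∀ α n x, e.symm (D.d α n x) = C.d α n (e.symm x) := fun α n x =>
    hf.1 (by rw [he, OmegaCat.Hom.map_d f, he])
  refine ⟨⟨⟨e.symm, hd, fun n x y h h' => hf.1 ?_⟩, ?_, ?_⟩⟩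
  · rw [he, OmegaCat.Hom.map_comp f n _ _ h' (by rwa [he, he])]
    congr 1 <;> exact (he _).symm
  · exact OmegaCat.hom_ext fun x => e.symm_apply_apply x
  · exact OmegaCat.hom_ext fun x => he x

namespace ADC

/-- A morphism that is bijective in each degree and that reflects the distinguished submonoids. -/
structure Hom.IsEquiv {K L : ADC.{u}} (f : Hom K L) : Prop where
  bijective : ∀ n, Function.Bijective (f.app n)
  mem_pos : ∀ n x, f.app n x ∈ L.pos n → x ∈ K.pos n

theorem Hom.IsEquiv.isIso {K L : ADC.{u}} {f : K ⟶ L} (hf : Hom.IsEquiv f) : IsIso f := by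
  let e := fun n => AddEquiv.ofBijective (Hom.app f n) (hf.bijective n)
  have he : ∀ n x, Hom.app f n ((e n).symm x) = x := fun n => (e n).apply_symm_apply
  refine ⟨⟨homMk (fun n => (e n).symm.toAddMonoidHom) (fun n x => (hf.bijective n).1 ?_)
    (fun x => ?_) (fun n x hx => hf.mem_pos n _ ?_), ?_, ?_⟩⟩
  · change Hom.app f n ((e n).symm (L.bd n x)) = Hom.app f n (K.bd n ((e (n + 1)).symm x))
    rw [he, Hom.app_bd, he]
  · have h := Hom.aug_map f ((e 0).symm x)
    change L.aug (Hom.app f 0 ((e 0).symm x)) = K.aug ((e 0).symm x) at h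
    rw [he] at h
    exact h.symm
  · change Hom.app f n ((e n).symm x) ∈ L.pos n
    rwa [he]
  · exact ADC.hom_ext fun n => AddMonoidHom.ext fun x => (e n).symm_apply_apply x
  · exact ADC.hom_ext fun n => AddMonoidHom.ext fun x => he n x

theorem Hom.isEquiv_of_isIso {K L : ADC.{u}} (f : K ⟶ L) [IsIso f] : Hom.IsEquiv f := by
  have h1 : ∀ n x, Hom.app (inv f) n (Hom.app f n x) = x := fun n x =>
    DFunLike.congr_fun (congrArg (fun g : K ⟶ K => Hom.app g n) (IsIso.hom_inv_id f)) x
  have h2 : ∀ n x, Hom.app f n (Hom.app (inv f) n x) = x := fun n x =>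
    DFunLike.congr_fun (congrArg (fun g : L ⟶ L => Hom.app g n) (IsIso.inv_hom_id f)) x
  refine ⟨fun n => ⟨Function.LeftInverse.injective (h1 n), Function.RightInverse.surjective (h2 n)⟩,
    fun n x hx => ?_⟩
  rw [← h1 n x]
  exact Hom.map_pos (inv f) n _ hx

/-! ### Transport of bases along isomorphisms -/

section Pullback

variable {K L : ADC.{u}} {f : Hom K L} {B : ∀ n, Set (L.X n)} (hf : f.IsEquiv)
  (hB : L.IsBasis B)

include hf hB in
theorem IsBasis.pullback : K.IsBasis fun n => f.app n ⁻¹' B n := by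
  let e := fun n => AddEquiv.ofBijective (f.app n) (hf.bijective n)
  let el : ∀ n, K.X n ≃ₗ[ℤ] L.X n := fun n => (e n).toIntLinearEquiv
  have himg : ∀ n, f.app n '' (f.app n ⁻¹' B n) = B n := fun n =>
    Set.image_preimage_eq _ (hf.bijective n).2
  refine ⟨fun n => ?_, fun n => ?_, fun n => ?_⟩
  · refine LinearIndependent.of_comp (el n).toLinearMap ?_
    let j : (f.app n ⁻¹' B n : Set (K.X n)) → B n := fun b => ⟨f.app n b, b.2⟩
    have hj : Function.Injective j := fun a b hab =>
      Subtype.ext ((hf.bijective n).1 (congrArg Subtype.val hab))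
    exact (hB.linearIndependent n).comp j hj
  · apply Submodule.map_injective_of_injective (f := (el n).toLinearMap) (el n).injective
    rw [Submodule.map_span, Submodule.map_top, LinearEquiv.range]
    have : (el n).toLinearMap '' (f.app n ⁻¹' B n) = B n := himg n
    rw [this, hB.span_eq_top]
  · ext x
    have h1 : x ∈ K.pos n ↔ f.app n x ∈ L.pos n := ⟨f.map_pos n x, hf.mem_pos n x⟩
    have h2 : L.pos n = (AddSubmonoid.closure (f.app n ⁻¹' B n)).map (f.app n) := by
      rw [AddMonoidHom.map_mclosure, himg, hB.pos_eq]
    rw [h1, h2]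
    exact AddSubmonoid.mem_map_iff_mem (hf.bijective n).1

/-- The map of basis elements. -/
def pullbackElt : (IsBasis.pullback hf hB).Elt → hB.Elt := fun b => ⟨b.1, f.app b.1 b.2, b.2.2⟩

theorem pullbackElt_injective : Function.Injective (pullbackElt hf hB) := by
  rintro ⟨n, a⟩ ⟨m, b⟩ h
  obtain rfl : n = m := congrArg Sigma.fst h
  have h1 : (⟨f.app n a, a.2⟩ : B n) = ⟨f.app n b, b.2⟩ := eq_of_heq (Sigma.ext_iff.1 h).2
  exact congrArg (Sigma.mk n) (Subtype.ext ((hf.bijective n).1 (congrArg Subtype.val h1)))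

theorem IsBasis.coef_app {n : ℕ} (b : (f.app n ⁻¹' B n : Set (K.X n))) (x : K.X n) :
    hB.coef ⟨f.app n b, b.2⟩ (f.app n x) = (IsBasis.pullback hf hB).coef b x := by
  have hB' := IsBasis.pullback hf hB
  have : (hB.coef ⟨f.app n b, b.2⟩).comp (f.app n) = hB'.coef b := by
    have : ((hB.coef ⟨f.app n b, b.2⟩).comp (f.app n)).toIntLinearMap =
        (hB'.coef b).toIntLinearMap := by
      refine (hB'.basis n).ext fun c => ?_
      rw [hB'.basis_apply]
      change hB.coef ⟨f.app n b, b.2⟩ (f.app n c) = hB'.coef b c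
      by_cases hbc : b = c
      · subst hbc
        rw [hB'.coef_self]
        exact hB.coef_self ⟨f.app n b, b.2⟩
      · rw [hB'.coef_ne hbc]
        refine hB.coef_ne (c := ⟨f.app n c, c.2⟩) fun h => hbc (Subtype.ext ?_)
        exact (hf.bijective n).1 (congrArg Subtype.val h)
    exact AddMonoidHom.ext fun x => DFunLike.congr_fun this x
  exact DFunLike.congr_fun this x

theorem IsBasis.app_part {n : ℕ} (α : Sgn) (x : K.X n) :
    f.app n ((IsBasis.pullback hf hB).part α x) = hB.part α (f.app n x) := by
  refine hB.coef_ext fun c => ?_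
  obtain ⟨c, hc⟩ := c
  obtain ⟨b, rfl⟩ := (hf.bijective n).2 c
  rw [hB.coef_app hf ⟨b, hc⟩, coef_part, coef_part, hB.coef_app hf ⟨b, hc⟩]

theorem IsBasis.app_bdPart {n : ℕ} (α : Sgn) (x : K.X (n + 1)) :
    f.app n ((IsBasis.pullback hf hB).bdPart α x) = hB.bdPart α (f.app (n + 1) x) := by
  rw [bdPart, hB.app_part hf, bdPart, f.app_bd]

theorem IsBasis.app_atom {n : ℕ} (α : Sgn) (x : K.X n) (m : ℕ) :
    f.app m ((IsBasis.pullback hf hB).atom α x m) = hB.atom α (f.app n x) m := by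
  rcases le_or_gt m n with h | h
  · obtain ⟨j, hj⟩ := Nat.exists_eq_add_of_le h
    induction j generalizing m with
    | zero =>
      obtain rfl : n = m := hj
      rw [atom_self, atom_self]
    | succ j ih =>
      rw [atom_of_lt _ _ _ (by omega : m < n), atom_of_lt _ _ _ (by omega : m < n),
        hB.app_bdPart hf,
        ih (m + 1) (by omega) (by omega)]
  · rw [atom_of_gt _ _ _ h, atom_of_gt _ _ _ h, map_zero]

theorem IsBasis.IsUnital.pullback {hB : L.IsBasis B} (hU : hB.IsUnital) :
    (IsBasis.pullback hf hB).IsUnital := by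
  intro n b hb α
  rw [← hU n (f.app n b) hb α, ← hB.app_atom hf]
  exact (f.aug_map _).symm

theorem IsBasis.feeds_pullback {n : ℕ} {a b : (IsBasis.pullback hf hB).Elt}
    (h : (IsBasis.pullback hf hB).Feeds n a b) :
    hB.Feeds n (pullbackElt hf hB a) (pullbackElt hf hB b) := by
  obtain ⟨c, h1, h2⟩ := h
  rw [← hB.coef_app hf, at', hB.app_atom hf] at h1 h2
  exact ⟨⟨f.app n c, c.2⟩, h1, h2⟩

theorem IsBasis.IsLoopFree.pullback {hB : L.IsBasis B} (hL : hB.IsLoopFree) :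
    (IsBasis.pullback hf hB).IsLoopFree := by
  rw [isLoopFree_iff] at hL ⊢
  obtain ⟨le, hle⟩ := hL
  exact ⟨fun n => @PartialOrder.lift _ _ (le n) _ (pullbackElt_injective hf hB),
    fun n a b ha hb hab => hle n _ _ ha hb (hB.feeds_pullback hf hab)⟩

theorem Hom.le_app (f : Hom K L) {n : ℕ} {x y : K.X n} (h : K.Le x y) :
    L.Le (f.app n x) (f.app n y) := by
  rw [ADC.Le, ← map_sub]
  exact f.map_pos n _ h

theorem IsBasis.IsStronglyLoopFree.pullback {hB : L.IsBasis B} (hL : hB.IsStronglyLoopFree) :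
    (IsBasis.pullback hf hB).IsStronglyLoopFree := by
  obtain ⟨le, h1, h2⟩ := hL
  refine ⟨@PartialOrder.lift _ _ le _ (pullbackElt_injective hf hB), fun n a b hab => ?_,
    fun n a b hab => ?_⟩
  · have := f.le_app hab
    rw [hB.app_bdPart hf] at this
    exact h1 n ⟨f.app n a, a.2⟩ ⟨f.app (n + 1) b, b.2⟩ this
  · have := f.le_app hab
    rw [hB.app_bdPart hf] at this
    exact h2 n ⟨f.app (n + 1) a, a.2⟩ ⟨f.app n b, b.2⟩ this

end Pullback

end ADC

theorem stronglyLoopFreeUnital_of_isEquiv {K L : ADC.{u}} {f : ADC.Hom K L} (hf : f.IsEquiv)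
    (h : StronglyLoopFreeUnital L) : StronglyLoopFreeUnital K := by
  obtain ⟨B, hB, hS, hU⟩ := h
  exact ⟨_, hB.pullback hf, hS.pullback hf, hU.pullback hf⟩

/-! ## The counit -/

namespace ADC.IsBasis

variable {K : ADC.{u}} {B : ∀ n, Set (K.X n)} {hB : K.IsBasis B} (hL : hB.IsLoopFree)
  (hU : hB.IsUnital)

/-- The identity morphism of an `ω`-category. -/
def idHom (C : OmegaCat.{u}) : OmegaCat.Hom C C := 𝟙 C

include hL in
-- Makes the results about levels of composites available in `ν K` itself.
theorem liftsAtoms_id : LiftsAtoms hU (idHom (nuObj K)) (nuAtom hU) where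
  map _ := rfl
  level := nuAtom_level hU
  gen _ _ h := composite_nuAtom hL hU h

/-- The atom `⟨b⟩` as an element of `(ν K)ₙ` for `n = |b|`. -/
noncomputable def atomLevel (b : hB.Elt) : (nuObj K).Level b.1 :=
  ⟨nuAtom hU b, nuAtom_level hU b⟩

/-- The homomorphism `b ↦ [⟨b⟩]ₙ`, inverse to the counit. -/
noncomputable def atomCls (n : ℕ) : K.X n →+ (nuObj K).LamGroup n :=
  ((hB.basis n).constr ℤ fun b =>
    OmegaCat.cls (atomLevel hU ⟨n, b⟩)).toAddMonoidHom

theorem atomCls_apply {n : ℕ} (b : B n) : atomCls hU n (b : K.X n) =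
    OmegaCat.cls (atomLevel hU ⟨n, b⟩) := by
  rw [← hB.basis_apply]
  exact (hB.basis n).constr_basis ℤ _ b

include hL in
-- Both sides are additive under `#ₘ` for `m < n`, so atoms suffice; an atom of dimension less than
-- `n` gives `0` on both sides.
theorem atomCls_topComp {n : ℕ} (x : (nuObj K).Level n) :
    atomCls hU n (x.1.1 .neg n) = OmegaCat.cls x := by
  obtain ⟨x, hx⟩ := x
  have hc := composite_nuAtom hL hU hx
  change atomCls hU n (x.1 .neg n) = _
  induction hc with
  | of x h =>
    obtain ⟨b, rfl, hb⟩ := h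
    rw [nuAtom_val]
    rcases hb.lt_or_eq with hb | rfl
    · rw [hB.at'_of_gt _ b hb, map_zero]
      exact (OmegaCat.cls_eq_zero hb _ (nuAtom_level hU b)).symm
    · rw [hB.at'_self, atomCls_apply]
      rfl
  | comp m x y h hcx hcy ihx ihy =>
    have hz : (nuObj K).IsComp m x y ((nuObj K).comp m x y h) := ⟨h, rfl⟩
    have hxn := (liftsAtoms_id hL hU).level_of_composite hcx
    have hyn := (liftsAtoms_id hL hU).level_of_composite hcy
    rcases lt_or_ge m n with hm | hm
    · rw [OmegaCat.cls_comp hm ⟨x, hxn⟩ ⟨y, hyn⟩ ⟨_, hx⟩ h rfl, ← ihx hxn, ← ihy hyn, ← map_add,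
        nu_isComp_gt hz hm]
    · have heq := hz.eq_right (OmegaCat.level_mono hxn hm)
      have : (⟨(nuObj K).comp m x y h, hx⟩ : (nuObj K).Level n) = ⟨y, hyn⟩ := Subtype.ext heq
      rw [this, heq, ihy hyn]

include hL in
theorem atomCls_piMap {n : ℕ} (u : (nuObj K).LamGroup n) : atomCls hU n (piMap K n u) = u := by
  have : (atomCls hU n).comp (piMap K n) = AddMonoidHom.id _ :=
    OmegaCat.lamGroup_hom_ext fun x => by
      rw [AddMonoidHom.comp_apply, piMap_cls]
      exact atomCls_topComp hL hU x
  exact DFunLike.congr_fun this u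

theorem piMap_atom {n : ℕ} (b : B n) :
    piMap K n (OmegaCat.cls (atomLevel hU ⟨n, b⟩)) = b := by
  rw [piMap_cls]
  exact hB.at'_self .neg ⟨n, b⟩

theorem piMap_atomCls {n : ℕ} (x : K.X n) : piMap K n (atomCls hU n x) = x := by
  have : ((piMap K n).comp (atomCls hU n)).toIntLinearMap = LinearMap.id :=
    (hB.basis n).ext fun b => by
      rw [hB.basis_apply]
      change piMap K n (atomCls hU n b) = b
      rw [atomCls_apply, piMap_atom]
  exact DFunLike.congr_fun this x

include hL hU in
theorem isEquiv_piApp : ADC.Hom.IsEquiv (piApp K) where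
  bijective n := ⟨Function.LeftInverse.injective (g := atomCls hU n) (atomCls_piMap hL hU),
    Function.RightInverse.surjective (g := atomCls hU n) (piMap_atomCls hU)⟩
  mem_pos n u hu := by
    change piMap K n u ∈ K.pos n at hu
    rw [← atomCls_piMap hL hU u]
    have : K.pos n ≤ ((lamObj (nuObj K)).pos n).comap (atomCls hU n) := by
      rw [hB.pos_eq, AddSubmonoid.closure_le]
      intro b hb
      change atomCls hU n ((⟨b, hb⟩ : B n) : K.X n) ∈ (lamObj (nuObj K)).pos n
      rw [atomCls_apply]
      exact AddSubmonoid.subset_closure ⟨_, rfl⟩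
    exact this hu

/-- The dimension of an atom. -/
noncomputable def atomDim (e : Set.range (nuAtom hU)) : ℕ := e.2.choose.1

theorem atomDim_eq (b : hB.Elt) : atomDim hU ⟨nuAtom hU b, b, rfl⟩ = b.1 := by
  have h : ∃ c, nuAtom hU c = nuAtom hU b := ⟨b, rfl⟩
  exact congrArg Sigma.fst (nuAtom_injective hU h.choose_spec)

include hL in
theorem isCompGen_atoms : (nuObj K).IsCompGen (Set.range (nuAtom hU)) (atomDim hU) := by
  intro n x
  have : {y | ∃ e : Set.range (nuAtom hU), e.1 = y ∧ atomDim hU e ≤ n} =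
      {y | ∃ b : hB.Elt, nuAtom hU b = y ∧ b.1 ≤ n} := by
    ext y
    constructor
    · rintro ⟨⟨_, b, rfl⟩, rfl, h⟩
      rw [atomDim_eq] at h
      exact ⟨b, rfl, h⟩
    · rintro ⟨b, rfl, h⟩
      exact ⟨⟨_, b, rfl⟩, rfl, (atomDim_eq hU b).le.trans h⟩
  rw [this]
  exact ⟨composite_nuAtom hL hU, (liftsAtoms_id hL hU).level_of_composite⟩

theorem gen_atom (h : (nuObj K).IsCompGen (Set.range (nuAtom hU)) (atomDim hU)) (b : hB.Elt) :
    h.gen ⟨nuAtom hU b, b, rfl⟩ =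
      ⟨b.1, OmegaCat.cls (atomLevel hU b)⟩ := by
  -- The dimension of an atom is obtained by choice and equals `|b|` only propositionally, hence the
  -- detour through an arbitrary equality of degrees.
  have key : ∀ (n m : ℕ) (hnm : n = m) (x : (nuObj K).carrier) (hn : (nuObj K).d .neg n x = x)
      (hm : (nuObj K).d .neg m x = x),
      (⟨n, OmegaCat.cls (C := nuObj K) ⟨x, hn⟩⟩ : Σ n, (lam.obj (nuObj K)).X n) =
        ⟨m, OmegaCat.cls (C := nuObj K) ⟨x, hm⟩⟩ := by
    rintro n _ rfl x _ _
    rfl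
  exact key _ _ (atomDim_eq hU b) _ _ _

/-- The action of the counit on homogeneous elements. -/
def piSigma (K : ADC.{u}) (z : Σ n, (lam.obj (nuObj K)).X n) : Σ n, K.X n :=
  ⟨z.1, piMap K z.1 z.2⟩

theorem piSigma_gen (h : (nuObj K).IsCompGen (Set.range (nuAtom hU)) (atomDim hU)) (b : hB.Elt) :
    piSigma K (h.gen ⟨nuAtom hU b, b, rfl⟩) = ⟨b.1, b.2⟩ := by
  rw [gen_atom]
  exact congrArg (Sigma.mk b.1) (piMap_atom hU b.2)

include hL in
-- Identifies the basis given by the atoms with the preimage of `B` under the counit, so that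
-- properties of `B` transfer by pullback.
theorem genSet_atoms (h : (nuObj K).IsCompGen (Set.range (nuAtom hU)) (atomDim hU)) :
    h.genSet = fun n => ADC.Hom.app (piApp K) n ⁻¹' B n := by
  funext n
  ext z
  constructor
  · rintro ⟨⟨_, b, rfl⟩, hb⟩
    have h1 := congrArg (piSigma K) hb
    rw [piSigma_gen] at h1
    obtain ⟨m, b⟩ := b
    obtain rfl : m = n := congrArg Sigma.fst h1
    have h2 : (b : K.X m) = piMap K m z := eq_of_heq (Sigma.ext_iff.1 h1).2
    change piMap K m z ∈ B m
    rw [← h2]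
    exact b.2
  · intro hz
    change piMap K n z ∈ B n at hz
    refine ⟨⟨_, ⟨n, ⟨_, hz⟩⟩, rfl⟩, ?_⟩
    rw [gen_atom]
    refine congrArg (Sigma.mk n) ?_
    change OmegaCat.cls _ = z
    rw [← atomCls_apply]
    exact atomCls_piMap hL hU z

include hL in
theorem isBasis_atoms : (nuObj K).IsBasis (Set.range (nuAtom hU)) (atomDim hU) where
  isCompGen := isCompGen_atoms hL hU
  gen_injective := by
    rintro ⟨_, a, rfl⟩ ⟨_, b, rfl⟩ h
    have h1 := congrArg (piSigma K) h
    rw [piSigma_gen, piSigma_gen] at h1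
    have : a = b := by
      obtain ⟨n, a⟩ := a
      obtain ⟨m, b⟩ := b
      obtain rfl : n = m := congrArg Sigma.fst h1
      exact congrArg (Sigma.mk n) (Subtype.ext (eq_of_heq (Sigma.ext_iff.1 h1).2))
    subst this
    rfl
  isBasis := by
    rw [genSet_atoms hL hU]
    exact hB.pullback (isEquiv_piApp hL hU)

theorem isLoopFree_congr {B B' : ∀ n, Set (K.X n)} (h : B = B') (hB : K.IsBasis B)
    (hB' : K.IsBasis B') (hL : hB.IsLoopFree) : hB'.IsLoopFree := by
  subst h
  exact hL

theorem isStronglyLoopFree_congr {B B' : ∀ n, Set (K.X n)} (h : B = B') (hB : K.IsBasis B)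
    (hB' : K.IsBasis B') (hL : hB.IsStronglyLoopFree) : hB'.IsStronglyLoopFree := by
  subst h
  exact hL

/-- The counit carries `[dₙᵅ⟨b⟩]ₙ` to `⟨b⟩ᵅₙ`, and `⟨b⟩⁻ₙ`, `⟨b⟩⁺ₙ` have disjoint supports by
loop-freeness. -/
theorem isAtomic_atoms : (isBasis_atoms hL hU).IsAtomic := by
  rintro ⟨_, b, rfl⟩ n hn
  rw [atomDim_eq] at hn
  refine (hB.pullback (isEquiv_piApp hL hU)).isMeet_iff.2 fun c => ?_
  have hf := isEquiv_piApp hL hU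
  let c' : B n := ⟨ADC.Hom.app (piApp K) n c, c.2⟩
  have key : ∀ α, (hB.pullback hf).coef c (OmegaCat.cls ((nuObj K).trunc α n (nuAtom hU b))) =
      hB.coef c' (hB.at' α b n) := fun α => by
    refine (hB.coef_app hf c _).symm.trans (congrArg (hB.coef c') ?_)
    exact (piMap_cls _).trans (ADC.dseq_self _ _ _ _)
  refine (map_zero ((hB.pullback hf).coef c)).trans
    (Eq.trans ?_ (congrArg₂ min (key .neg) (key .pos)).symm)
  have h1 := hL.coef_disjoint hn c'
  have h2 := hB.coef_at'_nonneg .pos b c'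
  have h3 := hB.coef_at'_nonneg .neg b c'
  omega

end ADC.IsBasis

/-! ### Images of the subcategories under `ν` -/

theorem LoopFreeUnital.nu {K : ADC.{u}} (h : LoopFreeUnital K) : LoopFreeAtomic (nu.obj K) := by
  obtain ⟨B, hB, hL, hU⟩ := h
  exact ⟨_, _, ADC.IsBasis.isBasis_atoms hL hU,
    ADC.IsBasis.isLoopFree_congr (ADC.IsBasis.genSet_atoms hL hU _).symm _ _
      (hL.pullback (ADC.IsBasis.isEquiv_piApp hL hU)), ADC.IsBasis.isAtomic_atoms hL hU⟩

theorem StronglyLoopFreeUnital.nu {K : ADC.{u}} (h : StronglyLoopFreeUnital K) :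
    StronglyLoopFreeAtomic (nu.obj K) := by
  obtain ⟨B, hB, hS, hU⟩ := h
  have hL := hS.isLoopFree
  exact ⟨_, _, ADC.IsBasis.isBasis_atoms hL hU,
    ADC.IsBasis.isStronglyLoopFree_congr (ADC.IsBasis.genSet_atoms hL hU _).symm _ _
      (hS.pullback (ADC.IsBasis.isEquiv_piApp hL hU)), ADC.IsBasis.isAtomic_atoms hL hU⟩

theorem LoopFreeUnital.isEquiv_piApp {K : ADC.{u}} (h : LoopFreeUnital K) :
    ADC.Hom.IsEquiv (piApp K) := by
  obtain ⟨B, hB, hL, hU⟩ := h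
  exact ADC.IsBasis.isEquiv_piApp hL hU

/-! ## The unit -/

/-- Positive elements with zero meet are the positive and negative parts of their difference, so the
components of `x` satisfy the recursion that defines the atom. -/
theorem ADC.IsBasis.eq_atom {K : ADC.{u}} {B : ∀ n, Set (K.X n)} (hB : K.IsBasis B)
    {x : K.DSeq} (hx : ADC.IsNu x) {n : ℕ} {b : K.X n} (hb : ∀ α, x α n = b)
    (hd : ∀ m < n, K.IsMeet (x .neg m) (x .pos m) 0) {m : ℕ} (hm : m ≤ n) (α : Sgn) :
    x α m = hB.atom α b m := by
  obtain ⟨j, hj⟩ := Nat.exists_eq_add_of_le hm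
  induction j generalizing m with
  | zero =>
    obtain rfl : n = m := hj
    rw [hB.atom_self, hb]
  | succ j ih =>
    have hmn : m < n := by omega
    rw [hB.atom_of_lt _ _ hmn, ← ih (m := m + 1) (by omega) (by omega), bdPart, hx.bd]
    refine hB.coef_ext fun c => ?_
    have h1 := hB.isMeet_iff.1 (hd m hmn) c
    have h2 := hB.mem_pos_iff.1 (hx.pos m .neg) c
    have h3 := hB.mem_pos_iff.1 (hx.pos m .pos) c
    rw [map_zero] at h1
    cases α
    · rw [coef_part_neg, map_sub]
      omega
    · rw [coef_part_pos, map_sub]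
      omega

namespace OmegaCat.IsBasis

variable {C : OmegaCat.{u}} {E : Set C.carrier} {dim : E → ℕ} {h : C.IsBasis E dim}

theorem IsAtomic.etaSeq_eq (ha : h.IsAtomic) (e : E) (α : Sgn) (m : ℕ) :
    etaSeq C e.1 α m = h.isBasis.atom α (h.isCompGen.gen e).2 m := by
  rcases le_or_gt m (dim e) with hm | hm
  · exact h.isBasis.eq_atom (etaSeq_isNu C e.1)
      (fun α => congrArg cls (trunc_level α ⟨e.1, h.isCompGen.mem_level e⟩)) (ha e) hm α
  · refine (cls_eq_zero hm _ ?_).trans (h.isBasis.atom_of_gt α _ hm).symm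
    have := h.isCompGen.mem_level e
    change C.d .neg (dim e) (C.d α m e.1) = C.d α m e.1
    rw [← this, C.d_d_of_le hm.le, C.d_d_of_le le_rfl]

/-- By atomicity `⟨[e]⟩ᵅ₀` is the class `[d₀ᵅe]₀`, whose augmentation is `1`. -/
theorem IsAtomic.isUnital (ha : h.IsAtomic) : h.isBasis.IsUnital := by
  rintro n b ⟨e, he⟩ α
  obtain rfl : dim e = n := congrArg Sigma.fst he
  obtain rfl : (h.isCompGen.gen e).2 = b := eq_of_heq (Sigma.ext_iff.1 he).2
  exact (congrArg C.lamAug (ha.etaSeq_eq e α 0).symm).trans ((etaSeq_isNu C e.1).aug α)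

variable (h) in
/-- The member of a basis of `C` that corresponds to a basis element of `λ C`. -/
noncomputable def elt (b : h.isBasis.Elt) : E := b.2.2.choose

theorem gen_elt (b : h.isBasis.Elt) : h.isCompGen.gen (h.elt b) = ⟨b.1, b.2⟩ :=
  b.2.2.choose_spec

theorem dim_elt (b : h.isBasis.Elt) : dim (h.elt b) = b.1 := congrArg Sigma.fst (gen_elt b)

theorem elt_gen (e : E) : h.elt ⟨dim e, (h.isCompGen.gen e).2, e, rfl⟩ = e :=
  h.gen_injective (gen_elt _)

/-- Brings the unit under the general bijectivity result for morphisms that lift atoms. -/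
theorem IsAtomic.liftsAtoms (ha : h.IsAtomic) :
    ADC.IsBasis.LiftsAtoms ha.isUnital (etaApp C) fun b => (h.elt b).1 where
  map b := nuObj_ext fun α m => by
    change etaSeq C (h.elt b).1 α m = h.isBasis.at' α b m
    rw [ha.etaSeq_eq, gen_elt]
    rfl
  level b := by
    rw [← dim_elt b]
    exact h.isCompGen.mem_level _
  gen n x hx := ((h.isCompGen n x).1 hx).mono (by
    rintro y ⟨e, rfl, he⟩
    exact ⟨⟨dim e, (h.isCompGen.gen e).2, e, rfl⟩, congrArg Subtype.val (elt_gen e), he⟩)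

end OmegaCat.IsBasis

theorem LoopFreeAtomic.lam {C : OmegaCat.{u}} (h : LoopFreeAtomic C) :
    LoopFreeUnital (lam.obj C) := by
  obtain ⟨E, dim, h, hL, ha⟩ := h
  exact ⟨_, h.isBasis, hL, ha.isUnital⟩

theorem StronglyLoopFreeAtomic.lam {C : OmegaCat.{u}} (h : StronglyLoopFreeAtomic C) :
    StronglyLoopFreeUnital (lam.obj C) := by
  obtain ⟨E, dim, h, hL, ha⟩ := h
  exact ⟨_, h.isBasis, hL, ha.isUnital⟩

theorem LoopFreeAtomic.isIso_etaApp {C : OmegaCat.{u}} (h : LoopFreeAtomic C) :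
    IsIso (etaApp C) := by
  obtain ⟨E, dim, h, hL, ha⟩ := h
  exact OmegaCat.isIso_of_bijective _ ⟨ha.liftsAtoms.injective hL, ha.liftsAtoms.surjective hL⟩

theorem stronglyLoopFreeAtomic_le : StronglyLoopFreeAtomic.{u} ≤ LoopFreeAtomic := by
  rintro C ⟨E, dim, h, hS, ha⟩
  exact ⟨E, dim, h, ADC.IsBasis.IsStronglyLoopFree.isLoopFree _ hS, ha⟩

theorem stronglyLoopFreeUnital_le : StronglyLoopFreeUnital.{u} ≤ LoopFreeUnital := by
  rintro K ⟨B, hB, hS, hU⟩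
  exact ⟨B, hB, hS.isLoopFree, hU⟩

/-- By uniqueness, the strongly loop-free basis of `λ C` is the one that comes from the atomic basis
of `C`. -/
theorem stronglyLoopFreeAtomic_of_lam {C : OmegaCat.{u}} (h : LoopFreeAtomic C)
    (hS : StronglyLoopFreeUnital (lam.obj C)) : StronglyLoopFreeAtomic C := by
  obtain ⟨E, dim, h, -, ha⟩ := h
  obtain ⟨B, hB, hS, -⟩ := hS
  exact ⟨E, dim, h, ADC.IsBasis.isStronglyLoopFree_congr (hB.unique h.isBasis) hB _ hS, ha⟩

/-- The basis of `λ ν K` is transported to `K` along the inverse of the counit. -/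
theorem stronglyLoopFreeUnital_of_nu {K : ADC.{u}} (h : LoopFreeUnital K)
    (hS : StronglyLoopFreeAtomic (nu.obj K)) : StronglyLoopFreeUnital K := by
  have := h.isEquiv_piApp.isIso (f := piApp K)
  exact stronglyLoopFreeUnital_of_isEquiv (ADC.Hom.isEquiv_of_isIso (inv (piApp K))) hS.lam

/-! ## Restriction of adjunctions -/

theorem restrictsToAdjointEquivalence_of_isIso {𝒜 ℬ : Type*} [Category 𝒜] [Category ℬ]
    {L : 𝒜 ⥤ ℬ} {R : ℬ ⥤ 𝒜} (adj : L ⊣ R) {P : ObjectProperty 𝒜} {Q : ObjectProperty ℬ}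
    (hL : ∀ X, P X → Q (L.obj X)) (hR : ∀ Y, Q Y → P (R.obj Y))
    (hunit : ∀ X, P X → IsIso (adj.unit.app X)) (hcounit : ∀ Y, Q Y → IsIso (adj.counit.app Y)) :
    RestrictsToAdjointEquivalence adj P Q := by
  have h1 : ∀ X : P.FullSubcategory, IsIso (adj.unit.app X.obj) := fun X => hunit _ X.property
  have h2 : ∀ Y : Q.FullSubcategory, IsIso (adj.counit.app Y.obj) := fun Y => hcounit _ Y.property
  let hL' : ∀ X : P.FullSubcategory, Q (L.obj X.obj) := fun X => hL _ X.property
  let hR' : ∀ Y : Q.FullSubcategory, P (R.obj Y.obj) := fun Y => hR _ Y.property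
  refine ⟨hL', hR',
    NatIso.ofComponents (fun X => P.isoMk (asIso (adj.unit.app X.obj))) (fun f => ?_),
    NatIso.ofComponents (fun Y => Q.isoMk (asIso (adj.counit.app Y.obj))) (fun f => ?_),
    fun X => rfl, fun Y => rfl, fun X => ?_⟩
  · ext
    exact adj.unit.naturality f.hom
  · ext
    exact adj.counit.naturality f.hom
  · ext
    exact adj.left_triangle_components X.obj

end Steiner


theorem theorem5p11 :
    Steiner.RestrictsToAdjointEquivalence Steiner.lamNuAdj.{u}
      Steiner.LoopFreeAtomic Steiner.LoopFreeUnital ∧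
    Steiner.StronglyLoopFreeAtomic.{u} ≤ Steiner.LoopFreeAtomic ∧
    Steiner.StronglyLoopFreeUnital.{u} ≤ Steiner.LoopFreeUnital ∧
    Steiner.RestrictsToAdjointEquivalence Steiner.lamNuAdj.{u}
      Steiner.StronglyLoopFreeAtomic Steiner.StronglyLoopFreeUnital ∧
    (∀ C : Steiner.OmegaCat.{u}, Steiner.LoopFreeAtomic C →
      (Steiner.StronglyLoopFreeAtomic C ↔
        Steiner.StronglyLoopFreeUnital (Steiner.lam.obj C))) ∧
    (∀ K : Steiner.ADC.{u}, Steiner.LoopFreeUnital K →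
      (Steiner.StronglyLoopFreeUnital K ↔
        Steiner.StronglyLoopFreeAtomic (Steiner.nu.obj K))) :=
  ⟨Steiner.restrictsToAdjointEquivalence_of_isIso _ (fun _ h => h.lam) (fun _ h => h.nu)
      (fun _ h => h.isIso_etaApp) (fun _ h => h.isEquiv_piApp.isIso),
    Steiner.stronglyLoopFreeAtomic_le, Steiner.stronglyLoopFreeUnital_le,
    Steiner.restrictsToAdjointEquivalence_of_isIso _ (fun _ h => h.lam) (fun _ h => h.nu)
      (fun _ h => (Steiner.stronglyLoopFreeAtomic_le _ h).isIso_etaApp)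
      (fun _ h => (Steiner.stronglyLoopFreeUnital_le _ h).isEquiv_piApp.isIso),
    fun _ h => ⟨fun hS => hS.lam, Steiner.stronglyLoopFreeAtomic_of_lam h⟩,
    fun _ h => ⟨fun hS => hS.nu, Steiner.stronglyLoopFreeUnital_of_nu h⟩⟩
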